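/- Let $(Y,\phi)$ be a smooth $7$-manifold with a closed $\mathrm G_2$-structure $\phi\in\Omega^3(Y)$, inducing the metric $g_\phi$, let $M$ be a smooth $4$-manifold and let $\iota\colon M\to Y$ be a coassociative immersion, i.e. a smooth immersion with $\iota^*\phi=0$. Equip $M$ with the metric $\iota^*g_\phi$ and the orientation for which $\iota^*({*\phi})>0$; then $v\mapsto\iota^*(i_v\phi)$ identifies the normal bundle $N_\iota=\iota^*TY/TM$ with $\Lambda^2_+T^*M$. Let $\mathtt J\colon U\to Y$ be a tubular neighborhood of $\iota$: $U\subset\Lambda^2_+T^*M$ is a (fibrewise) convex open neighborhood of the zero section, $\mathtt J$ is a smooth open immersion which restricts to $\iota$ on the zero section, and for each $u\in U$ the image of $\partial_t\mathtt J(tu)|_{t=0}$ in $N_\iota\cong\Lambda^2_+T^*M$ is $u$. Let $\Gamma(U)\subset\Omega^2_+(M)$ be the set of smooth sections of $\Lambda^2_+T^*M$ with values in $U$ and, for $\omega\in\Gamma(U)$, put $\mathtt J_\omega(x)=\mathtt J(\omega_x)$ and $F_{\mathtt J}(\omega)=\mathtt J_\omega^*\phi\in\Omega^3(M)$. Then $F_{\mathtt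 J}$ takes values in the space $d\Omega^2(M)$ of exact $3$-forms, and there is a map $\mathcal N_{\mathtt J}\colon\Gamma(U)\to d\Omega^2(M)$ with $$F_{\mathtt J}(\omega)=d\omega+\mathcal N_{\mathtt J}(\omega)\qquad\text{for all }\omega\in\Gamma(U).$$ If $M$ is compact, then $\Gamma(U)$ is open in the Fréchet space $\Omega^2_+(M)$ (with the $C^\infty$ topology), $\mathcal N_{\mathtt J}$ is smooth as a map of Fréchet spaces, and it satisfies the following quadratic estimate. Let $r\ge 0$ be an integer, let $\alpha\in(0,1)$, and let Hölder norms of forms on $M$ be formed with respect to any fixed finite family of closed coordinate balls whose interiors cover $M$. For every compact $K\subset U$ and every $R\ge0$ there is a constant $c=c(\mathtt J,r,\alpha,K,R)>0$ (depending also on the chosen balls) such that $$\|\mathcal N_{\mathtt J}(\omega)-\mathcal N_{\mathtt J}(\eta)\|_{C^{r,\alpha}}\le c\,\big(\|\omega\|_{C^{r+1,\alpha}}+\|\eta\|_{C^{r+1,\alpha}}\big)\,\|\omega-\eta\|_{C^{r+1,\alpha}}$$ for all $\omega,\eta\in\Gamma(U)$ with values in $K$ and with $\|\omega\|_{C^{r+1,\alpha}},\|\eta\|_{C^{r+1,\alpha}}\le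 R$. (The case $r=0$ is the estimate from $C^{1,\alpha}$ to $C^{0,\alpha}$.) -/

import Mathlib

open scoped Manifold ContDiff Topology ENNReal NNReal
open Set Filter Bundle

noncomputable section

namespace Coassociative

/-! ### Differential forms on manifolds -/

section Forms

variable {n m k : ℕ} {M N : Type*}
  [TopologicalSpace M] [ChartedSpace (EuclideanSpace ℝ (Fin n)) M]
  [TopologicalSpace N] [ChartedSpace (EuclideanSpace ℝ (Fin m)) N]

/-- The space `Λᵏ Tₓ* M` of alternating `k`-forms on the tangent space at `x` of the
`n`-manifold `M`. -/
abbrev FormAt (n k : ℕ) {M : Type*} [TopologicalSpace M]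
    [ChartedSpace (EuclideanSpace ℝ (Fin n)) M] (x : M) : Type :=
  TangentSpace (𝓡 n) x [⋀^Fin k]→L[ℝ] Bundle.Trivial M ℝ x

/-- A (not necessarily smooth) field of alternating `k`-forms on `M`. -/
abbrev RawForm (n k : ℕ) (M : Type*) [TopologicalSpace M]
    [ChartedSpace (EuclideanSpace ℝ (Fin n)) M] : Type _ :=
  (x : M) → FormAt n k x

/-- The representative `(κ⁻¹)^* σ` of `σ` in the chart `κ` around `p`; it is meaningful on the
target of the chart. -/
def inChart (p : M) (σ : RawForm n k M) (y : EuclideanSpace ℝ (Fin n)) :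
    EuclideanSpace ℝ (Fin n) [⋀^Fin k]→L[ℝ] ℝ :=
  (σ ((extChartAt (𝓡 n) p).symm y)).compContinuousLinearMap
    (mfderiv 𝓘(ℝ, EuclideanSpace ℝ (Fin n)) (𝓡 n) (extChartAt (𝓡 n) p).symm y)

/-- `σ` is smooth on the open set `V`: all its chart representatives are. -/
def IsSmoothOn (σ : RawForm n k M) (V : Set M) : Prop :=
  ∀ p : M, ContDiffOn ℝ ∞ (inChart p σ)
    ((extChartAt (𝓡 n) p).target ∩ (extChartAt (𝓡 n) p).symm ⁻¹' V)

/-- The exterior derivative: `dσ` at `x` is computed in the chart around `x`. -/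
def extD (σ : RawForm n k M) : RawForm n (k + 1) M := fun x =>
  (extDeriv (inChart x σ) (extChartAt (𝓡 n) x x)).compContinuousLinearMap
    (mfderiv (𝓡 n) 𝓘(ℝ, EuclideanSpace ℝ (Fin n)) (extChartAt (𝓡 n) x) x)

/-- The pull-back `f^* η` of a form. -/
def pullback (f : M → N) (η : RawForm m k N) : RawForm n k M := fun x =>
  (η (f x)).compContinuousLinearMap (mfderiv (𝓡 n) (𝓡 m) f x)

theorem inChart_add (p : M) (σ η : RawForm n k M) :
    inChart p (σ + η) = inChart p σ + inChart p η := rfl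

theorem inChart_smul (p : M) (a : ℝ) (σ : RawForm n k M) :
    inChart p (a • σ) = a • inChart p σ := rfl

theorem inChart_zero (p : M) : inChart p (0 : RawForm n k M) = 0 := rfl

variable (n k M) in
/-- The smooth `k`-forms, as a subspace of the space of all fields of `k`-forms. -/
def smoothSubmodule : Submodule ℝ (RawForm n k M) where
  carrier := {σ | IsSmoothOn σ univ}
  add_mem' := by
    intro σ η hσ hη p
    rw [inChart_add]
    exact (hσ p).add (hη p)
  zero_mem' := by
    intro p
    rw [inChart_zero]
    exact contDiffOn_const
  smul_mem' := by
    intro a σ hσ p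
    rw [inChart_smul]
    exact contDiffOn_const.smul (hσ p)

variable (n k M) in
/-- The space `Ωᵏ(M)` of smooth `k`-forms. It is a type of its own, since its topology is the
`C^∞` topology and not the topology of pointwise convergence. -/
def SmoothForm : Type _ := ↥(smoothSubmodule n k M)

instance : AddCommGroup (SmoothForm n k M) :=
  inferInstanceAs (AddCommGroup ↥(smoothSubmodule n k M))

instance : Module ℝ (SmoothForm n k M) :=
  inferInstanceAs (Module ℝ ↥(smoothSubmodule n k M))

/-- The underlying field of alternating forms. -/
def SmoothForm.val (σ : SmoothForm n k M) : RawForm n k M := Subtype.val σ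

theorem SmoothForm.smooth (σ : SmoothForm n k M) : IsSmoothOn σ.val univ := Subtype.property σ

theorem SmoothForm.val_add (σ η : SmoothForm n k M) : (σ + η).val = σ.val + η.val := rfl

theorem SmoothForm.val_smul (a : ℝ) (σ : SmoothForm n k M) : (a • σ).val = a • σ.val := rfl

theorem SmoothForm.val_zero : (0 : SmoothForm n k M).val = 0 := rfl

/-- The `C^∞` (Fréchet) topology on `Ωᵏ(M)`: uniform convergence of all derivatives of the chart
representatives on the compact subsets of the chart domains. -/
instance : TopologicalSpace (SmoothForm n k M) :=
  TopologicalSpace.induced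
    (fun σ => fun (q : M × ℕ) =>
      (UniformOnFun.ofFun {C | IsCompact C ∧ C ⊆ (extChartAt (𝓡 n) q.1).target}
        (iteratedFDeriv ℝ q.2 (inChart q.1 σ.val)) :
        UniformOnFun (EuclideanSpace ℝ (Fin n))
          (EuclideanSpace ℝ (Fin n) [×q.2]→L[ℝ] (EuclideanSpace ℝ (Fin n) [⋀^Fin k]→L[ℝ] ℝ))
          {C | IsCompact C ∧ C ⊆ (extChartAt (𝓡 n) q.1).target}))
    inferInstance

theorem SmoothForm.differentiableAt_inChart (σ : SmoothForm n k M) (x : M) :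
    DifferentiableAt ℝ (inChart x σ.val) (extChartAt (𝓡 n) x x) := by
  have h := σ.smooth x
  rw [preimage_univ, inter_univ] at h
  exact (h.differentiableOn (by simp)).differentiableAt (extChartAt_target_mem_nhds (I := 𝓡 n) x)

theorem extD_add (σ η : SmoothForm n k M) :
    extD (σ + η).val = extD σ.val + extD η.val := by
  funext x
  rw [SmoothForm.val_add]
  simp only [extD, Pi.add_apply]
  rw [inChart_add, extDeriv_add (σ.differentiableAt_inChart x) (η.differentiableAt_inChart x)]
  rfl

theorem extD_smul (a : ℝ) (σ : SmoothForm n k M) :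
    extD (a • σ).val = a • extD σ.val := by
  funext x
  rw [SmoothForm.val_smul]
  simp only [extD, Pi.smul_apply]
  rw [inChart_smul, extDeriv_smul]
  rfl

variable (n k M) in
/-- The space `d Ωᵏ(M)` of exact smooth `(k+1)`-forms. -/
def exactForms : Submodule ℝ (SmoothForm n (k + 1) M) where
  carrier := {θ | ∃ β : SmoothForm n k M, θ.val = extD β.val}
  add_mem' := by
    rintro θ θ' ⟨β, h⟩ ⟨β', h'⟩
    exact ⟨β + β', by rw [SmoothForm.val_add, extD_add, h, h']⟩
  zero_mem' := ⟨0, by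
    have h := extD_smul (0 : ℝ) (0 : SmoothForm n k M)
    rw [zero_smul, zero_smul] at h
    rw [h, SmoothForm.val_zero]⟩
  smul_mem' := by
    rintro a θ ⟨β, h⟩
    exact ⟨a • β, by rw [SmoothForm.val_smul, extD_smul, h]⟩

end Forms

/-! ### Smooth maps between Fréchet spaces -/

/-- `f` is a smooth map on the open set `O` of the topological vector space `E`: all
iterated directional derivatives `Dʲ f (x) (h₁, …, hⱼ)` exist for `x ∈ O` and are jointly
continuous as maps `O × Eʲ → F`. -/
def IsFrechetSmoothOn {E F : Type*} [AddCommGroup E] [Module ℝ E] [TopologicalSpace E]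
    [AddCommGroup F] [Module ℝ F] [TopologicalSpace F] (f : E → F) (O : Set E) : Prop :=
  IsOpen O ∧
  ∃ D : (j : ℕ) → E → (Fin j → E) → F,
    (∀ x ∈ O, ∀ h : Fin 0 → E, D 0 x h = f x) ∧
    (∀ j, ∀ x ∈ O, ∀ (h : Fin j → E) (v : E),
      Tendsto (fun t : ℝ => t⁻¹ • (D j (x + t • v) h - D j x h)) (𝓝[≠] 0)
        (𝓝 (D (j + 1) x (Fin.snoc h v)))) ∧
    ∀ j, ContinuousOn (fun p : E × (Fin j → E) => D j p.1 p.2) (O ×ˢ univ)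

/-! ### Hölder norms -/

section Holder

variable {E F : Type*} [NormedAddCommGroup E] [NormedSpace ℝ E]
  [NormedAddCommGroup F] [NormedSpace ℝ F]

/-- The supremum of `‖f‖` over `S`. -/
def supNorm (f : E → F) (S : Set E) : ℝ≥0∞ := ⨆ y ∈ S, ‖f y‖ₑ

/-- The Hölder seminorm `sup ‖f y - f z‖ / ‖y - z‖ ^ α` over `y ≠ z` in `S`. -/
def holderSeminorm (α : ℝ) (f : E → F) (S : Set E) : ℝ≥0∞ :=
  ⨆ y ∈ S, ⨆ z ∈ S, ⨆ _ : y ≠ z, ‖f y - f z‖ₑ / ‖y - z‖ₑ ^ α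

variable {n k : ℕ} {M : Type*} [TopologicalSpace M] [ChartedSpace (EuclideanSpace ℝ (Fin n)) M]

variable (n M) in
/-- A finite family of closed coordinate balls whose interiors cover `M`: the data
with respect to which Hölder norms on a compact manifold are formed. -/
structure BallCover where
  size : ℕ
  base : Fin size → M
  center : Fin size → EuclideanSpace ℝ (Fin n)
  radius : Fin size → ℝ
  subset : ∀ i, Metric.closedBall (center i) (radius i) ⊆ (extChartAt (𝓡 n) (base i)).target
  cover : ∀ x : M, ∃ i, x ∈ (extChartAt (𝓡 n) (base i)).source ∧
    extChartAt (𝓡 n) (base i) x ∈ Metric.ball (center i) (radius i)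

/-- The `C^{r,α}` norm of a form: the maximum over the coordinate balls of the `C^{r,α}` norms
of its chart representatives. -/
def BallCover.holderNorm (𝒜 : BallCover n M) (r : ℕ) (α : ℝ) (σ : RawForm n k M) : ℝ≥0∞ :=
  ⨆ i, ((∑ j ∈ Finset.range (r + 1), supNorm (iteratedFDeriv ℝ j (inChart (𝒜.base i) σ))
      (Metric.closedBall (𝒜.center i) (𝒜.radius i))) +
    holderSeminorm α (iteratedFDeriv ℝ r (inChart (𝒜.base i) σ))
      (Metric.closedBall (𝒜.center i) (𝒜.radius i)))

end Holder

/-! ### `G₂`-structures and coassociative immersions -/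

/-- The value of `dx^{i₁} ∧ … ∧ dx^{iₖ}` on `k` vectors of `ℝ⁷`. -/
def dxWedge {k : ℕ} (i : Fin k → Fin 7) (v : Fin k → EuclideanSpace ℝ (Fin 7)) : ℝ :=
  Matrix.det (Matrix.of fun a b => v a (i b))

/-- The standard `G₂` form on `ℝ⁷`,
`dx¹²³ + dx¹⁴⁵ + dx¹⁶⁷ + dx²⁴⁶ - dx²⁵⁷ - dx³⁴⁷ - dx³⁵⁶` (indices shifted by one). -/
def phi0 (v : Fin 3 → EuclideanSpace ℝ (Fin 7)) : ℝ :=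
  dxWedge ![0, 1, 2] v + dxWedge ![0, 3, 4] v + dxWedge ![0, 5, 6] v + dxWedge ![1, 3, 5] v
    - dxWedge ![1, 4, 6] v - dxWedge ![2, 3, 6] v - dxWedge ![2, 4, 5] v

/-- The Hodge dual of the standard `G₂` form,
`dx⁴⁵⁶⁷ + dx²³⁶⁷ + dx²³⁴⁵ + dx¹³⁵⁷ - dx¹³⁴⁶ - dx¹²⁵⁶ - dx¹²⁴⁷`. -/
def psi0 (v : Fin 4 → EuclideanSpace ℝ (Fin 7)) : ℝ :=
  dxWedge ![3, 4, 5, 6] v + dxWedge ![1, 2, 5, 6] v + dxWedge ![1, 2, 3, 4] v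
    + dxWedge ![0, 2, 4, 6] v - dxWedge ![0, 2, 3, 5] v - dxWedge ![0, 1, 4, 5] v
    - dxWedge ![0, 1, 3, 6] v

section Geometry

variable {M Y : Type*}
  [TopologicalSpace M] [ChartedSpace (EuclideanSpace ℝ (Fin 4)) M] [IsManifold (𝓡 4) ∞ M]
  [TopologicalSpace Y] [ChartedSpace (EuclideanSpace ℝ (Fin 7)) Y]

/-- `L` is an adapted frame of the `3`-form `φ` at `y`: it identifies `φ` with the standard `G₂`
form. The metric `g_φ` and the `4`-form `*φ` at `y` are the pull-backs under any such `L` of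
the Euclidean metric and of `psi0`. -/
def IsG2Frame (φ : RawForm 7 3 Y) (y : Y)
    (L : TangentSpace (𝓡 7) y ≃ₗ[ℝ] EuclideanSpace ℝ (Fin 7)) : Prop :=
  ∀ v : Fin 3 → TangentSpace (𝓡 7) y, φ y v = phi0 (fun i => L (v i))

/-- `φ` is a closed `G₂`-structure on `Y`. -/
structure IsClosedG2Structure (φ : RawForm 7 3 Y) : Prop where
  smooth : IsSmoothOn φ univ
  exists_frame : ∀ y, ∃ L, IsG2Frame φ y L
  closed : ∀ y, extD φ y = 0

/-- `ι` is a smooth immersion with `ι^* φ = 0`. -/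
structure IsCoassociativeImmersion (φ : RawForm 7 3 Y) (ι : M → Y) : Prop where
  smooth : ContMDiff (𝓡 4) (𝓡 7) ∞ ι
  immersion : ∀ x, Function.Injective (mfderiv (𝓡 4) (𝓡 7) ι x)
  pullback_eq_zero : ∀ x, pullback (n := 4) ι φ x = 0

/-- `e` is a positively oriented orthonormal basis of `Tₓ M`, where `M` carries the metric
`ι^* g_φ` and the orientation for which `ι^* (*φ)` is positive. -/
def IsOrientedOrthonormal (φ : RawForm 7 3 Y) (ι : M → Y) (x : M)
    (e : Fin 4 → TangentSpace (𝓡 4) x) : Prop :=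
  ∃ L : TangentSpace (𝓡 7) (ι x) ≃ₗ[ℝ] EuclideanSpace ℝ (Fin 7), IsG2Frame φ (ι x) L ∧
    Orthonormal ℝ (fun i => L (mfderiv (𝓡 4) (𝓡 7) ι x (e i))) ∧
    0 < psi0 (fun i => L (mfderiv (𝓡 4) (𝓡 7) ι x (e i)))

/-- The fibre at `x` of `Λ²₊ T^*M`: the `2`-forms `β` with `*β = β`, the equation being
written out in the positively oriented orthonormal bases `e₀, …, e₃`, where `*` maps
`e⁰¹ ↦ e²³`, `e⁰² ↦ -e¹³`, `e⁰³ ↦ e¹²`. -/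
def selfDualAt (φ : RawForm 7 3 Y) (ι : M → Y) (x : M) : Submodule ℝ (FormAt 4 2 x) where
  carrier := {β | ∀ e, IsOrientedOrthonormal φ ι x e →
    β ![e 0, e 1] = β ![e 2, e 3] ∧ β ![e 0, e 2] = -β ![e 1, e 3] ∧
      β ![e 0, e 3] = β ![e 1, e 2]}
  add_mem' := by
    intro β γ hβ hγ e he
    obtain ⟨h1, h2, h3⟩ := hβ e he
    obtain ⟨k1, k2, k3⟩ := hγ e he
    simp only [ContinuousAlternatingMap.add_apply, h1, h2, h3, k1, k2, k3, neg_add, and_self]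
  zero_mem' := by
    intro e _
    simp
  smul_mem' := by
    intro a β hβ e he
    obtain ⟨h1, h2, h3⟩ := hβ e he
    simp only [ContinuousAlternatingMap.smul_apply, h1, h2, h3, smul_neg, and_self]

/-- The space `Ω²₊(M)` of smooth self-dual `2`-forms. -/
def selfDualForms (φ : RawForm 7 3 Y) (ι : M → Y) : Submodule ℝ (SmoothForm 4 2 M) where
  carrier := {σ | ∀ x, σ.val x ∈ selfDualAt φ ι x}
  add_mem' := fun hσ hη x => (selfDualAt φ ι x).add_mem (hσ x) (hη x)
  zero_mem' := fun x => (selfDualAt φ ι x).zero_mem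
  smul_mem' := fun a _ hσ x => (selfDualAt φ ι x).smul_mem a (hσ x)

/-- The `2`-form underlying a self-dual form. -/
abbrev formOf {φ : RawForm 7 3 Y} {ι : M → Y} (σ : selfDualForms φ ι) : RawForm 4 2 M :=
  (σ : SmoothForm 4 2 M).val

variable (M) in
/-- The total space of `Λ² T^*M`, with Mathlib's topology of a vector bundle. -/
abbrev TwoFormBundle : Type _ :=
  TotalSpace (EuclideanSpace ℝ (Fin 4) [⋀^Fin 2]→L[ℝ] ℝ) (fun x : M => FormAt 4 2 x)

/-- The total space of `Λ²₊ T^*M`, as a subset of that of `Λ² T^*M`. -/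
def selfDualBundle (φ : RawForm 7 3 Y) (ι : M → Y) : Set (TwoFormBundle M) :=
  {u | u.2 ∈ selfDualAt φ ι u.1}

/-- `s` is a smooth frame of the vector bundle `Λ²₊ T^*M` over the open set `V`. -/
structure IsSelfDualFrame (φ : RawForm 7 3 Y) (ι : M → Y) (V : Set M)
    (s : Fin 3 → RawForm 4 2 M) : Prop where
  isOpen : IsOpen V
  smooth : ∀ i, IsSmoothOn (s i) V
  linearIndependent : ∀ x ∈ V, LinearIndependent ℝ (fun i => s i x)
  span_eq : ∀ x ∈ V, Submodule.span ℝ (range fun i => s i x) = selfDualAt φ ι x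

/-- The local parametrisation `(x, t) ↦ t₀ s₀(x) + t₁ s₁(x) + t₂ s₂(x)` of `Λ²₊ T^*M` that belongs
to the frame `s`. -/
def frameParam (s : Fin 3 → RawForm 4 2 M) (p : M × EuclideanSpace ℝ (Fin 3)) :
    TwoFormBundle M :=
  ⟨p.1, ∑ i, p.2 i • s i p.1⟩

/-- A tubular neighborhood of the coassociative immersion `ι`. Only the values of `J` on `U` matter.
Smoothness and differential of `J` are taken with respect to the smooth
structure of the vector bundle `Λ²₊ T^*M`, that is, in the parametrisations given by its
smooth local frames. -/
structure TubularNeighborhood (φ : RawForm 7 3 Y) (ι : M → Y) where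
  U : Set (TwoFormBundle M)
  J : TwoFormBundle M → Y
  subset : U ⊆ selfDualBundle φ ι
  isOpen : ∃ O : Set (TwoFormBundle M), IsOpen O ∧ U = O ∩ selfDualBundle φ ι
  convex : ∀ x : M, Convex ℝ {β : FormAt 4 2 x | (⟨x, β⟩ : TwoFormBundle M) ∈ U}
  zero_mem : ∀ x : M, (⟨x, 0⟩ : TwoFormBundle M) ∈ U
  smooth : ∀ V s, IsSelfDualFrame φ ι V s →
    ContMDiffOn ((𝓡 4).prod (𝓡 3)) (𝓡 7) ∞ (fun p => J (frameParam s p))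
      {p | p.1 ∈ V ∧ frameParam s p ∈ U}
  immersion : ∀ V s, IsSelfDualFrame φ ι V s → ∀ p, p.1 ∈ V → frameParam s p ∈ U →
    Function.Injective (mfderiv ((𝓡 4).prod (𝓡 3)) (𝓡 7) (fun p => J (frameParam s p)) p)
  zero_section : ∀ x : M, J ⟨x, 0⟩ = ι x
  /-- The normal vector `w = ∂ₜ J(t u)|ₜ₌₀` corresponds to `u` under the isomorphism
  `w ↦ ι^* (i_w φ)` of the normal bundle with `Λ²₊ T^*M`. -/
  deriv_zero : ∀ (x : M) (u : FormAt 4 2 x), (⟨x, u⟩ : TwoFormBundle M) ∈ U →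
    ∀ w : TangentSpace (𝓡 7) (ι x),
      w = mfderiv 𝓘(ℝ, ℝ) (𝓡 7) (fun t : ℝ => J ⟨x, t • u⟩) 0 (1 : ℝ) →
      ∀ a b : TangentSpace (𝓡 4) x,
        φ (ι x) ![w, mfderiv (𝓡 4) (𝓡 7) ι x a, mfderiv (𝓡 4) (𝓡 7) ι x b] = u ![a, b]

namespace TubularNeighborhood

variable {φ : RawForm 7 3 Y} {ι : M → Y}

/-- The set `Γ(U)` of smooth sections of `Λ²₊ T^*M` with values in `U`. -/
def sections (T : TubularNeighborhood φ ι) : Set (selfDualForms φ ι) :=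
  {σ | ∀ x, (⟨x, formOf σ x⟩ : TwoFormBundle M) ∈ T.U}

/-- The map `J_σ : M → Y`, `x ↦ J(σ_x)`. -/
def map (T : TubularNeighborhood φ ι) (σ : selfDualForms φ ι) : M → Y :=
  fun x => T.J ⟨x, formOf σ x⟩

/-- The map `F(σ) = J_σ^* φ`. -/
def F (T : TubularNeighborhood φ ι) (σ : selfDualForms φ ι) : RawForm 4 3 M :=
  pullback (T.map σ) φ

end TubularNeighborhood

end Geometry

end Coassociative

end

/-!
# The deformation map of a coassociative immersion

Algebra. For an orthonormal frame `f` of a coassociative `4`-plane with normal directions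
`f i × f j`, the seven-dimensional cross product satisfies the self-duality relations. Hence the
forms `ι^*(i_w φ)` are self-dual, and three of them are linearly independent
(`exists_contractAt_linearIndependent`), so that they span the rank-three bundle of self-dual
forms. As they depend smoothly on the point, the self-dual forms have smooth local frames
(`exists_selfDualFrame`), and the bundle can be projected onto smoothly in charts.

Exactness. Contracting the tubular neighborhood along rays, `(t, x) ↦ J (t σ_x)`, the homotopy
formula for the closed form `φ` and `ι^*φ = 0` give `F(σ) = d P(σ)`, where
`P(σ) = ∫₀¹ J_{tσ}^*(i_{∂ₜ} φ) dt` (`extDeriv_inChart_primitive`, `F_eq`). The nonlinear part is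
therefore `N(σ) = d (P(σ) - σ)`.

Smoothness. In a chart, `P(σ)` is a smooth function of the point and of the `1`-jet of `σ`
(`chartPrimitive`). The derivatives of such a superposition operator are again superposition
operators (`jetDeriv`); their difference quotients converge in every `C^k` norm on compact sets
(`tendstoCk_slope_jetDeriv`), and they are continuous in these norms (`TendstoCk.comp_graph`).

Quadratic estimate. `F(σ)` is in a chart a smooth function of the `1`-jet, because pulling back
needs only first derivatives. Its linearization at `0` is `d`: this combines the homotopy formula
with the normalisation `ι^*(i_{∂ₜ J(tu)} φ) = u` at `t = 0` (`chartIntegrand_zero`,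
`hasDerivAt_chartF`). So the chart expression of `N` vanishes to second order at the zero jet
(`fderiv_chartN_zero`), and the mean value formula used twice writes its increment as
`H(x; a, b)(a, b)(a - b)` with `H` smooth (`exists_quadratic_remainder`). The estimate follows
from the product and composition inequalities for Hölder norms (`exists_hnorm_bilin_le`,
`exists_hnorm_comp_graph_le`). The jets that enter stay in a compact set, their values lying in
`K` and their derivatives being bounded in terms of `R`, so the constant is uniform.
-/

noncomputable section

set_option linter.unusedSectionVars false

namespace Coassociative

/-! ### Convergence of derivatives on compact sets -/

section CkConvergence

variable {E : Type} [NormedAddCommGroup E] [NormedSpace ℝ E]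

/-- Uniform convergence on `C` of `f i` to `g` along `l`, together with all derivatives up to
order `q`. The recursion on `q` replaces a function by its Fréchet derivative. -/
def TendstoCk {ι : Type*} (l : Filter ι) (C : Set E) :
    ℕ → {F : Type} → [NormedAddCommGroup F] → [NormedSpace ℝ F] → (ι → E → F) → (E → F) → Prop
  | 0, _, _, _, f, g => TendstoUniformlyOn f g l C
  | q + 1, _, _, _, f, g => TendstoUniformlyOn f g l C ∧
      TendstoCk l C q (fun i => fderiv ℝ (f i)) (fderiv ℝ g)

variable {F G Z : Type} [NormedAddCommGroup F] [NormedSpace ℝ F]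
  [NormedAddCommGroup G] [NormedSpace ℝ G] [NormedAddCommGroup Z] [NormedSpace ℝ Z]
  {ι : Type*} {l : Filter ι} {C : Set E}

theorem dist_iteratedFDeriv_succ (f g : E → F) (j : ℕ) (y z : E) :
    dist (iteratedFDeriv ℝ (j + 1) f y) (iteratedFDeriv ℝ (j + 1) g z) =
      dist (iteratedFDeriv ℝ j (fderiv ℝ f) y) (iteratedFDeriv ℝ j (fderiv ℝ g) z) := by
  rw [iteratedFDeriv_succ_eq_comp_right, iteratedFDeriv_succ_eq_comp_right, Function.comp_apply,
    Function.comp_apply, LinearIsometryEquiv.dist_map]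

theorem dist_iteratedFDeriv_zero (f g : E → F) (y z : E) :
    dist (iteratedFDeriv ℝ 0 f y) (iteratedFDeriv ℝ 0 g z) = dist (f y) (g z) := by
  rw [iteratedFDeriv_zero_eq_comp, iteratedFDeriv_zero_eq_comp, Function.comp_apply,
    Function.comp_apply, LinearIsometryEquiv.dist_map]

theorem tendstoCk_iff {q : ℕ} {f : ι → E → F} {g : E → F} :
    TendstoCk l C q f g ↔ ∀ j ≤ q,
      TendstoUniformlyOn (fun i => iteratedFDeriv ℝ j (f i)) (iteratedFDeriv ℝ j g) l C := by
  have h0 : ∀ {F : Type} [NormedAddCommGroup F] [NormedSpace ℝ F] (f : ι → E → F) (g : E → F),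
      TendstoUniformlyOn (fun i => iteratedFDeriv ℝ 0 (f i)) (iteratedFDeriv ℝ 0 g) l C ↔
        TendstoUniformlyOn f g l C := by
    intro F _ _ f g
    simp only [Metric.tendstoUniformlyOn_iff, dist_iteratedFDeriv_zero]
  induction q generalizing F with
  | zero =>
    simp only [TendstoCk, nonpos_iff_eq_zero, forall_eq]
    exact (h0 f g).symm
  | succ q ih =>
    simp only [TendstoCk]
    refine Iff.trans (and_congr Iff.rfl ih) ?_
    have h1 : ∀ j, TendstoUniformlyOn (fun i => iteratedFDeriv ℝ (j + 1) (f i))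
        (iteratedFDeriv ℝ (j + 1) g) l C ↔
        TendstoUniformlyOn (fun i => iteratedFDeriv ℝ j (fderiv ℝ (f i)))
          (iteratedFDeriv ℝ j (fderiv ℝ g)) l C := by
      intro j
      simp only [Metric.tendstoUniformlyOn_iff, dist_iteratedFDeriv_succ]
    constructor
    · rintro ⟨h, h'⟩ j hj
      cases j with
      | zero => exact (h0 f g).2 h
      | succ j => exact (h1 j).2 (h' j (by omega))
    · intro h
      exact ⟨(h0 f g).1 (h 0 (by omega)), fun j hj => (h1 j).1 (h (j + 1) (by omega))⟩

theorem TendstoCk.uniformly {q : ℕ} {f : ι → E → F} {g : E → F} (h : TendstoCk l C q f g) :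
    TendstoUniformlyOn f g l C := by
  cases q with
  | zero => exact h
  | succ q => exact h.1

theorem TendstoCk.of_succ {q : ℕ} {f : ι → E → F} {g : E → F} (h : TendstoCk l C (q + 1) f g) :
    TendstoCk l C q f g :=
  tendstoCk_iff.2 fun j hj => tendstoCk_iff.1 h j (by omega)

theorem TendstoCk.congr {q : ℕ} {f f' : ι → E → F} {g g' : E → F} (h : TendstoCk l C q f g)
    (hf : ∀ᶠ i in l, ∀ y ∈ C, f i =ᶠ[𝓝 y] f' i) (hg : ∀ y ∈ C, g =ᶠ[𝓝 y] g') :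
    TendstoCk l C q f' g' := by
  have h0 : ∀ {F : Type} [NormedAddCommGroup F] [NormedSpace ℝ F] {f f' : ι → E → F}
      {g g' : E → F}, TendstoUniformlyOn f g l C →
      (∀ᶠ i in l, ∀ y ∈ C, f i =ᶠ[𝓝 y] f' i) → (∀ y ∈ C, g =ᶠ[𝓝 y] g') →
      TendstoUniformlyOn f' g' l C := by
    intro F _ _ f f' g g' h hf hg
    refine (h.congr ?_).congr_right fun y hy => (hg y hy).eq_of_nhds
    filter_upwards [hf] with i hi y hy using (hi y hy).eq_of_nhds
  induction q generalizing F with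
  | zero => exact h0 h hf hg
  | succ q ih =>
    refine ⟨h0 h.1 hf hg, ih h.2 ?_ fun y hy => (hg y hy).fderiv⟩
    filter_upwards [hf] with i hi y hy using (hi y hy).fderiv

theorem TendstoCk.const {q : ℕ} {g : E → F} : TendstoCk l C q (fun _ => g) g :=
  tendstoCk_iff.2 fun _ _ _ hu => .of_forall fun _ _ _ => refl_mem_uniformity hu

theorem TendstoCk.clm_comp {q : ℕ} {V : Set E} (hV : IsOpen V) (hCV : C ⊆ V) (L : F →L[ℝ] G)
    {f : ι → E → F} {g : E → F} (h : TendstoCk l C q f g)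
    (hf : ∀ᶠ i in l, ContDiffOn ℝ ∞ (f i) V) (hg : ContDiffOn ℝ ∞ g V) :
    TendstoCk l C q (fun i y => L (f i y)) (fun y => L (g y)) := by
  induction q generalizing F G with
  | zero => exact L.uniformContinuous.comp_tendstoUniformlyOn h.uniformly
  | succ q ih =>
    have hD : ∀ {f : E → F}, ContDiffOn ℝ ∞ f V → ∀ y ∈ C,
        (fun z => L.comp (fderiv ℝ f z)) =ᶠ[𝓝 y] fderiv ℝ (fun z => L (f z)) := by
      intro f hf y hy
      filter_upwards [hV.mem_nhds (hCV hy)] with z hz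
      exact (L.hasFDerivAt.comp z ((hf.differentiableOn (by simp)).differentiableAt
        (hV.mem_nhds hz)).hasFDerivAt).fderiv.symm
    refine ⟨L.uniformContinuous.comp_tendstoUniformlyOn h.uniformly, ?_⟩
    have h2 := ih (ContinuousLinearMap.compL ℝ E F G L) h.2 ?_
      (hg.fderiv_of_isOpen hV (by simp))
    · refine h2.congr ?_ (hD hg)
      filter_upwards [hf] with i hi using hD hi
    · filter_upwards [hf] with i hi using hi.fderiv_of_isOpen hV (by simp)

theorem TendstoCk.prodMk {q : ℕ} {V : Set E} (hV : IsOpen V) (hCV : C ⊆ V)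
    {f : ι → E → F} {g : E → F} {f' : ι → E → G} {g' : E → G}
    (h : TendstoCk l C q f g) (h' : TendstoCk l C q f' g')
    (hf : ∀ᶠ i in l, ContDiffOn ℝ ∞ (f i) V) (hg : ContDiffOn ℝ ∞ g V)
    (hf' : ∀ᶠ i in l, ContDiffOn ℝ ∞ (f' i) V) (hg' : ContDiffOn ℝ ∞ g' V) :
    TendstoCk l C q (fun i y => (f i y, f' i y)) (fun y => (g y, g' y)) := by
  have h0 : TendstoUniformlyOn (fun i y => (f i y, f' i y)) (fun y => (g y, g' y)) l C := by
    have h1 := h.uniformly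
    have h1' := h'.uniformly
    rw [Metric.tendstoUniformlyOn_iff] at *
    intro ε hε
    filter_upwards [h1 ε hε, h1' ε hε] with i h1 h2 y hy
    exact max_lt (h1 y hy) (h2 y hy)
  induction q generalizing F G with
  | zero => exact h0
  | succ q ih =>
    have hD : ∀ {f : E → F} {f' : E → G}, ContDiffOn ℝ ∞ f V → ContDiffOn ℝ ∞ f' V → ∀ y ∈ C,
        (fun z => ContinuousLinearMap.prodₗᵢ ℝ (fderiv ℝ f z, fderiv ℝ f' z)) =ᶠ[𝓝 y]
          fderiv ℝ (fun z => (f z, f' z)) := by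
      intro f f' hf hf' y hy
      filter_upwards [hV.mem_nhds (hCV hy)] with z hz
      exact ((((hf.differentiableOn (by simp)).differentiableAt (hV.mem_nhds hz)).hasFDerivAt).prodMk
        (((hf'.differentiableOn (by simp)).differentiableAt
          (hV.mem_nhds hz)).hasFDerivAt)).fderiv.symm
    have e1 : ∀ᶠ i in l, ContDiffOn ℝ ∞ (fderiv ℝ (f i)) V := by
      filter_upwards [hf] with i hi using hi.fderiv_of_isOpen hV (by simp)
    have e2 : ∀ᶠ i in l, ContDiffOn ℝ ∞ (fderiv ℝ (f' i)) V := by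
      filter_upwards [hf'] with i hi using hi.fderiv_of_isOpen hV (by simp)
    have e3 := hg.fderiv_of_isOpen hV (m := ∞) (by simp)
    have e4 := hg'.fderiv_of_isOpen hV (m := ∞) (by simp)
    have h1 : TendstoUniformlyOn (fun i y => (fderiv ℝ (f i) y, fderiv ℝ (f' i) y))
        (fun y => (fderiv ℝ g y, fderiv ℝ g' y)) l C := by
      have h1 := h.2.uniformly
      have h1' := h'.2.uniformly
      rw [Metric.tendstoUniformlyOn_iff] at *
      intro ε hε
      filter_upwards [h1 ε hε, h1' ε hε] with i h1 h2 y hy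
      exact max_lt (h1 y hy) (h2 y hy)
    refine ⟨h0, ?_⟩
    have h2 := (ih h.2 h'.2 e1 e3 e2 e4 h1).clm_comp hV hCV
      (ContinuousLinearMap.prodₗᵢ ℝ : ((E →L[ℝ] F) × (E →L[ℝ] G)) ≃ₗᵢ[ℝ]
        (E →L[ℝ] F × G)).toContinuousLinearEquiv.toContinuousLinearMap
      (by filter_upwards [e1, e2] with i h1 h2 using h1.prodMk h2) (e3.prodMk e4)
    refine h2.congr ?_ (hD hg hg')
    filter_upwards [hf, hf'] with i h1 h2 using hD h1 h2

/-- The derivative of `y ↦ H (y, f y)` as a function of `y` and of the `1`-jet of `f`. -/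
def prolong (H : E × Z → F) (p : E × (Z × (E →L[ℝ] Z))) : E →L[ℝ] F :=
  (fderiv ℝ H (p.1, p.2.1)).comp ((ContinuousLinearMap.id ℝ E).prod p.2.2)

/-- The jets that lie over `Ω`. -/
def prolongSet (Ω : Set (E × Z)) : Set (E × (Z × (E →L[ℝ] Z))) := {p | (p.1, p.2.1) ∈ Ω}

theorem isOpen_prolongSet {Ω : Set (E × Z)} (hΩ : IsOpen Ω) : IsOpen (prolongSet Ω) :=
  hΩ.preimage (by fun_prop : Continuous fun p : E × (Z × (E →L[ℝ] Z)) => (p.1, p.2.1))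

theorem contDiffOn_prolong {Ω : Set (E × Z)} (hΩ : IsOpen Ω) {H : E × Z → F}
    (hH : ContDiffOn ℝ ∞ H Ω) : ContDiffOn ℝ ∞ (prolong H) (prolongSet Ω) := by
  have h1 : ContDiffOn ℝ ∞ (fderiv ℝ H) Ω := hH.fderiv_of_isOpen hΩ (by simp)
  have h2 : ContDiffOn ℝ ∞ (fun p : E × (Z × (E →L[ℝ] Z)) => fderiv ℝ H (p.1, p.2.1))
      (prolongSet Ω) := h1.comp (by fun_prop) fun p hp => hp
  refine h2.clm_comp (ContDiff.contDiffOn ?_)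
  exact (ContinuousLinearMap.prodₗᵢ ℝ : ((E →L[ℝ] E) × (E →L[ℝ] Z)) ≃ₗᵢ[ℝ]
        (E →L[ℝ] E × Z)).contDiff.comp (by fun_prop :
          ContDiff ℝ ∞ fun p : E × (Z × (E →L[ℝ] Z)) => (ContinuousLinearMap.id ℝ E, p.2.2))

theorem fderiv_comp_graph {Ω : Set (E × Z)} (hΩ : IsOpen Ω) {H : E × Z → F}
    (hH : ContDiffOn ℝ ∞ H Ω) {f : E → Z} {y : E} (hf : DifferentiableAt ℝ f y)
    (hy : (y, f y) ∈ Ω) :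
    fderiv ℝ (fun z => H (z, f z)) y = prolong H (y, (f y, fderiv ℝ f y)) := by
  have h1 : HasFDerivAt H (fderiv ℝ H (y, f y)) (y, f y) :=
    ((hH.differentiableOn (by simp)).differentiableAt (hΩ.mem_nhds hy)).hasFDerivAt
  exact (h1.comp y ((hasFDerivAt_id y).prodMk hf.hasFDerivAt)).fderiv

theorem eventually_graph_mem (hC : IsCompact C) {Ω : Set (E × Z)} (hΩ : IsOpen Ω)
    {f : ι → E → Z} {g : E → Z} (h : TendstoUniformlyOn f g l C) (hg : ContinuousOn g C)
    (hgΩ : ∀ y ∈ C, (y, g y) ∈ Ω) : ∀ᶠ i in l, ∀ y ∈ C, (y, f i y) ∈ Ω := by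
  have hS : IsCompact ((fun y => (y, g y)) '' C) := hC.image_of_continuousOn (by fun_prop)
  obtain ⟨δ, hδ, hsub⟩ := hS.exists_thickening_subset_open hΩ (by rintro _ ⟨y, hy, rfl⟩; exact hgΩ y hy)
  filter_upwards [Metric.tendstoUniformlyOn_iff.1 h δ hδ] with i hi y hy
  refine hsub (Metric.mem_thickening_iff.2 ⟨_, mem_image_of_mem _ hy, ?_⟩)
  rw [dist_comm, Prod.dist_eq]
  exact max_lt (by simpa using hδ) (hi y hy)

theorem tendstoUniformlyOn_comp_graph (hC : IsCompact C) {Ω : Set (E × Z)} (hΩ : IsOpen Ω)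
    {H : E × Z → F} (hH : ContinuousOn H Ω)
    {f : ι → E → Z} {g : E → Z} (h : TendstoUniformlyOn f g l C) (hg : ContinuousOn g C)
    (hgΩ : ∀ y ∈ C, (y, g y) ∈ Ω) :
    TendstoUniformlyOn (fun i y => H (y, f i y)) (fun y => H (y, g y)) l C := by
  have hS : IsCompact ((fun y => (y, g y)) '' C) := hC.image_of_continuousOn (by fun_prop)
  intro r hr
  have h1 := hS.uniformContinuousAt_of_continuousAt H (by
    rintro _ ⟨y, hy, rfl⟩
    exact hH.continuousAt (hΩ.mem_nhds (hgΩ y hy))) hr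
  obtain ⟨δ, hδ, hsub⟩ := Metric.mem_uniformity_dist.1 h1
  filter_upwards [Metric.tendstoUniformlyOn_iff.1 h δ hδ] with i hi y hy
  refine hsub (a := (y, g y)) (b := (y, f i y)) ?_ (mem_image_of_mem _ hy)
  rw [Prod.dist_eq]
  exact max_lt (by simpa using hδ) (hi y hy)

/-- Composition with a smooth function of `(y, f y)` is continuous in `f` for the convergence of
derivatives on compact sets. -/
theorem TendstoCk.comp_graph {q : ℕ} (hC : IsCompact C) {V : Set E} (hV : IsOpen V) (hCV : C ⊆ V)
    {Ω : Set (E × Z)} (hΩ : IsOpen Ω) {H : E × Z → F} (hH : ContDiffOn ℝ ∞ H Ω)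
    {f : ι → E → Z} {g : E → Z}
    (hf : ∀ᶠ i in l, ContDiffOn ℝ ∞ (f i) V) (hg : ContDiffOn ℝ ∞ g V)
    (hgΩ : ∀ y ∈ C, (y, g y) ∈ Ω) (h : TendstoCk l C q f g) :
    TendstoCk l C q (fun i y => H (y, f i y)) (fun y => H (y, g y)) := by
  have h0 := tendstoUniformlyOn_comp_graph hC hΩ hH.continuousOn h.uniformly
    (hg.continuousOn.mono hCV) hgΩ
  induction q generalizing F Z with
  | zero => exact h0
  | succ q ih =>
    refine ⟨h0, ?_⟩
    have hD : ∀ {f : E → Z}, ContDiffOn ℝ ∞ f V → (∀ y ∈ C, (y, f y) ∈ Ω) → ∀ y ∈ C,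
        (fun z => prolong H (z, (f z, fderiv ℝ f z))) =ᶠ[𝓝 y] fderiv ℝ (fun z => H (z, f z)) := by
      intro f hf hfΩ y hy
      have hc : ContinuousAt (fun z => (z, f z)) y :=
        continuousAt_id.prodMk (hf.continuousOn.continuousAt (hV.mem_nhds (hCV hy)))
      filter_upwards [hV.mem_nhds (hCV hy), hc (hΩ.mem_nhds (hfΩ y hy))] with z hz hz'
      exact (fderiv_comp_graph hΩ hH ((hf.differentiableOn (by simp)).differentiableAt
        (hV.mem_nhds hz)) hz').symm
    have e1 : ∀ᶠ i in l, ContDiffOn ℝ ∞ (fderiv ℝ (f i)) V := by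
      filter_upwards [hf] with i hi using hi.fderiv_of_isOpen hV (by simp)
    have e3 := hg.fderiv_of_isOpen hV (m := ∞) (by simp)
    have h1 := h.of_succ.prodMk hV hCV h.2 hf hg e1 e3
    have hg' := hg.prodMk e3
    have hgΩ' : ∀ y ∈ C, (y, (g y, fderiv ℝ g y)) ∈ prolongSet Ω := hgΩ
    have e5 : ∀ᶠ i in l, ContDiffOn ℝ ∞ (fun y => (f i y, fderiv ℝ (f i) y)) V := by
      filter_upwards [hf, e1] with i h1 h2 using h1.prodMk h2
    have o1 := isOpen_prolongSet hΩ
    have o2 := contDiffOn_prolong hΩ hH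
    have o3 := tendstoUniformlyOn_comp_graph hC o1 o2.continuousOn h1.uniformly
      (hg'.continuousOn.mono hCV) hgΩ'
    have h2 := ih (Z := Z × (E →L[ℝ] Z)) (F := E →L[ℝ] F) (Ω := prolongSet Ω) (H := prolong H)
      (f := fun i y => (f i y, fderiv ℝ (f i) y))
      (g := fun y => (g y, fderiv ℝ g y)) o1 o2 e5 hg' hgΩ' h1 o3
    refine h2.congr ?_ (hD hg hgΩ)
    filter_upwards [hf, eventually_graph_mem hC hΩ h.uniformly (hg.continuousOn.mono hCV) hgΩ]
      with i h1 h2 using hD h1 h2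

end CkConvergence

/-! ### Integrals depending on a parameter -/

section ParametricIntegral

variable {X F : Type} [NormedAddCommGroup X] [NormedSpace ℝ X] [FiniteDimensional ℝ X]
  [NormedAddCommGroup F] [NormedSpace ℝ F] [CompleteSpace F]

theorem isOpen_setOf_forall_Icc_mem {X : Type*} [TopologicalSpace X] {O : Set (ℝ × X)}
    (hO : IsOpen O) : IsOpen {x | ∀ t ∈ Icc (0 : ℝ) 1, (t, x) ∈ O} := by
  rw [isOpen_iff_mem_nhds]
  intro x hx
  have h := (isCompact_Icc (a := (0 : ℝ)) (b := 1)).eventually_forall_of_forall_eventually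
    (x₀ := x) (P := fun x t => (t, x) ∈ O) (fun t ht => by
      have : Tendsto (fun z : X × ℝ => (z.2, z.1)) (𝓝 (x, t)) (𝓝 (t, x)) :=
        (continuous_snd.prodMk continuous_fst).continuousAt
      exact this (hO.mem_nhds (hx t ht)))
  exact h

theorem hasFDerivAt_integral_param {O : Set (ℝ × X)} (hO : IsOpen O) {g : ℝ × X → F}
    (hg : ContDiffOn ℝ ∞ g O) {x : X} (hx : ∀ t ∈ Icc (0 : ℝ) 1, (t, x) ∈ O) :
    HasFDerivAt (fun x => ∫ t in (0 : ℝ)..1, g (t, x))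
      (∫ t in (0 : ℝ)..1, (fderiv ℝ g (t, x)).comp (ContinuousLinearMap.inr ℝ ℝ X)) x := by
  have hg' : ContDiffOn ℝ ∞ (fun p => (fderiv ℝ g p).comp (ContinuousLinearMap.inr ℝ ℝ X)) O :=
    (hg.fderiv_of_isOpen hO (by simp)).clm_comp contDiffOn_const
  have hU := (isOpen_setOf_forall_Icc_mem hO).mem_nhds hx
  obtain ⟨ε, hε, hball⟩ := Metric.nhds_basis_closedBall.mem_iff.1 hU
  have hK : IsCompact (Icc (0 : ℝ) 1 ×ˢ Metric.closedBall x ε) :=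
    isCompact_Icc.prod (isCompact_closedBall x ε)
  have hKO : Icc (0 : ℝ) 1 ×ˢ Metric.closedBall x ε ⊆ O := fun p hp => hball hp.2 p.1 hp.1
  obtain ⟨B, hB⟩ := hK.exists_bound_of_continuousOn (hg'.continuousOn.mono hKO)
  have hI : uIoc (0 : ℝ) 1 ⊆ Icc 0 1 := by
    rw [uIoc_of_le zero_le_one]; exact Ioc_subset_Icc_self
  have hcont : ∀ {G : Type} [NormedAddCommGroup G] {k : ℝ × X → G}, ContinuousOn k O →
      ∀ y ∈ Metric.closedBall x ε, ContinuousOn (fun t => k (t, y)) (Icc (0 : ℝ) 1) :=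
    fun hk y hy => hk.comp (by fun_prop) fun t ht => hball hy t ht
  refine intervalIntegral.hasFDerivAt_integral_of_dominated_of_fderiv_le
    (F := fun x t => g (t, x))
    (F' := fun x t => (fderiv ℝ g (t, x)).comp (ContinuousLinearMap.inr ℝ ℝ X))
    (Metric.closedBall_mem_nhds x hε) ?_ ?_ ?_ (bound := fun _ => B) ?_ ?_ ?_
  · filter_upwards [Metric.closedBall_mem_nhds x hε] with y hy
    exact ((hcont hg.continuousOn y hy).mono hI).aestronglyMeasurable measurableSet_uIoc
  · refine ContinuousOn.intervalIntegrable ?_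
    rw [uIcc_of_le zero_le_one]
    exact hcont hg.continuousOn x (Metric.mem_closedBall_self hε.le)
  · exact ((hcont hg'.continuousOn x (Metric.mem_closedBall_self hε.le)).mono
      hI).aestronglyMeasurable measurableSet_uIoc
  · exact .of_forall fun t ht y hy => hB (t, y) ⟨hI ht, hy⟩
  · exact intervalIntegrable_const
  · refine .of_forall fun t ht y hy => ?_
    have h1 : HasFDerivAt g (fderiv ℝ g (t, y)) (t, y) :=
      ((hg.differentiableOn (by simp)).differentiableAt
        (hO.mem_nhds (hball hy t (hI ht)))).hasFDerivAt
    exact h1.comp y (hasFDerivAt_prodMk_right t y)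

/-- An integral over `[0, 1]` of a function that is jointly smooth in the variable and the
parameter is smooth in the parameter. -/
theorem contDiffOn_integral_param {O : Set (ℝ × X)} (hO : IsOpen O) {g : ℝ × X → F}
    (hg : ContDiffOn ℝ ∞ g O) :
    ContDiffOn ℝ ∞ (fun x => ∫ t in (0 : ℝ)..1, g (t, x)) {x | ∀ t ∈ Icc (0 : ℝ) 1, (t, x) ∈ O} := by
  rw [contDiffOn_infty]
  intro n
  induction n generalizing F with
  | zero =>
    rw [Nat.cast_zero, contDiffOn_zero]
    exact fun x hx => (hasFDerivAt_integral_param hO hg hx).continuousAt.continuousWithinAt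
  | succ n ih =>
    rw [Nat.cast_add, Nat.cast_one, contDiffOn_succ_iff_fderiv_of_isOpen
      (isOpen_setOf_forall_Icc_mem hO)]
    refine ⟨fun x hx =>
      (hasFDerivAt_integral_param hO hg hx).differentiableAt.differentiableWithinAt, by simp, ?_⟩
    have hg' : ContDiffOn ℝ ∞ (fun p => (fderiv ℝ g p).comp (ContinuousLinearMap.inr ℝ ℝ X)) O :=
      (hg.fderiv_of_isOpen hO (by simp)).clm_comp contDiffOn_const
    exact (ih hg').congr fun x hx => (hasFDerivAt_integral_param hO hg hx).fderiv

end ParametricIntegral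

/-! ### Hadamard's lemma with parameters -/

section Hadamard

variable {E F Z : Type} [NormedAddCommGroup E] [NormedSpace ℝ E] [FiniteDimensional ℝ E]
  [NormedAddCommGroup F] [NormedSpace ℝ F] [CompleteSpace F]
  [NormedAddCommGroup Z] [NormedSpace ℝ Z] [FiniteDimensional ℝ Z]

/-- The pairs of points of a fibre of `Ω` whose segment lies in `Ω`. -/
def segmentSet (Ω : Set (E × Z)) : Set (E × (Z × Z)) :=
  {p | ∀ s ∈ Icc (0 : ℝ) 1, (p.1, p.2.2 + s • (p.2.1 - p.2.2)) ∈ Ω}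

theorem isOpen_segmentSet {Ω : Set (E × Z)} (hΩ : IsOpen Ω) : IsOpen (segmentSet Ω) :=
  isOpen_setOf_forall_Icc_mem (X := E × (Z × Z))
    (O := {q | (q.2.1, q.2.2.2 + q.1 • (q.2.2.1 - q.2.2.2)) ∈ Ω}) (hΩ.preimage (by fun_prop))

/-- Hadamard's lemma in the second variable:
`G (y, ξ) - G (y, ζ) = H (y, ξ, ζ) (ξ - ζ)` with `H` smooth, whose restriction to the diagonal is
the partial derivative of `G`. -/
theorem exists_hadamard {Ω : Set (E × Z)} (hΩ : IsOpen Ω) {G : E × Z → F}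
    (hG : ContDiffOn ℝ ∞ G Ω) : ∃ H : E × (Z × Z) → (Z →L[ℝ] F),
      ContDiffOn ℝ ∞ H (segmentSet Ω) ∧
      (∀ p ∈ segmentSet Ω, G (p.1, p.2.1) - G (p.1, p.2.2) = H p (p.2.1 - p.2.2)) ∧
      ∀ y ξ, H (y, (ξ, ξ)) = (fderiv ℝ G (y, ξ)).comp (ContinuousLinearMap.inr ℝ E Z) := by
  let P : ℝ × (E × (Z × Z)) → E × Z := fun q => (q.2.1, q.2.2.2 + q.1 • (q.2.2.1 - q.2.2.2))
  have hP : ContDiff ℝ ∞ P := by fun_prop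
  let D : E × Z → (Z →L[ℝ] F) := fun p => (fderiv ℝ G p).comp (ContinuousLinearMap.inr ℝ E Z)
  have hD : ContDiffOn ℝ ∞ D Ω := (hG.fderiv_of_isOpen hΩ (by simp)).clm_comp contDiffOn_const
  have hDP : ContDiffOn ℝ ∞ (fun q => D (P q)) (P ⁻¹' Ω) :=
    hD.comp hP.contDiffOn fun q hq => hq
  refine ⟨fun p => ∫ s in (0 : ℝ)..1, D (P (s, p)),
    contDiffOn_integral_param (hΩ.preimage hP.continuous) hDP, ?_, ?_⟩
  · rintro ⟨y, ξ, ζ⟩ hp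
    have hc : ContinuousOn (fun s : ℝ => D (P (s, (y, (ξ, ζ))))) (uIcc (0 : ℝ) 1) := by
      rw [uIcc_of_le zero_le_one]
      exact hDP.continuousOn.comp (by fun_prop) fun s hs => hp s hs
    have h1 : ∀ s ∈ uIcc (0 : ℝ) 1, HasDerivAt (fun s : ℝ => G (P (s, (y, (ξ, ζ)))))
        (D (P (s, (y, (ξ, ζ)))) (ξ - ζ)) s := by
      intro s hs
      rw [uIcc_of_le zero_le_one] at hs
      have h2 : HasFDerivAt G (fderiv ℝ G (P (s, (y, (ξ, ζ))))) (P (s, (y, (ξ, ζ)))) :=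
        ((hG.differentiableOn (by simp)).differentiableAt (hΩ.mem_nhds (hp s hs))).hasFDerivAt
      have h3 : HasDerivAt (fun s : ℝ => P (s, (y, (ξ, ζ)))) ((0 : E), ξ - ζ) s := by
        refine (hasDerivAt_const s y).prodMk ?_
        simpa using ((hasDerivAt_id s).smul_const (ξ - ζ)).const_add ζ
      exact h2.comp_hasDerivAt s h3
    have h4 := intervalIntegral.integral_eq_sub_of_hasDerivAt h1
      (hc.clm_apply continuousOn_const).intervalIntegrable
    have h5 : (∫ s in (0 : ℝ)..1, D (P (s, (y, (ξ, ζ))))) (ξ - ζ) =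
        ∫ s in (0 : ℝ)..1, D (P (s, (y, (ξ, ζ)))) (ξ - ζ) :=
      ContinuousLinearMap.intervalIntegral_apply hc.intervalIntegrable _
    simp only [h5, h4]
    simp [P]
  · intro y ξ
    simp [P, D]

theorem tendstoCk_of_tendsto {E : Type} [NormedAddCommGroup E] [NormedSpace ℝ E]
    {F : Type} [NormedAddCommGroup F] [NormedSpace ℝ F] {ι : Type*} {l : Filter ι} {C : Set E}
    (q : ℕ) {c : ι → F} {c₀ : F} (h : Tendsto c l (𝓝 c₀)) :
    TendstoCk l C q (fun i _ => c i) (fun _ => c₀) := by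
  have h0 : TendstoUniformlyOn (fun i (_ : E) => c i) (fun _ => c₀) l C := by
    intro u hu
    filter_upwards [Uniform.tendsto_nhds_right.1 h hu] with i hi y _ using hi
  cases q with
  | zero => exact h0
  | succ q =>
    refine ⟨h0, ?_⟩
    simp only [fderiv_fun_const]
    exact TendstoCk.const

/-- The difference quotients of `G` in the direction of a real parameter converge together with
all derivatives in the other variable. -/
theorem tendstoCk_slope {Ω : Set (E × ℝ)} (hΩ : IsOpen Ω) {G : E × ℝ → F}
    (hG : ContDiffOn ℝ ∞ G Ω) {C : Set E} (hC : IsCompact C) (hCΩ : ∀ y ∈ C, (y, (0 : ℝ)) ∈ Ω)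
    (q : ℕ) :
    TendstoCk (𝓝[≠] (0 : ℝ)) C q (fun t y => t⁻¹ • (G (y, t) - G (y, 0)))
      (fun y => fderiv ℝ G (y, 0) (0, 1)) := by
  obtain ⟨H, hH, hH1, hH2⟩ := exists_hadamard hΩ hG
  have hO := isOpen_segmentSet hΩ
  let Ω' : Set (E × ℝ) := (fun p : E × ℝ => (p.1, (p.2, (0 : ℝ)))) ⁻¹' segmentSet Ω
  have hΩ' : IsOpen Ω' := hO.preimage (by fun_prop)
  have hH₀ : ContDiffOn ℝ ∞ (fun p : E × ℝ => H (p.1, (p.2, 0))) Ω' :=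
    hH.comp (ContDiff.contDiffOn (by fun_prop)) fun p hp => hp
  have hH' : ContDiffOn ℝ ∞ (fun p : E × ℝ => H (p.1, (p.2, 0)) 1) Ω' :=
    hH₀.clm_apply contDiffOn_const
  have hC' : ∀ y ∈ C, (y, (0 : ℝ)) ∈ Ω' := by
    intro y hy s _
    simpa using hCΩ y hy
  have ht : Tendsto (fun t : ℝ => t) (𝓝[≠] 0) (𝓝 0) := tendsto_nhdsWithin_of_tendsto_nhds tendsto_id
  have h1 := tendstoCk_of_tendsto (E := E) (C := C) q ht
  have h2 := h1.comp_graph hC isOpen_univ (subset_univ C) hΩ' hH'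
    (.of_forall fun t => contDiffOn_const) contDiffOn_const hC'
  refine h2.congr ?_ (fun y _ => .of_forall fun z => ?_)
  · filter_upwards [eventually_graph_mem hC hΩ' h1.uniformly continuousOn_const hC',
      self_mem_nhdsWithin] with t ht ht0 y hy
    have : ContinuousAt (fun z : E => (z, t)) y := by fun_prop
    filter_upwards [this (hΩ'.mem_nhds (ht y hy))] with z hz
    have h3 := hH1 _ hz
    simp only [sub_zero] at h3
    rw [h3, ← map_smul, smul_eq_mul, inv_mul_cancel₀ ht0]
  · simp [hH2]

/-- If the fibres of `Ω` are convex and contain `0`, and the partial derivative of `G` vanishes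
along the zero section, then the difference of two values of `G` is the value of a smooth
bilinear-map-valued function on the pair of points and their difference. -/
theorem exists_quadratic_remainder {Ω : Set (E × Z)} (hΩ : IsOpen Ω) {G : E × Z → F}
    (hG : ContDiffOn ℝ ∞ G Ω) (hconv : ∀ y, Convex ℝ {z | (y, z) ∈ Ω})
    (h0 : ∀ y z, (y, z) ∈ Ω → (y, (0 : Z)) ∈ Ω)
    (hd : ∀ y, (y, (0 : Z)) ∈ Ω → (fderiv ℝ G (y, 0)).comp (ContinuousLinearMap.inr ℝ E Z) = 0) :
    ∃ H : E × (Z × Z) → (Z × Z →L[ℝ] Z →L[ℝ] F),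
      ContDiffOn ℝ ∞ H {p | (p.1, p.2.1) ∈ Ω ∧ (p.1, p.2.2) ∈ Ω} ∧
      ∀ p : E × (Z × Z), (p.1, p.2.1) ∈ Ω → (p.1, p.2.2) ∈ Ω →
        G (p.1, p.2.1) - G (p.1, p.2.2) = H p p.2 (p.2.1 - p.2.2) := by
  have hc₁ : CompleteSpace (Z →L[ℝ] F) := inferInstance
  have hc₂ : FiniteDimensional ℝ (Z × Z) := inferInstance
  obtain ⟨H₁, hH₁, hH₁', hdiag⟩ := exists_hadamard hΩ hG
  obtain ⟨H₂, hH₂, hH₂', -⟩ := exists_hadamard (Z := Z × Z) (F := Z →L[ℝ] F)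
    (isOpen_segmentSet hΩ) hH₁
  have hseg : ∀ (y : E) (ξ ζ : Z), (y, ξ) ∈ Ω → (y, ζ) ∈ Ω → (y, (ξ, ζ)) ∈ segmentSet Ω := by
    intro y ξ ζ h1 h2 s hs
    have h3 := hconv y h2 h1 (a := 1 - s) (b := s) (by linarith [hs.2]) hs.1 (by ring)
    have : (1 - s) • ζ + s • ξ = ζ + s • (ξ - ζ) := by module
    rwa [mem_ofPred_eq, this] at h3
  have hscale : ∀ (y : E) (ξ : Z), (y, ξ) ∈ Ω → ∀ s ∈ Icc (0 : ℝ) 1, (y, s • ξ) ∈ Ω := by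
    intro y ξ h1 s hs
    have := hseg y ξ 0 h1 (h0 y ξ h1) s hs
    simpa using this
  have hmem : ∀ p : E × (Z × Z), (p.1, p.2.1) ∈ Ω → (p.1, p.2.2) ∈ Ω →
      (p.1, (p.2, (0 : Z × Z))) ∈ segmentSet (segmentSet Ω) := by
    rintro ⟨y, ξ, ζ⟩ h1 h2 s hs
    simp only [sub_zero, zero_add]
    exact hseg y _ _ (hscale y ξ h1 s hs) (hscale y ζ h2 s hs)
  have hinc : ContDiff ℝ ∞ fun p : E × (Z × Z) => (p.1, (p.2, (0 : Z × Z))) := by fun_prop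
  refine ⟨fun p => H₂ (p.1, (p.2, 0)), hH₂.comp hinc.contDiffOn fun p hp => hmem p hp.1 hp.2, ?_⟩
  intro p h1 h2
  rw [hH₁' p (hseg _ _ _ h1 h2)]
  have h3 := hH₂' _ (hmem p h1 h2)
  have h4 : H₁ (p.1, 0) = 0 := by
    rw [← hd p.1 (h0 _ _ h1)]
    exact hdiag p.1 0
  simp only [h4, sub_zero] at h3
  rw [← h3]

end Hadamard

/-! ### Hölder norms of functions on convex sets -/

section HolderNorm

variable {E F G H Z : Type} [NormedAddCommGroup E] [NormedSpace ℝ E]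
  [NormedAddCommGroup F] [NormedSpace ℝ F] [NormedAddCommGroup G] [NormedSpace ℝ G]
  [NormedAddCommGroup H] [NormedSpace ℝ H] [NormedAddCommGroup Z] [NormedSpace ℝ Z]

/-- The `C^{r,α}` norm of `f` on `S`. -/
def hnorm (r : ℕ) (α : ℝ) (S : Set E) (f : E → F) : ℝ≥0∞ :=
  (∑ j ∈ Finset.range (r + 1), supNorm (iteratedFDeriv ℝ j f) S) +
    holderSeminorm α (iteratedFDeriv ℝ r f) S

variable {α : ℝ} {S V : Set E} {r : ℕ}

theorem supNorm_le_iff {f : E → F} {c : ℝ≥0∞} : supNorm f S ≤ c ↔ ∀ y ∈ S, ‖f y‖ₑ ≤ c := by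
  simp [supNorm]

theorem enorm_le_supNorm {f : E → F} {y : E} (hy : y ∈ S) : ‖f y‖ₑ ≤ supNorm f S :=
  supNorm_le_iff.1 le_rfl y hy

theorem holderSeminorm_le_iff {f : E → F} {c : ℝ≥0∞} :
    holderSeminorm α f S ≤ c ↔ ∀ y ∈ S, ∀ z ∈ S, y ≠ z → ‖f y - f z‖ₑ ≤ c * ‖y - z‖ₑ ^ α := by
  simp only [holderSeminorm, iSup_le_iff]
  refine forall₂_congr fun y _ => forall₂_congr fun z _ => forall_congr' fun hyz => ?_
  have h0 : ‖y - z‖ₑ ≠ 0 := by simpa [sub_eq_zero] using hyz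
  exact ENNReal.div_le_iff (by simp [ENNReal.rpow_eq_zero_iff, h0])
    (by simp [ENNReal.rpow_eq_top_iff, h0])

theorem enorm_sub_le_holderSeminorm {f : E → F} {y z : E} (hy : y ∈ S) (hz : z ∈ S) :
    ‖f y - f z‖ₑ ≤ holderSeminorm α f S * ‖y - z‖ₑ ^ α := by
  by_cases hyz : y = z
  · simp [hyz]
  · exact holderSeminorm_le_iff.1 le_rfl y hy z hz hyz

theorem supNorm_congr {f : E → F} {g : E → G} (h : ∀ y ∈ S, ‖f y‖ₑ = ‖g y‖ₑ) :
    supNorm f S = supNorm g S :=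
  le_antisymm (supNorm_le_iff.2 fun y hy => (h y hy).trans_le (enorm_le_supNorm hy))
    (supNorm_le_iff.2 fun y hy => (h y hy).symm.trans_le (enorm_le_supNorm hy))

theorem holderSeminorm_congr {f : E → F} {g : E → G}
    (h : ∀ y ∈ S, ∀ z ∈ S, ‖f y - f z‖ₑ = ‖g y - g z‖ₑ) :
    holderSeminorm α f S = holderSeminorm α g S :=
  le_antisymm
    (holderSeminorm_le_iff.2 fun y hy z hz _ =>
      (h y hy z hz).trans_le (enorm_sub_le_holderSeminorm hy hz))
    (holderSeminorm_le_iff.2 fun y hy z hz _ =>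
      (h y hy z hz).symm.trans_le (enorm_sub_le_holderSeminorm hy hz))

theorem enorm_iteratedFDeriv_succ (f : E → F) (j : ℕ) (y : E) :
    ‖iteratedFDeriv ℝ (j + 1) f y‖ₑ = ‖iteratedFDeriv ℝ j (fderiv ℝ f) y‖ₑ := by
  rw [← ofReal_norm, ← ofReal_norm, norm_iteratedFDeriv_fderiv]

theorem hnorm_zero (f : E → F) : hnorm 0 α S f = supNorm f S + holderSeminorm α f S := by
  have h1 : supNorm (iteratedFDeriv ℝ 0 f) S = supNorm f S :=
    supNorm_congr fun y _ => by rw [← ofReal_norm, ← ofReal_norm, norm_iteratedFDeriv_zero]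
  have h2 : holderSeminorm α (iteratedFDeriv ℝ 0 f) S = holderSeminorm α f S :=
    holderSeminorm_congr fun y _ z _ => by
      rw [← edist_eq_enorm_sub, ← edist_eq_enorm_sub, edist_dist, edist_dist,
        dist_iteratedFDeriv_zero]
  simp [hnorm, h1, h2]

theorem hnorm_succ (f : E → F) :
    hnorm (r + 1) α S f = supNorm f S + hnorm r α S (fderiv ℝ f) := by
  have h1 : supNorm (iteratedFDeriv ℝ 0 f) S = supNorm f S :=
    supNorm_congr fun y _ => by rw [← ofReal_norm, ← ofReal_norm, norm_iteratedFDeriv_zero]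
  have h2 : ∀ j, supNorm (iteratedFDeriv ℝ (j + 1) f) S =
      supNorm (iteratedFDeriv ℝ j (fderiv ℝ f)) S := fun j =>
    supNorm_congr fun y _ => enorm_iteratedFDeriv_succ f j y
  have h3 : holderSeminorm α (iteratedFDeriv ℝ (r + 1) f) S =
      holderSeminorm α (iteratedFDeriv ℝ r (fderiv ℝ f)) S :=
    holderSeminorm_congr fun y _ z _ => by
      rw [← edist_eq_enorm_sub, ← edist_eq_enorm_sub, edist_dist, edist_dist,
        dist_iteratedFDeriv_succ]
  rw [hnorm, Finset.sum_range_succ', h1, h3, hnorm]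
  simp only [h2]
  ring

theorem supNorm_le_hnorm (f : E → F) : supNorm f S ≤ hnorm r α S f := by
  cases r with
  | zero => rw [hnorm_zero]; exact le_self_add
  | succ r => rw [hnorm_succ]; exact le_self_add

theorem hnorm_fderiv_le (f : E → F) : hnorm r α S (fderiv ℝ f) ≤ hnorm (r + 1) α S f := by
  rw [hnorm_succ]; exact le_add_self

theorem hnorm_congr {f g : E → F} (h : ∀ y ∈ S, f =ᶠ[𝓝 y] g) : hnorm r α S f = hnorm r α S g := by
  have h1 : ∀ j, ∀ y ∈ S, iteratedFDeriv ℝ j f y = iteratedFDeriv ℝ j g y :=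
    fun j y hy => ((h y hy).iteratedFDeriv ℝ j).eq_of_nhds
  have h2 : ∀ j, supNorm (iteratedFDeriv ℝ j f) S = supNorm (iteratedFDeriv ℝ j g) S :=
    fun j => supNorm_congr fun y hy => by rw [h1 j y hy]
  have h3 : holderSeminorm α (iteratedFDeriv ℝ r f) S =
      holderSeminorm α (iteratedFDeriv ℝ r g) S :=
    holderSeminorm_congr fun y hy z hz => by rw [h1 r y hy, h1 r z hz]
  simp only [hnorm, h2, h3]

theorem hnorm_add_le (hV : IsOpen V) (hS : S ⊆ V) {f g : E → F} (hf : ContDiffOn ℝ ∞ f V)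
    (hg : ContDiffOn ℝ ∞ g V) :
    hnorm r α S (fun y => f y + g y) ≤ hnorm r α S f + hnorm r α S g := by
  have h0 : ∀ {F : Type} [NormedAddCommGroup F] [NormedSpace ℝ F] (f g : E → F),
      supNorm (fun y => f y + g y) S ≤ supNorm f S + supNorm g S := fun f g =>
    supNorm_le_iff.2 fun y hy => (enorm_add_le _ _).trans
      (add_le_add (enorm_le_supNorm hy) (enorm_le_supNorm hy))
  induction r generalizing F with
  | zero =>
    simp only [hnorm_zero]
    have h1 : holderSeminorm α (fun y => f y + g y) S ≤
        holderSeminorm α f S + holderSeminorm α g S := by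
      refine holderSeminorm_le_iff.2 fun y hy z hz _ => ?_
      rw [add_sub_add_comm, add_mul]
      exact (enorm_add_le _ _).trans (add_le_add (enorm_sub_le_holderSeminorm hy hz)
        (enorm_sub_le_holderSeminorm hy hz))
    exact (add_le_add (h0 f g) h1).trans_eq (by ring)
  | succ r ih =>
    simp only [hnorm_succ]
    have h1 : hnorm r α S (fderiv ℝ fun y => f y + g y) =
        hnorm r α S fun y => fderiv ℝ f y + fderiv ℝ g y :=
      hnorm_congr fun y hy => by
        filter_upwards [hV.mem_nhds (hS hy)] with z hz
        exact fderiv_fun_add ((hf.differentiableOn (by simp)).differentiableAt (hV.mem_nhds hz))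
          ((hg.differentiableOn (by simp)).differentiableAt (hV.mem_nhds hz))
    rw [h1]
    exact (add_le_add (h0 f g) (ih (hf.fderiv_of_isOpen hV (by simp))
      (hg.fderiv_of_isOpen hV (by simp)))).trans_eq (by ring)

theorem enorm_clm_apply_le (L : F →L[ℝ] G) (a : F) : ‖L a‖ₑ ≤ ENNReal.ofReal ‖L‖ * ‖a‖ₑ := by
  rw [← ofReal_norm, ← ofReal_norm, ← ENNReal.ofReal_mul (norm_nonneg _)]
  exact ENNReal.ofReal_le_ofReal (L.le_opNorm a)

theorem enorm_bilin_apply_le {B : F →L[ℝ] G →L[ℝ] H} {b : ℝ≥0}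
    (hB : ∀ x y, ‖B x y‖ ≤ b * ‖x‖ * ‖y‖) (x : F) (y : G) : ‖B x y‖ₑ ≤ b * ‖x‖ₑ * ‖y‖ₑ := by
  have h : ‖B x y‖₊ ≤ b * ‖x‖₊ * ‖y‖₊ := hB x y
  simp only [enorm_eq_nnnorm]
  exact_mod_cast h

theorem hnorm_clm_comp_le (hV : IsOpen V) (hS : S ⊆ V) (L : F →L[ℝ] G) {f : E → F}
    (hf : ContDiffOn ℝ ∞ f V) : hnorm r α S (fun y => L (f y)) ≤ ENNReal.ofReal ‖L‖ * hnorm r α S f := by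
  have h0 : ∀ {F G : Type} [NormedAddCommGroup F] [NormedAddCommGroup G] [NormedSpace ℝ F]
      [NormedSpace ℝ G] (L : F →L[ℝ] G) (f : E → F),
      supNorm (fun y => L (f y)) S ≤ ENNReal.ofReal ‖L‖ * supNorm f S := fun L f =>
    supNorm_le_iff.2 fun y hy => (enorm_clm_apply_le L _).trans (by gcongr; exact enorm_le_supNorm hy)
  induction r generalizing F G with
  | zero =>
    simp only [hnorm_zero]
    have h1 : holderSeminorm α (fun y => L (f y)) S ≤ ENNReal.ofReal ‖L‖ * holderSeminorm α f S := by
      refine holderSeminorm_le_iff.2 fun y hy z hz _ => ?_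
      rw [← map_sub, mul_assoc]
      exact (enorm_clm_apply_le L _).trans (by gcongr; exact enorm_sub_le_holderSeminorm hy hz)
    exact (add_le_add (h0 L f) h1).trans_eq (by ring)
  | succ r ih =>
    simp only [hnorm_succ]
    have h1 : hnorm r α S (fderiv ℝ fun y => L (f y)) =
        hnorm r α S fun y => ContinuousLinearMap.compL ℝ E F G L (fderiv ℝ f y) :=
      hnorm_congr fun y hy => by
        filter_upwards [hV.mem_nhds (hS hy)] with z hz
        exact (L.hasFDerivAt.comp z ((hf.differentiableOn (by simp)).differentiableAt
          (hV.mem_nhds hz)).hasFDerivAt).fderiv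
    rw [h1]
    have h2 : ENNReal.ofReal ‖ContinuousLinearMap.compL ℝ E F G L‖ ≤ ENNReal.ofReal ‖L‖ := by
      refine ENNReal.ofReal_le_ofReal ?_
      refine ContinuousLinearMap.opNorm_le_bound _ (norm_nonneg _) fun A => ?_
      exact L.opNorm_comp_le A
    calc _ ≤ ENNReal.ofReal ‖L‖ * supNorm f S + ENNReal.ofReal ‖ContinuousLinearMap.compL ℝ E F G L‖ *
          hnorm r α S (fderiv ℝ f) := add_le_add (h0 L f) (ih _ (hf.fderiv_of_isOpen hV (by simp)))
      _ ≤ ENNReal.ofReal ‖L‖ * supNorm f S + ENNReal.ofReal ‖L‖ * hnorm r α S (fderiv ℝ f) := by gcongr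
      _ = _ := by ring

theorem hnorm_prodMk_le (hV : IsOpen V) (hS : S ⊆ V) {f : E → F} {g : E → G}
    (hf : ContDiffOn ℝ ∞ f V) (hg : ContDiffOn ℝ ∞ g V) :
    hnorm r α S (fun y => (f y, g y)) ≤ hnorm r α S f + hnorm r α S g := by
  have h1 : (fun y => (f y, g y)) = fun y => ContinuousLinearMap.inl ℝ F G (f y) +
      ContinuousLinearMap.inr ℝ F G (g y) := by
    funext y; simp
  have h2 : ENNReal.ofReal ‖ContinuousLinearMap.inl ℝ F G‖ ≤ 1 := by
    rw [ENNReal.ofReal_le_one]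
    exact ContinuousLinearMap.norm_inl_le_one ℝ F G
  have h3 : ENNReal.ofReal ‖ContinuousLinearMap.inr ℝ F G‖ ≤ 1 := by
    rw [ENNReal.ofReal_le_one]
    exact ContinuousLinearMap.norm_inr_le_one ℝ F G
  rw [h1]
  calc _ ≤ _ := hnorm_add_le hV hS ((ContinuousLinearMap.inl ℝ F G).contDiff.comp_contDiffOn hf)
        ((ContinuousLinearMap.inr ℝ F G).contDiff.comp_contDiffOn hg)
    _ ≤ _ := add_le_add (hnorm_clm_comp_le hV hS _ hf) (hnorm_clm_comp_le hV hS _ hg)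
    _ ≤ 1 * hnorm r α S f + 1 * hnorm r α S g := by gcongr
    _ = _ := by simp

/-- On a set of diameter at most `d`, a Lipschitz bound gives a Hölder bound. -/
theorem enorm_sub_le_rpow (hα : α ∈ Ioo (0 : ℝ) 1) {d : ℝ≥0}
    (hd : ∀ y ∈ S, ∀ z ∈ S, ‖y - z‖ₑ ≤ d) {y z : E} (hy : y ∈ S) (hz : z ∈ S) :
    ‖y - z‖ₑ ≤ (d : ℝ≥0∞) ^ (1 - α) * ‖y - z‖ₑ ^ α := by
  calc ‖y - z‖ₑ = ‖y - z‖ₑ ^ ((1 - α) + α) := by simp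
    _ = ‖y - z‖ₑ ^ (1 - α) * ‖y - z‖ₑ ^ α :=
        ENNReal.rpow_add_of_nonneg _ _ (by linarith [hα.2]) hα.1.le
    _ ≤ _ := by
        gcongr
        · linarith [hα.2]
        · exact hd y hy z hz

theorem holderSeminorm_le_supNorm_fderiv (hα : α ∈ Ioo (0 : ℝ) 1) {d : ℝ≥0}
    (hd : ∀ y ∈ S, ∀ z ∈ S, ‖y - z‖ₑ ≤ d) (hconv : Convex ℝ S) (hV : IsOpen V) (hS : S ⊆ V)
    {f : E → F} (hf : ContDiffOn ℝ ∞ f V) :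
    holderSeminorm α f S ≤ (d : ℝ≥0∞) ^ (1 - α) * supNorm (fderiv ℝ f) S := by
  refine holderSeminorm_le_iff.2 fun y hy z hz hyz => ?_
  have h1 : ‖f y - f z‖ₑ ≤ supNorm (fderiv ℝ f) S * ‖y - z‖ₑ := by
    by_cases htop : supNorm (fderiv ℝ f) S = ⊤
    · rw [htop, ENNReal.top_mul (by simpa [sub_eq_zero] using hyz)]
      exact le_top
    · have h2 := hconv.norm_image_sub_le_of_norm_fderiv_le (𝕜 := ℝ) (f := f)
        (C := (supNorm (fderiv ℝ f) S).toReal)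
        (fun w hw => (hf.differentiableOn (by simp)).differentiableAt (hV.mem_nhds (hS hw)))
        (fun w hw => by
          rw [← toReal_enorm]
          exact ENNReal.toReal_mono htop (enorm_le_supNorm hw)) hz hy
      rw [← ENNReal.ofReal_toReal htop, ← ofReal_norm, ← ofReal_norm,
        ← ENNReal.ofReal_mul ENNReal.toReal_nonneg]
      exact ENNReal.ofReal_le_ofReal h2
  calc _ ≤ _ := h1
    _ ≤ supNorm (fderiv ℝ f) S * ((d : ℝ≥0∞) ^ (1 - α) * ‖y - z‖ₑ ^ α) := by
        gcongr; exact enorm_sub_le_rpow hα hd hy hz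
    _ = _ := by ring

theorem hnorm_le_hnorm_succ (hα : α ∈ Ioo (0 : ℝ) 1) {d : ℝ≥0}
    (hd : ∀ y ∈ S, ∀ z ∈ S, ‖y - z‖ₑ ≤ d) (hconv : Convex ℝ S) (hV : IsOpen V) (hS : S ⊆ V)
    {f : E → F} (hf : ContDiffOn ℝ ∞ f V) :
    hnorm r α S f ≤ (1 + (d : ℝ≥0∞) ^ (1 - α)) * hnorm (r + 1) α S f := by
  induction r generalizing F with
  | zero =>
    rw [hnorm_succ, hnorm_zero, hnorm_zero]
    calc _ ≤ supNorm f S + (d : ℝ≥0∞) ^ (1 - α) * supNorm (fderiv ℝ f) S := by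
          gcongr; exact holderSeminorm_le_supNorm_fderiv hα hd hconv hV hS hf
      _ ≤ supNorm f S + (d : ℝ≥0∞) ^ (1 - α) * supNorm (fderiv ℝ f) S +
          (supNorm (fderiv ℝ f) S + holderSeminorm α (fderiv ℝ f) S +
            (d : ℝ≥0∞) ^ (1 - α) * (supNorm f S + holderSeminorm α (fderiv ℝ f) S)) :=
          le_self_add
      _ = _ := by ring
  | succ r ih =>
    rw [hnorm_succ, hnorm_succ (r := r + 1)]
    calc _ ≤ supNorm f S + (1 + (d : ℝ≥0∞) ^ (1 - α)) * hnorm (r + 1) α S (fderiv ℝ f) := by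
          gcongr; exact ih (hf.fderiv_of_isOpen hV (by simp))
      _ ≤ supNorm f S + (1 + (d : ℝ≥0∞) ^ (1 - α)) * hnorm (r + 1) α S (fderiv ℝ f) +
          (d : ℝ≥0∞) ^ (1 - α) * supNorm f S := le_self_add
      _ = _ := by ring

theorem supNorm_bilin_le {B : F →L[ℝ] G →L[ℝ] H} {b : ℝ≥0}
    (hB : ∀ x y, ‖B x y‖ ≤ b * ‖x‖ * ‖y‖) (f : E → F) (g : E → G) :
    supNorm (fun y => B (f y) (g y)) S ≤ b * supNorm f S * supNorm g S :=
  supNorm_le_iff.2 fun y hy => (enorm_bilin_apply_le hB _ _).trans (by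
    gcongr
    · exact enorm_le_supNorm hy
    · exact enorm_le_supNorm hy)

theorem holderSeminorm_bilin_le {B : F →L[ℝ] G →L[ℝ] H} {b : ℝ≥0}
    (hB : ∀ x y, ‖B x y‖ ≤ b * ‖x‖ * ‖y‖) (f : E → F) (g : E → G) :
    holderSeminorm α (fun y => B (f y) (g y)) S ≤
      b * holderSeminorm α f S * supNorm g S + b * supNorm f S * holderSeminorm α g S := by
  refine holderSeminorm_le_iff.2 fun y hy z hz _ => ?_
  have h2 : B (f y) (g y) - B (f z) (g z) = B (f y - f z) (g y) + B (f z) (g y - g z) := by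
    rw [map_sub, map_sub, sub_apply]; abel
  have h3 := enorm_sub_le_holderSeminorm (α := α) (f := f) hy hz
  have h4 := enorm_sub_le_holderSeminorm (α := α) (f := g) hy hz
  have h5 : ‖g y‖ₑ ≤ supNorm g S := enorm_le_supNorm hy
  have h6 : ‖f z‖ₑ ≤ supNorm f S := enorm_le_supNorm hz
  rw [h2]
  calc _ ≤ _ := enorm_add_le _ _
    _ ≤ b * ‖f y - f z‖ₑ * ‖g y‖ₑ + b * ‖f z‖ₑ * ‖g y - g z‖ₑ :=
      add_le_add (enorm_bilin_apply_le hB _ _) (enorm_bilin_apply_le hB _ _)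
    _ ≤ b * (holderSeminorm α f S * ‖y - z‖ₑ ^ α) * supNorm g S +
        b * supNorm f S * (holderSeminorm α g S * ‖y - z‖ₑ ^ α) := by
      gcongr
    _ = _ := by ring

/-- The product estimate: the `C^{r,α}` norm is submultiplicative up to a constant, for any
bilinear product. -/
theorem exists_hnorm_bilin_le (hα : α ∈ Ioo (0 : ℝ) 1) {d : ℝ≥0}
    (hd : ∀ y ∈ S, ∀ z ∈ S, ‖y - z‖ₑ ≤ d) (hconv : Convex ℝ S) (hV : IsOpen V) (hS : S ⊆ V)
    (r : ℕ) : ∃ c : ℝ≥0, ∀ {F G H : Type} [NormedAddCommGroup F] [NormedSpace ℝ F]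
      [NormedAddCommGroup G] [NormedSpace ℝ G] [NormedAddCommGroup H] [NormedSpace ℝ H]
      (B : F →L[ℝ] G →L[ℝ] H) (b : ℝ≥0), (∀ x y, ‖B x y‖ ≤ b * ‖x‖ * ‖y‖) →
      ∀ {f : E → F} {g : E → G}, ContDiffOn ℝ ∞ f V → ContDiffOn ℝ ∞ g V →
      hnorm r α S (fun y => B (f y) (g y)) ≤ c * b * hnorm r α S f * hnorm r α S g := by
  induction r with
  | zero =>
    refine ⟨1, fun B b hB f g hf hg => ?_⟩
    simp only [hnorm_zero, ENNReal.coe_one, one_mul]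
    calc _ ≤ _ := add_le_add (supNorm_bilin_le hB f g) (holderSeminorm_bilin_le hB f g)
      _ ≤ b * supNorm f S * supNorm g S + (b * holderSeminorm α f S * supNorm g S +
          b * supNorm f S * holderSeminorm α g S) +
          b * holderSeminorm α f S * holderSeminorm α g S := le_self_add
      _ = _ := by ring
  | succ r ih =>
    obtain ⟨c, hc⟩ := ih
    refine ⟨1 + 2 * c * (1 + d ^ (1 - α)), fun {F G H} _ _ _ _ _ _ B b hB f g hf hg => ?_⟩
    have hf' : ContDiffOn ℝ ∞ (fderiv ℝ f) V := hf.fderiv_of_isOpen hV (by simp)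
    have hg' : ContDiffOn ℝ ∞ (fderiv ℝ g) V := hg.fderiv_of_isOpen hV (by simp)
    set c₀ : ℝ≥0∞ := 1 + (d : ℝ≥0∞) ^ (1 - α) with hc₀
    have hcoe : ((1 + 2 * c * (1 + d ^ (1 - α)) : ℝ≥0) : ℝ≥0∞) = 1 + 2 * c * c₀ := by
      rw [hc₀]
      push_cast
      rw [ENNReal.coe_rpow_of_nonneg _ (by linarith [hα.2])]
    have h1 : hnorm r α S (fderiv ℝ fun y => B (f y) (g y)) =
        hnorm r α S fun y => B.precompR E (f y) (fderiv ℝ g y) +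
          B.precompL E (fderiv ℝ f y) (g y) :=
      hnorm_congr fun y hy => by
        filter_upwards [hV.mem_nhds (hS hy)] with z hz
        exact B.fderiv_of_bilinear
          ((hf.differentiableOn (by simp)).differentiableAt (hV.mem_nhds hz))
          ((hg.differentiableOn (by simp)).differentiableAt (hV.mem_nhds hz))
    have hR : ∀ (x : F) (A : E →L[ℝ] G), ‖B.precompR E x A‖ ≤ b * ‖x‖ * ‖A‖ := fun x A =>
      ContinuousLinearMap.opNorm_le_bound _ (by positivity) fun e =>
        ((hB x (A e)).trans (mul_le_mul_of_nonneg_left (A.le_opNorm e) (by positivity))).trans_eq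
          (by ring)
    have hL : ∀ (A : E →L[ℝ] F) (y : G), ‖B.precompL E A y‖ ≤ b * ‖A‖ * ‖y‖ := fun A y =>
      ContinuousLinearMap.opNorm_le_bound _ (by positivity) fun e =>
        ((hB (A e) y).trans (mul_le_mul_of_nonneg_right
          (mul_le_mul_of_nonneg_left (A.le_opNorm e) b.2) (norm_nonneg y))).trans_eq (by ring)
    have n1 : hnorm r α S f ≤ c₀ * hnorm (r + 1) α S f :=
      hnorm_le_hnorm_succ hα hd hconv hV hS hf
    have n2 : hnorm r α S g ≤ c₀ * hnorm (r + 1) α S g :=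
      hnorm_le_hnorm_succ hα hd hconv hV hS hg
    have n3 : hnorm r α S (fderiv ℝ f) ≤ hnorm (r + 1) α S f := hnorm_fderiv_le f
    have n4 : hnorm r α S (fderiv ℝ g) ≤ hnorm (r + 1) α S g := hnorm_fderiv_le g
    have e1 : hnorm r α S (fun y => B.precompR E (f y) (fderiv ℝ g y)) ≤
        c * b * (c₀ * hnorm (r + 1) α S f) * hnorm (r + 1) α S g :=
      (hc (B.precompR E) b hR hf hg').trans (by gcongr)
    have e2 : hnorm r α S (fun y => B.precompL E (fderiv ℝ f y) (g y)) ≤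
        c * b * hnorm (r + 1) α S f * (c₀ * hnorm (r + 1) α S g) :=
      (hc (B.precompL E) b hL hf' hg).trans (by gcongr)
    have s1 : ContDiffOn ℝ ∞ (fun y => B.precompR E (f y) (fderiv ℝ g y)) V :=
      (B.contDiff.comp_contDiffOn hf).clm_comp hg'
    have s2 : ContDiffOn ℝ ∞ (fun y => B.precompL E (fderiv ℝ f y) (g y)) V :=
      (B.flip.contDiff.comp_contDiffOn hg).clm_comp hf'
    have e3 := hnorm_add_le (r := r) (α := α) hV hS s1 s2
    have e4 : supNorm (fun y => B (f y) (g y)) S ≤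
        b * hnorm (r + 1) α S f * hnorm (r + 1) α S g := by
      have m1 := supNorm_le_hnorm (r := r + 1) (α := α) (S := S) f
      have m2 := supNorm_le_hnorm (r := r + 1) (α := α) (S := S) g
      exact (supNorm_bilin_le hB f g).trans (by gcongr)
    rw [hnorm_succ, h1, hcoe]
    calc _ ≤ b * hnorm (r + 1) α S f * hnorm (r + 1) α S g +
          (c * b * (c₀ * hnorm (r + 1) α S f) * hnorm (r + 1) α S g +
            c * b * hnorm (r + 1) α S f * (c₀ * hnorm (r + 1) α S g)) :=
          add_le_add e4 (e3.trans (add_le_add e1 e2))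
      _ = _ := by ring

theorem exists_supNorm_comp_graph_le {K : Set (E × Z)} (hK : IsCompact K) {H : E × Z → F}
    (hH : ContinuousOn H K) : ∃ c : ℝ≥0, ∀ f : E → Z, (∀ y ∈ S, (y, f y) ∈ K) →
      supNorm (fun y => H (y, f y)) S ≤ c := by
  obtain ⟨B, hB⟩ := hK.exists_bound_of_continuousOn hH
  refine ⟨B.toNNReal, fun f hf => supNorm_le_iff.2 fun y hy => ?_⟩
  rw [← ofReal_norm]
  exact ENNReal.ofReal_le_ofReal (hB _ (hf y hy))

/-- The composition estimate: `y ↦ G (y, f y)` is bounded in `C^{r,α}` if `f` is, as long as the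
graph of `f` stays in a fixed compact subset of the domain of the smooth function `G`. -/
theorem exists_hnorm_comp_graph_le [FiniteDimensional ℝ E] (hα : α ∈ Ioo (0 : ℝ) 1) {d : ℝ≥0}
    (hd : ∀ y ∈ S, ∀ z ∈ S, ‖y - z‖ₑ ≤ d) (hconv : Convex ℝ S) (hV : IsOpen V) (hS : S ⊆ V)
    (r : ℕ) [FiniteDimensional ℝ Z] {Ω : Set (E × Z)} (hΩ : IsOpen Ω) {H : E × Z → F}
    (hH : ContDiffOn ℝ ∞ H Ω) {K : Set (E × Z)} (hK : IsCompact K) (hKΩ : K ⊆ Ω) (R : ℝ≥0) :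
    ∃ c : ℝ≥0, ∀ f : E → Z, ContDiffOn ℝ ∞ f V → (∀ y ∈ S, (y, f y) ∈ K) →
      hnorm r α S f ≤ R → hnorm r α S (fun y => H (y, f y)) ≤ c := by
  obtain ⟨c₁, hc₁⟩ := exists_supNorm_comp_graph_le (S := S) hK (hH.continuousOn.mono hKΩ)
  induction r generalizing Z F R c₁ with
  | zero =>
    have hlip : LocallyLipschitzOn K H := by
      intro p hp
      have h1 : ContDiffAt ℝ 1 H p := (hH.contDiffAt (hΩ.mem_nhds (hKΩ hp))).of_le (by simp)
      obtain ⟨L, t, ht, hL⟩ := h1.exists_lipschitzOnWith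
      exact ⟨L, t, mem_nhdsWithin_of_mem_nhds ht, hL⟩
    obtain ⟨L, hL⟩ := hlip.exists_lipschitzOnWith_of_compact hK
    refine ⟨c₁ + L * (d ^ (1 - α) + R), fun f hf hfK hfR => ?_⟩
    rw [hnorm_zero] at hfR ⊢
    push_cast
    refine add_le_add (hc₁ f hfK) (holderSeminorm_le_iff.2 fun y hy z hz _ => ?_)
    have h1 := hL (hfK y hy) (hfK z hz)
    rw [edist_eq_enorm_sub] at h1
    refine h1.trans ?_
    rw [mul_assoc]
    gcongr
    rw [Prod.edist_eq, edist_eq_enorm_sub, edist_eq_enorm_sub, add_mul]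
    refine max_le ?_ ?_
    · refine (enorm_sub_le_rpow hα hd hy hz).trans ?_
      rw [ENNReal.coe_rpow_of_nonneg _ (by linarith [hα.2])]
      exact le_self_add
    · refine ((enorm_sub_le_holderSeminorm (α := α) hy hz).trans ?_).trans le_add_self
      gcongr
      exact le_add_self.trans hfR
  | succ r ih =>
    have : FiniteDimensional ℝ (E →L[ℝ] Z) := inferInstance
    have : FiniteDimensional ℝ (Z × (E →L[ℝ] Z)) := inferInstance
    let K' : Set (E × (Z × (E →L[ℝ] Z))) := (fun q : (E × Z) × (E →L[ℝ] Z) =>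
      (q.1.1, (q.1.2, q.2))) '' (K ×ˢ Metric.closedBall 0 R)
    have : ProperSpace (E →L[ℝ] Z) := FiniteDimensional.proper ℝ _
    have hK' : IsCompact K' := (hK.prod (isCompact_closedBall _ _)).image (by fun_prop)
    have hK'Ω : K' ⊆ prolongSet Ω := by
      rintro _ ⟨q, hq, rfl⟩
      exact hKΩ hq.1
    have hP := contDiffOn_prolong hΩ hH
    obtain ⟨c₂, hc₂⟩ := exists_supNorm_comp_graph_le (S := S) hK' (hP.continuousOn.mono hK'Ω)
    obtain ⟨c, hc⟩ := ih (Z := Z × (E →L[ℝ] Z)) (F := E →L[ℝ] F) (isOpen_prolongSet hΩ) hP hK' hK'Ω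
      ((1 + d ^ (1 - α)) * R + R) c₂ hc₂
    refine ⟨c₁ + c, fun f hf hfK hfR => ?_⟩
    have hf' : ContDiffOn ℝ ∞ (fderiv ℝ f) V := hf.fderiv_of_isOpen hV (by simp)
    have h1 : hnorm r α S (fderiv ℝ fun y => H (y, f y)) =
        hnorm r α S fun y => prolong H (y, (f y, fderiv ℝ f y)) :=
      hnorm_congr fun y hy => by
        have hcont : ContinuousAt (fun z => (z, f z)) y :=
          continuousAt_id.prodMk (hf.continuousOn.continuousAt (hV.mem_nhds (hS hy)))
        filter_upwards [hV.mem_nhds (hS hy), hcont (hΩ.mem_nhds (hKΩ (hfK y hy)))] with z hz hz'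
        exact fderiv_comp_graph hΩ hH ((hf.differentiableOn (by simp)).differentiableAt
          (hV.mem_nhds hz)) hz'
    rw [hnorm_succ, h1]
    push_cast
    refine add_le_add (hc₁ f hfK) (hc _ (hf.prodMk hf') (fun y hy => ?_) ?_)
    · refine ⟨((y, f y), fderiv ℝ f y), ⟨hfK y hy, ?_⟩, rfl⟩
      rw [mem_closedBall_zero_iff]
      have h2 : ‖fderiv ℝ f y‖ₑ ≤ R :=
        ((enorm_le_supNorm hy).trans (supNorm_le_hnorm _)).trans ((hnorm_fderiv_le f).trans hfR)
      rw [← ofReal_norm, ENNReal.ofReal_le_coe] at h2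
      exact h2
    · refine (hnorm_prodMk_le hV hS hf hf').trans ?_
      push_cast
      rw [ENNReal.coe_rpow_of_nonneg _ (by linarith [hα.2])]
      refine add_le_add ((hnorm_le_hnorm_succ hα hd hconv hV hS hf).trans ?_)
        ((hnorm_fderiv_le f).trans hfR)
      gcongr

end HolderNorm

/-! ### The cross product of the standard `G₂` form -/

section CrossProduct

local notation "V7" => EuclideanSpace ℝ (Fin 7)

/-- The cross product of `ℝ⁷`, defined by `⟨z, u × v⟩ = φ₀ (z, u, v)`. -/
def cross7 (u v : V7) : V7 :=
  let m : Fin 7 → Fin 7 → ℝ := fun i j => u i * v j - u j * v i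
  !₂[m 1 2 + m 3 4 + m 5 6, m 2 0 + m 3 5 - m 4 6, m 0 1 - m 3 6 - m 4 5,
    m 4 0 + m 5 1 - m 6 2, m 0 3 - m 6 1 - m 5 2, m 6 0 + m 1 3 - m 2 4, m 0 5 - m 1 4 - m 2 3]

theorem dxWedge_three (i j k : Fin 7) (v : Fin 3 → V7) :
    dxWedge ![i, j, k] v = v 0 i * v 1 j * v 2 k - v 0 i * v 1 k * v 2 j - v 0 j * v 1 i * v 2 k
      + v 0 j * v 1 k * v 2 i + v 0 k * v 1 i * v 2 j - v 0 k * v 1 j * v 2 i := by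
  simp [dxWedge, Matrix.det_fin_three]

theorem dxWedge_four (i j k l : Fin 7) (v : Fin 4 → V7) :
    dxWedge ![i, j, k, l] v =
      v 0 i * (v 1 j * (v 2 k * v 3 l - v 2 l * v 3 k) - v 1 k * (v 2 j * v 3 l - v 2 l * v 3 j)
        + v 1 l * (v 2 j * v 3 k - v 2 k * v 3 j))
      - v 0 j * (v 1 i * (v 2 k * v 3 l - v 2 l * v 3 k) - v 1 k * (v 2 i * v 3 l - v 2 l * v 3 i)
        + v 1 l * (v 2 i * v 3 k - v 2 k * v 3 i))
      + v 0 k * (v 1 i * (v 2 j * v 3 l - v 2 l * v 3 j) - v 1 j * (v 2 i * v 3 l - v 2 l * v 3 i)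
        + v 1 l * (v 2 i * v 3 j - v 2 j * v 3 i))
      - v 0 l * (v 1 i * (v 2 j * v 3 k - v 2 k * v 3 j) - v 1 j * (v 2 i * v 3 k - v 2 k * v 3 i)
        + v 1 k * (v 2 i * v 3 j - v 2 j * v 3 i)) := by
  simp only [dxWedge, Matrix.det_succ_row_zero, Fin.sum_univ_succ]
  simp [Fin.succAbove, Matrix.submatrix, Matrix.of_apply, Fin.lt_def]
  ring

theorem inner_cross7 (z u v : V7) : inner ℝ z (cross7 u v) = phi0 ![z, u, v] := by
  simp only [phi0, dxWedge_three, cross7, PiLp.inner_apply, Fin.sum_univ_succ]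
  simp
  ring

/-- The identity between the cross product and the `4`-form `ψ₀`. -/
theorem inner_cross7_cross7 (u v w z : V7) :
    inner ℝ (cross7 u v) (cross7 w z) =
      inner ℝ u w * inner ℝ v z - inner ℝ u z * inner ℝ v w + psi0 ![u, v, w, z] := by
  simp only [psi0, dxWedge_four, cross7, PiLp.inner_apply, Fin.sum_univ_succ]
  simp
  ring

theorem psi0_update_neg (f : Fin 4 → V7) : psi0 ![-f 0, f 1, f 2, f 3] = -psi0 f := by
  simp only [psi0, dxWedge_four]
  simp
  ring

theorem psi0_eq_zero_of_eq (u v w : V7) : psi0 ![u, v, u, w] = 0 ∧ psi0 ![u, v, v, w] = 0 ∧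
    psi0 ![u, v, w, v] = 0 := by
  simp only [psi0, dxWedge_four]
  refine ⟨?_, ?_, ?_⟩ <;> · simp; ring

theorem psi0_swap (a b c d : V7) : psi0 ![a, c, b, d] = -psi0 ![a, b, c, d] := by
  simp only [psi0, dxWedge_four]
  simp
  ring

theorem psi0_rotate (a b c d : V7) : psi0 ![a, d, b, c] = psi0 ![a, b, c, d] := by
  simp only [psi0, dxWedge_four]
  simp
  ring

theorem eq_zero_of_inner_orthonormal {g : Fin 7 → V7} (hg : Orthonormal ℝ g) {x : V7}
    (hx : ∀ i, inner ℝ (g i) x = 0) : x = 0 := by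
  have hb := coe_basisOfOrthonormalOfCardEqFinrank hg (by simp)
  refine InnerProductSpace.ext_inner_left_basis (𝕜 := ℝ)
    (basisOfOrthonormalOfCardEqFinrank hg (by simp)) fun i => ?_
  rw [hb, hx, inner_zero_right]

theorem inner_cross7_orthonormal {f : Fin 4 → V7} (hf : Orthonormal ℝ f)
    (i j k l : Fin 4) :
    inner ℝ (cross7 (f i) (f j)) (cross7 (f k) (f l)) =
      (if i = k then 1 else 0) * (if j = l then 1 else 0)
        - (if i = l then 1 else 0) * (if j = k then 1 else 0)
        + psi0 ![f i, f j, f k, f l] := by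
  have hff := orthonormal_iff_ite.1 hf
  rw [inner_cross7_cross7, hff, hff, hff, hff]

/-- An orthonormal basis of a coassociative subspace, extended by the cross products with its first
vector, is an orthonormal basis of `ℝ⁷`. -/
theorem orthonormal_coassociative_frame {f : Fin 4 → V7} (hf : Orthonormal ℝ f)
    (h0 : ∀ i j k, phi0 ![f i, f j, f k] = 0) : Orthonormal ℝ
    ![f 0, f 1, f 2, f 3, cross7 (f 0) (f 1), cross7 (f 0) (f 2), cross7 (f 0) (f 3)] := by
  have hff := orthonormal_iff_ite.1 hf
  have hfc : ∀ i j k, inner ℝ (f i) (cross7 (f j) (f k)) = 0 := fun i j k => by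
    rw [inner_cross7, h0]
  have hcf : ∀ i j k, inner ℝ (cross7 (f j) (f k)) (f i) = 0 := fun i j k => by
    rw [real_inner_comm, hfc]
  have hcc := inner_cross7_orthonormal hf
  have hp := fun u v w => psi0_eq_zero_of_eq u v w
  rw [orthonormal_iff_ite]
  intro i j
  fin_cases i <;> fin_cases j <;> simp [hff, hfc, hcf, hcc, hp, -inner_self_eq_norm_sq_to_K]

theorem cross7_eq_smul_of_inner {f : Fin 4 → V7} (hf : Orthonormal ℝ f)
    (h0 : ∀ i j k, phi0 ![f i, f j, f k] = 0)
    {a : V7} (ha : ∀ i, inner ℝ (f i) a = 0) :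
    a = (inner ℝ (cross7 (f 0) (f 1)) a : ℝ) • cross7 (f 0) (f 1)
      + (inner ℝ (cross7 (f 0) (f 2)) a : ℝ) • cross7 (f 0) (f 2)
      + (inner ℝ (cross7 (f 0) (f 3)) a : ℝ) • cross7 (f 0) (f 3) := by
  have hfc : ∀ i j k, inner ℝ (f i) (cross7 (f j) (f k)) = 0 := fun i j k => by
    rw [inner_cross7, h0]
  have hcc := inner_cross7_orthonormal hf
  have hp := fun u v w => psi0_eq_zero_of_eq u v w
  rw [← sub_eq_zero]
  refine eq_zero_of_inner_orthonormal (orthonormal_coassociative_frame hf h0) fun i => ?_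
  fin_cases i <;> simp [inner_sub_right, inner_add_right, inner_smul_right, hfc, hcc, hp, ha,
    -inner_self_eq_norm_sq_to_K]

/-- The three relations say that, for each normal vector, the components of its contraction with
the `3`-form along an orthonormal frame of a coassociative `4`-plane are those of a self-dual or
anti-self-dual form; the sign is that of the orientation. -/
theorem cross7_coassociative {f : Fin 4 → V7} (hf : Orthonormal ℝ f)
    (h0 : ∀ i j k, phi0 ![f i, f j, f k] = 0) :
    cross7 (f 2) (f 3) = psi0 f • cross7 (f 0) (f 1) ∧
    cross7 (f 1) (f 3) = -psi0 f • cross7 (f 0) (f 2) ∧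
    cross7 (f 1) (f 2) = psi0 f • cross7 (f 0) (f 3) := by
  have hfc : ∀ j k i, inner ℝ (f i) (cross7 (f j) (f k)) = 0 := fun j k i => by
    rw [inner_cross7, h0]
  have hcc := inner_cross7_orthonormal hf
  have hp := fun u v w => psi0_eq_zero_of_eq u v w
  have hf4 : ![f 0, f 1, f 2, f 3] = f := by ext i; fin_cases i <;> rfl
  have hs : psi0 ![f 0, f 2, f 1, f 3] = -psi0 f := by rw [psi0_swap, hf4]
  have hr : psi0 ![f 0, f 3, f 1, f 2] = psi0 f := by rw [psi0_rotate, hf4]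
  refine ⟨?_, ?_, ?_⟩
  · conv_lhs => rw [cross7_eq_smul_of_inner hf h0 (hfc 2 3)]
    simp [hcc, hp, hf4]
  · conv_lhs => rw [cross7_eq_smul_of_inner hf h0 (hfc 1 3)]
    simp [hcc, hp, hs]
  · conv_lhs => rw [cross7_eq_smul_of_inner hf h0 (hfc 1 2)]
    simp [hcc, hp, hr]

/-- On a coassociative subspace, `ψ₀` is a volume form. -/
theorem psi0_sq_eq_one {f : Fin 4 → V7} (hf : Orthonormal ℝ f)
    (h0 : ∀ i j k, phi0 ![f i, f j, f k] = 0) : psi0 f ^ 2 = 1 := by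
  have hcc := inner_cross7_orthonormal hf
  have hp := fun u v w => psi0_eq_zero_of_eq u v w
  have h1 := hcc 2 3 2 3
  rw [(cross7_coassociative hf h0).1, inner_smul_left, inner_smul_right, hcc] at h1
  simp [hp] at h1
  rw [sq, h1]

/-- A coassociative subspace has an orthonormal basis on which `ψ₀` is positive. -/
theorem exists_oriented_orthonormal {V : Type*} [AddCommGroup V] [Module ℝ V]
    [FiniteDimensional ℝ V] (hV : Module.finrank ℝ V = 4) (A : V →ₗ[ℝ] V7)
    (hA : Function.Injective A) (h0 : ∀ a b c, phi0 ![A a, A b, A c] = 0) :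
    ∃ e : Fin 4 → V, Orthonormal ℝ (fun i => A (e i)) ∧ 0 < psi0 (fun i => A (e i)) := by
  have hfin : Module.finrank ℝ (LinearMap.range A) = 4 := by
    rw [LinearMap.finrank_range_of_inj hA, hV]
  let b := (stdOrthonormalBasis ℝ (LinearMap.range A)).reindex (finCongr hfin)
  choose e he using fun i => (b i).2
  have hon : Orthonormal ℝ (fun i => A (e i)) := by
    have := b.orthonormal.comp_linearIsometry (LinearMap.range A).subtypeₗᵢ
    convert! this using 2
    exact he _
  have hsq := psi0_sq_eq_one hon fun i j k => h0 _ _ _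
  rcases lt_trichotomy (psi0 fun i => A (e i)) 0 with h | h | h
  · refine ⟨![-e 0, e 1, e 2, e 3], ?_, ?_⟩
    · rw [orthonormal_iff_ite] at hon ⊢
      intro i j
      have := hon i j
      fin_cases i <;> fin_cases j <;> simpa using this
    · have h1 := psi0_update_neg fun i => A (e i)
      have h2 : (fun i => A ((![-e 0, e 1, e 2, e 3] : Fin 4 → V) i)) =
          ![-A (e 0), A (e 1), A (e 2), A (e 3)] := by
        ext i : 1; fin_cases i <;> simp
      rw [h2, h1]
      linarith
  · rw [h] at hsq; norm_num at hsq
  · exact ⟨e, hon, h⟩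

end CrossProduct

/-! ### Self-dual forms as contractions of the `G₂` form -/

section Contraction

local notation "E4" => EuclideanSpace ℝ (Fin 4)
local notation "V7" => EuclideanSpace ℝ (Fin 7)

/-- The value of a field of forms at a point, as a form on the model space. -/
def RawForm.at {n k : ℕ} {M : Type*} [TopologicalSpace M]
    [ChartedSpace (EuclideanSpace ℝ (Fin n)) M] (σ : RawForm n k M) (x : M) :
    EuclideanSpace ℝ (Fin n) [⋀^Fin k]→L[ℝ] ℝ := σ x

/-- The differential of a map of manifolds, as a map of the model spaces. -/
def diffAt {n m : ℕ} {M N : Type*} [TopologicalSpace M]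
    [ChartedSpace (EuclideanSpace ℝ (Fin n)) M] [TopologicalSpace N]
    [ChartedSpace (EuclideanSpace ℝ (Fin m)) N] (f : M → N) (x : M) :
    EuclideanSpace ℝ (Fin n) →L[ℝ] EuclideanSpace ℝ (Fin m) :=
  mfderiv (𝓡 n) (𝓡 m) f x

variable {M Y : Type*}
  [TopologicalSpace M] [ChartedSpace (EuclideanSpace ℝ (Fin 4)) M]
  [TopologicalSpace Y] [ChartedSpace (EuclideanSpace ℝ (Fin 7)) Y]

/-- The fibre of `Λ²₊ T^*M`, as a subspace of the `2`-forms on the model space. -/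
def selfDual (φ : RawForm 7 3 Y) (ι : M → Y) (x : M) : Submodule ℝ (E4 [⋀^Fin 2]→L[ℝ] ℝ) :=
  selfDualAt φ ι x

/-- The `2`-form `ι^* (i_w φ)` at `x`, for a tangent vector `w` of `Y` at `ι x`. -/
def contractAt (φ : RawForm 7 3 Y) (ι : M → Y) (x : M) (w : V7) : E4 [⋀^Fin 2]→L[ℝ] ℝ :=
  ((φ.at (ι x)).curryLeft w).compContinuousLinearMap (diffAt ι x)

theorem contractAt_apply (φ : RawForm 7 3 Y) (ι : M → Y) (x : M) (w : V7) (a b : E4) :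
    contractAt φ ι x w ![a, b] = φ.at (ι x) ![w, diffAt ι x a, diffAt ι x b] := by
  change (φ.at (ι x)) (Matrix.vecCons w _) = _
  congr 1
  ext i : 1
  fin_cases i <;> rfl

theorem contractAt_apply_eq_inner {φ : RawForm 7 3 Y} {ι : M → Y} {x : M} {L : V7 ≃ₗ[ℝ] V7}
    (hL : IsG2Frame φ (ι x) L) (w : V7) (a b : E4) :
    contractAt φ ι x w ![a, b] =
      inner ℝ (L w) (cross7 (L (diffAt ι x a)) (L (diffAt ι x b))) := by
  rw [contractAt_apply, inner_cross7]
  refine (hL _).trans ?_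
  congr 1
  ext i : 1
  fin_cases i <;> rfl

theorem phi0_eq_zero_of_pullback {φ : RawForm 7 3 Y} {ι : M → Y} {x : M}
    (h : pullback (n := 4) ι φ x = 0) {L : V7 ≃ₗ[ℝ] V7} (hL : IsG2Frame φ (ι x) L) (a b c : E4) :
    phi0 ![L (diffAt ι x a), L (diffAt ι x b), L (diffAt ι x c)] = 0 := by
  have h1 : (pullback (n := 4) ι φ).at x ![a, b, c] = 0 := by
    have h2 : (pullback (n := 4) ι φ).at x = 0 := h
    rw [h2]; rfl
  refine Eq.trans ?_ h1
  refine Eq.trans ?_ (hL _).symm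
  congr 1
  ext i : 1
  fin_cases i <;> rfl

theorem mem_selfDual_iff {φ : RawForm 7 3 Y} {ι : M → Y} {x : M} {β : E4 [⋀^Fin 2]→L[ℝ] ℝ} :
    β ∈ selfDual φ ι x ↔ ∀ (e : Fin 4 → E4) (L : V7 ≃ₗ[ℝ] V7), IsG2Frame φ (ι x) L →
      Orthonormal ℝ (fun i => L (diffAt ι x (e i))) →
      0 < psi0 (fun i => L (diffAt ι x (e i))) →
      β ![e 0, e 1] = β ![e 2, e 3] ∧ β ![e 0, e 2] = -β ![e 1, e 3] ∧
        β ![e 0, e 3] = β ![e 1, e 2] :=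
  ⟨fun h e L h1 h2 h3 => h e ⟨L, h1, h2, h3⟩, fun h e ⟨L, h1, h2, h3⟩ => h e L h1 h2 h3⟩

/-- The forms `ι^* (i_w φ)` are self-dual. -/
theorem contractAt_mem {φ : RawForm 7 3 Y} {ι : M → Y} {x : M}
    (h : pullback (n := 4) ι φ x = 0) (w : V7) : contractAt φ ι x w ∈ selfDual φ ι x := by
  refine mem_selfDual_iff.2 fun e L hL hon hpos => ?_
  have h0 := fun i j k => phi0_eq_zero_of_pullback h hL (e i) (e j) (e k)
  have h1 : psi0 (fun i => L (diffAt ι x (e i))) = 1 := by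
    have := psi0_sq_eq_one hon h0
    nlinarith
  obtain ⟨h23, h13, h12⟩ := cross7_coassociative hon h0
  rw [h1] at h23 h13 h12
  refine ⟨?_, ?_, ?_⟩
  · rw [contractAt_apply_eq_inner hL, contractAt_apply_eq_inner hL, h23, one_smul]
  · rw [contractAt_apply_eq_inner hL, contractAt_apply_eq_inner hL, h13, neg_smul, one_smul,
      inner_neg_right, neg_neg]
  · rw [contractAt_apply_eq_inner hL, contractAt_apply_eq_inner hL, h12, one_smul]

theorem exists_isOrientedOrthonormal {φ : RawForm 7 3 Y} {ι : M → Y} {x : M}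
    (hι : Function.Injective (diffAt (n := 4) (m := 7) ι x)) (h : pullback (n := 4) ι φ x = 0)
    {L : V7 ≃ₗ[ℝ] V7} (hL : IsG2Frame φ (ι x) L) :
    ∃ e : Fin 4 → E4, Orthonormal ℝ (fun i => L (diffAt ι x (e i))) ∧
      0 < psi0 (fun i => L (diffAt ι x (e i))) :=
  exists_oriented_orthonormal (V := E4) (by simp)
    (L.toLinearMap ∘ₗ (diffAt ι x).toLinearMap) (L.injective.comp hι)
    (phi0_eq_zero_of_pullback h hL)

/-- Evaluation of a `2`-form on the pairs `(e₀, e₁)`, `(e₀, e₂)`, `(e₀, e₃)`. -/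
def evalFirst (e : Fin 4 → E4) : (E4 [⋀^Fin 2]→L[ℝ] ℝ) →ₗ[ℝ] (Fin 3 → ℝ) where
  toFun β i := β ![e 0, e i.succ]
  map_add' _ _ := rfl
  map_smul' _ _ := rfl

theorem eq_zero_of_evalFirst {φ : RawForm 7 3 Y} {ι : M → Y} {x : M}
    {e : Fin 4 → E4} {L : V7 ≃ₗ[ℝ] V7} (hL : IsG2Frame φ (ι x) L)
    (hon : Orthonormal ℝ (fun i => L (diffAt ι x (e i))))
    (hpos : 0 < psi0 (fun i => L (diffAt ι x (e i))))
    {β : E4 [⋀^Fin 2]→L[ℝ] ℝ} (hβ : β ∈ selfDual φ ι x)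
    (h : evalFirst e β = 0) : β = 0 := by
  have hli : LinearIndependent ℝ e :=
    LinearIndependent.of_comp (L.toLinearMap ∘ₗ (diffAt ι x).toLinearMap) hon.linearIndependent
  let b := basisOfLinearIndependentOfCardEqFinrank hli (by simp)
  have hb : ⇑b = e := coe_basisOfLinearIndependentOfCardEqFinrank hli (by simp)
  obtain ⟨h1, h2, h3⟩ := mem_selfDual_iff.1 hβ e L hL hon hpos
  have k1 : β ![e 0, e 1] = 0 := congrFun h 0
  have k2 : β ![e 0, e 2] = 0 := congrFun h 1
  have k3 : β ![e 0, e 3] = 0 := congrFun h 2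
  have k4 : β ![e 2, e 3] = 0 := h1.symm.trans k1
  have k5 : β ![e 1, e 3] = 0 := neg_eq_zero.1 (h2.symm.trans k2)
  have k6 : β ![e 1, e 2] = 0 := h3.symm.trans k3
  have hsw : ∀ u v, β ![u, v] = 0 → β ![v, u] = 0 := fun u v huv => by
    have h4 : β (![u, v] ∘ ⇑(Equiv.swap 0 1)) = -β ![u, v] :=
      β.toAlternatingMap.map_swap ![u, v] (i := 0) (j := 1) (by simp)
    rw [huv, neg_zero] at h4
    rw [← h4]
    congr 1
    ext i : 1
    fin_cases i <;> rfl
  refine ContinuousAlternatingMap.toAlternatingMap_injective ?_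
  refine b.ext_alternating fun v hv => ?_
  rw [hb]
  have hv2 : (fun i => e (v i)) = ![e (v 0), e (v 1)] := by
    ext i : 1; fin_cases i <;> rfl
  have hne : v 0 ≠ v 1 := fun hh => by simpa using hv hh
  change β (fun i => e (v i)) = 0
  rw [hv2]
  generalize v 0 = i at hne
  generalize v 1 = j at hne
  fin_cases i <;> fin_cases j <;> first
    | exact absurd rfl hne
    | exact k1 | exact k2 | exact k3 | exact k4 | exact k5 | exact k6
    | exact hsw _ _ k1 | exact hsw _ _ k2 | exact hsw _ _ k3
    | exact hsw _ _ k4 | exact hsw _ _ k5 | exact hsw _ _ k6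

/-- The forms `ι^* (i_w φ)` fill the space of self-dual forms, which is `3`-dimensional. -/
theorem exists_contractAt_linearIndependent {φ : RawForm 7 3 Y} {ι : M → Y} {x : M}
    (hι : Function.Injective (diffAt (n := 4) (m := 7) ι x)) (h : pullback (n := 4) ι φ x = 0)
    {L : V7 ≃ₗ[ℝ] V7} (hL : IsG2Frame φ (ι x) L) :
    (∃ w : Fin 3 → V7, LinearIndependent ℝ (fun i => contractAt φ ι x (w i))) ∧
    Module.finrank ℝ (selfDual φ ι x) = 3 := by
  obtain ⟨e, hon, hpos⟩ := exists_isOrientedOrthonormal hι h hL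
  let w : Fin 3 → V7 := fun i =>
    L.symm (cross7 (L (diffAt ι x (e 0))) (L (diffAt ι x (e i.succ))))
  have hT : ∀ i, evalFirst e (contractAt φ ι x (w i)) = Pi.single i 1 := by
    intro i
    funext j
    change contractAt φ ι x (w i) ![e 0, e j.succ] = _
    rw [contractAt_apply_eq_inner hL, L.apply_symm_apply, inner_cross7_orthonormal hon,
      (psi0_eq_zero_of_eq _ _ _).1]
    rcases eq_or_ne i j with rfl | hij
    · simp
    · simp [hij, Fin.succ_ne_zero, Ne.symm hij]
  have hli : LinearIndependent ℝ (fun i => contractAt φ ι x (w i)) := by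
    refine LinearIndependent.of_comp (evalFirst e) ?_
    have : (⇑(evalFirst e) ∘ fun i => contractAt φ ι x (w i)) =
        fun i => Pi.basisFun ℝ (Fin 3) i := by
      funext i
      simp only [Function.comp, hT, Pi.basisFun_apply]
    rw [this]
    exact (Pi.basisFun ℝ (Fin 3)).linearIndependent
  have hinj : Function.Injective ((evalFirst e) ∘ₗ (selfDual φ ι x).subtype) := by
    refine (injective_iff_map_eq_zero _).2 ?_
    rintro ⟨β, hβ⟩ hz
    exact Subtype.ext (eq_zero_of_evalFirst hL hon hpos hβ hz)
  refine ⟨⟨w, hli⟩, le_antisymm ?_ ?_⟩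
  · simpa using LinearMap.finrank_le_finrank_of_injective hinj
  · have hli' : LinearIndependent ℝ
        (fun i => (⟨contractAt φ ι x (w i), contractAt_mem h _⟩ : selfDual φ ι x)) :=
      LinearIndependent.of_comp (selfDual φ ι x).subtype hli
    have hfd : Module.Finite ℝ (selfDual φ ι x) := Module.Finite.of_injective _ hinj
    simpa using hli'.fintype_card_le_finrank

end Contraction

/-! ### Alternating forms on finite-dimensional spaces -/

section Alternating

variable {X E F : Type*} [NormedAddCommGroup X] [NormedSpace ℝ X]
  [NormedAddCommGroup E] [NormedSpace ℝ E] [FiniteDimensional ℝ E]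
  [NormedAddCommGroup F] [NormedSpace ℝ F] {k : ℕ}

instance finiteDimensional_alternating :
    FiniteDimensional ℝ (E [⋀^Fin k]→L[ℝ] ℝ) := by
  let T : (E [⋀^Fin k]→L[ℝ] ℝ) →ₗ[ℝ] MultilinearMap ℝ (fun _ : Fin k => E) ℝ :=
    { toFun := fun β => β.toMultilinearMap
      map_add' := fun _ _ => rfl
      map_smul' := fun _ _ => rfl }
  refine Module.Finite.of_injective T fun β γ h => ?_
  ext v
  exact congrArg (fun μ : MultilinearMap ℝ (fun _ : Fin k => E) ℝ => μ v) h

/-- Evaluation at a fixed tuple of vectors. -/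
def evalAlt (v : Fin k → E) : (E [⋀^Fin k]→L[ℝ] ℝ) →L[ℝ] ℝ :=
  LinearMap.toContinuousLinearMap
    { toFun := fun β => β v
      map_add' := fun _ _ => rfl
      map_smul' := fun _ _ => rfl }

/-- Smoothness of a map into a space of alternating forms can be tested on values. -/
theorem contDiffOn_alternating {f : X → E [⋀^Fin k]→L[ℝ] ℝ} {s : Set X}
    (h : ∀ v, ContDiffOn ℝ ∞ (fun x => f x v) s) : ContDiffOn ℝ ∞ f s := by
  let b := Module.finBasis ℝ E
  let ev : (E [⋀^Fin k]→L[ℝ] ℝ) →L[ℝ] ((Fin k → Fin (Module.finrank ℝ E)) → ℝ) :=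
    ContinuousLinearMap.pi fun i => evalAlt fun j => b (i j)
  have hinj : Function.Injective ev := by
    refine (injective_iff_map_eq_zero ev).2 fun β hβ => ?_
    refine ContinuousAlternatingMap.toAlternatingMap_injective ?_
    exact b.ext_alternating fun i _ => congrFun hβ i
  obtain ⟨g, hg⟩ := ev.toLinearMap.exists_leftInverse_of_injective (LinearMap.ker_eq_bot.2 hinj)
  have h1 : ContDiffOn ℝ ∞ (fun x => ev (f x)) s :=
    contDiffOn_pi.2 fun i => h _
  have h2 := (LinearMap.toContinuousLinearMap g).contDiff.comp_contDiffOn h1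
  refine h2.congr fun x _ => ?_
  exact (LinearMap.congr_fun hg (f x)).symm

theorem contDiffOn_alternating_apply {n : WithTop ℕ∞} {f : X → F [⋀^Fin k]→L[ℝ] ℝ}
    {v : X → Fin k → F}
    {s : Set X} (hf : ContDiffOn ℝ n f s) (hv : ∀ i, ContDiffOn ℝ n (fun x => v x i) s) :
    ContDiffOn ℝ n (fun x => f x (v x)) s := by
  let J := (ContinuousAlternatingMap.toContinuousMultilinearMapLI (𝕜 := ℝ) (E := F) (F := ℝ)
    (ι := Fin k)).toContinuousLinearMap
  let C := ContinuousMultilinearMap.compContinuousLinearMapContinuousMultilinear ℝ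
    (fun _ : Fin k => ℝ) (fun _ : Fin k => F) ℝ
  have hC : ContDiff ℝ n C := ContinuousMultilinearMap.contDiff (𝕜 := ℝ)
    (E := fun _ : Fin k => ℝ →L[ℝ] F) (F := (F [×k]→L[ℝ] ℝ) →L[ℝ] ℝ [×k]→L[ℝ] ℝ) C
  let S := ContinuousLinearMap.toSpanSingletonCLE (𝕜 := ℝ) (E := F)
  have h1 : ContDiffOn ℝ n (fun x => J (f x)) s := J.contDiff.comp_contDiffOn hf
  have h2 : ContDiffOn ℝ n (fun x => C fun i => S (v x i)) s :=
    hC.comp_contDiffOn (contDiffOn_pi.2 fun i => S.contDiff.comp_contDiffOn (hv i))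
  have h3 := (h2.clm_apply h1)
  have h4 := (ContinuousMultilinearMap.apply ℝ (fun _ : Fin k => ℝ) ℝ
    (fun _ => (1 : ℝ))).contDiff.comp_contDiffOn h3
  refine h4.congr fun x _ => ?_
  simp [J, C, S]

/-- The pull-back of forms depends smoothly on the form and on the linear map. -/
theorem contDiffOn_alternating_comp {f : X → F [⋀^Fin k]→L[ℝ] ℝ} {A : X → E →L[ℝ] F}
    {s : Set X} (hf : ContDiffOn ℝ ∞ f s) (hA : ContDiffOn ℝ ∞ A s) :
    ContDiffOn ℝ ∞ (fun x => (f x).compContinuousLinearMap (A x)) s :=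
  contDiffOn_alternating fun w => contDiffOn_alternating_apply (v := fun x i => A x (w i)) hf
    fun _ => hA.clm_apply contDiffOn_const

theorem compContinuousLinearMap_comp {X' : Type*} [NormedAddCommGroup X'] [NormedSpace ℝ X']
    (β : F [⋀^Fin k]→L[ℝ] ℝ) (A : X →L[ℝ] F) (B : X' →L[ℝ] X) :
    (β.compContinuousLinearMap A).compContinuousLinearMap B =
      β.compContinuousLinearMap (A.comp B) := rfl

theorem compContinuousLinearMap_id' (β : F [⋀^Fin k]→L[ℝ] ℝ) :
    β.compContinuousLinearMap (ContinuousLinearMap.id ℝ F) = β := rfl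

end Alternating

/-! ### Pull-back of forms to open subsets of vector spaces -/

section Pull

variable {n m k : ℕ} {M N : Type*}
  [TopologicalSpace M] [ChartedSpace (EuclideanSpace ℝ (Fin n)) M]
  [TopologicalSpace N] [ChartedSpace (EuclideanSpace ℝ (Fin m)) N]
  {X X' : Type*} [NormedAddCommGroup X] [NormedSpace ℝ X]
  [NormedAddCommGroup X'] [NormedSpace ℝ X']

/-- The differential of a map from a normed space to a manifold. -/
def diffFrom (f : X → N) (x : X) : X →L[ℝ] EuclideanSpace ℝ (Fin m) :=
  mfderiv 𝓘(ℝ, X) (𝓡 m) f x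

/-- The pull-back of a form under a map from a normed space to a manifold. -/
def pull (f : X → N) (η : RawForm m k N) (x : X) : X [⋀^Fin k]→L[ℝ] ℝ :=
  (η.at (f x)).compContinuousLinearMap (diffFrom f x)

/-- The differential of the chart around `p`. -/
def chartDiff (p x : M) : EuclideanSpace ℝ (Fin n) →L[ℝ] EuclideanSpace ℝ (Fin n) :=
  mfderiv (𝓡 n) 𝓘(ℝ, EuclideanSpace ℝ (Fin n)) (extChartAt (𝓡 n) p) x

/-- The differential of the inverse of the chart around `p`. -/
def chartSymmDiff (p : M) (y : EuclideanSpace ℝ (Fin n)) :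
    EuclideanSpace ℝ (Fin n) →L[ℝ] EuclideanSpace ℝ (Fin n) :=
  diffFrom (m := n) (extChartAt (𝓡 n) p).symm y

theorem inChart_apply_eq (p : M) (σ : RawForm n k M) (y : EuclideanSpace ℝ (Fin n)) :
    inChart p σ y = (σ.at ((extChartAt (𝓡 n) p).symm y)).compContinuousLinearMap
      (chartSymmDiff p y) := rfl

variable [IsManifold (𝓡 n) ∞ M] [IsManifold (𝓡 m) ∞ N]

theorem mdifferentiableAt_chart {p x : M} (hx : x ∈ (extChartAt (𝓡 n) p).source) :
    MDifferentiableAt (𝓡 n) 𝓘(ℝ, EuclideanSpace ℝ (Fin n)) (extChartAt (𝓡 n) p) x :=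
  haveI : IsManifold (𝓡 n) 1 M := IsManifold.of_le (n := ∞) (by simp)
  mdifferentiableAt_extChartAt (by rwa [extChartAt_source] at hx)

theorem contMDiffOn_chart_symm (p : M) :
    ContMDiffOn 𝓘(ℝ, EuclideanSpace ℝ (Fin n)) (𝓡 n) ∞ (extChartAt (𝓡 n) p).symm
      (extChartAt (𝓡 n) p).target := contMDiffOn_extChartAt_symm p

theorem contMDiffAt_chart_symm {p : M} {y : EuclideanSpace ℝ (Fin n)}
    (hy : y ∈ (extChartAt (𝓡 n) p).target) :
    ContMDiffAt 𝓘(ℝ, EuclideanSpace ℝ (Fin n)) (𝓡 n) ∞ (extChartAt (𝓡 n) p).symm y :=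
  (contMDiffOn_chart_symm p).contMDiffAt ((isOpen_extChartAt_target p).mem_nhds hy)

theorem mdifferentiableAt_chart_symm {p : M} {y : EuclideanSpace ℝ (Fin n)}
    (hy : y ∈ (extChartAt (𝓡 n) p).target) :
    MDifferentiableAt 𝓘(ℝ, EuclideanSpace ℝ (Fin n)) (𝓡 n) (extChartAt (𝓡 n) p).symm y :=
  (contMDiffAt_chart_symm hy).mdifferentiableAt (by simp)

theorem chartDiff_comp_diffFrom {q : N} {f : X → N} {x : X}
    (hf : MDifferentiableAt 𝓘(ℝ, X) (𝓡 m) f x) (hx : f x ∈ (extChartAt (𝓡 m) q).source) :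
    (chartDiff q (f x)).comp (diffFrom f x) = fderiv ℝ (extChartAt (𝓡 m) q ∘ f) x := by
  have h := mfderiv_comp x (mdifferentiableAt_chart hx) hf
  rw [mfderiv_eq_fderiv] at h
  exact h.symm

theorem chartSymmDiff_comp_chartDiff {p x : M} (hx : x ∈ (extChartAt (𝓡 n) p).source) :
    (chartSymmDiff p (extChartAt (𝓡 n) p x)).comp (chartDiff p x) =
      ContinuousLinearMap.id ℝ (EuclideanSpace ℝ (Fin n)) := by
  have h := mfderiv_comp x (mdifferentiableAt_chart_symm ((extChartAt (𝓡 n) p).map_source hx))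
    (mdifferentiableAt_chart hx)
  have h2 : mfderiv (𝓡 n) (𝓡 n) ((extChartAt (𝓡 n) p).symm ∘ extChartAt (𝓡 n) p) x =
      mfderiv (𝓡 n) (𝓡 n) (id : M → M) x := by
    refine Filter.EventuallyEq.mfderiv_eq ?_
    filter_upwards [(isOpen_extChartAt_source p).mem_nhds hx] with z hz
    exact (extChartAt (𝓡 n) p).left_inv hz
  rw [h2, mfderiv_id] at h
  exact h.symm

theorem chartDiff_comp_chartSymmDiff {p : M} {y : EuclideanSpace ℝ (Fin n)}
    (hy : y ∈ (extChartAt (𝓡 n) p).target) :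
    (chartDiff p ((extChartAt (𝓡 n) p).symm y)).comp (chartSymmDiff p y) =
      ContinuousLinearMap.id ℝ (EuclideanSpace ℝ (Fin n)) := by
  have h := chartDiff_comp_diffFrom (q := p) (mdifferentiableAt_chart_symm hy)
    ((extChartAt (𝓡 n) p).map_target hy)
  refine h.trans ?_
  have : (extChartAt (𝓡 n) p ∘ (extChartAt (𝓡 n) p).symm) =ᶠ[𝓝 y] id := by
    filter_upwards [(isOpen_extChartAt_target p).mem_nhds hy] with z hz
    exact (extChartAt (𝓡 n) p).right_inv hz
  rw [this.fderiv_eq, fderiv_id]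

/-- A form is recovered from its representative in a chart. -/
theorem at_eq_inChart (σ : RawForm n k M) {p x : M} (hx : x ∈ (extChartAt (𝓡 n) p).source) :
    σ.at x = (inChart p σ (extChartAt (𝓡 n) p x)).compContinuousLinearMap (chartDiff p x) := by
  rw [inChart_apply_eq, compContinuousLinearMap_comp, (extChartAt (𝓡 n) p).left_inv hx,
    chartSymmDiff_comp_chartDiff hx, compContinuousLinearMap_id']

/-- The pull-back of a form, expressed in a chart of the target. -/
theorem pull_eq_inChart (η : RawForm m k N) {q : N} {f : X → N} {x : X}
    (hf : MDifferentiableAt 𝓘(ℝ, X) (𝓡 m) f x) (hx : f x ∈ (extChartAt (𝓡 m) q).source) :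
    pull f η x = (inChart q η (extChartAt (𝓡 m) q (f x))).compContinuousLinearMap
      (fderiv ℝ (extChartAt (𝓡 m) q ∘ f) x) := by
  rw [pull, at_eq_inChart η hx, compContinuousLinearMap_comp, chartDiff_comp_diffFrom hf hx]

theorem IsSmoothOn.contDiffOn {σ : RawForm n k M} (h : IsSmoothOn σ univ) (p : M) :
    ContDiffOn ℝ ∞ (inChart p σ) (extChartAt (𝓡 n) p).target := by
  have := h p
  rwa [preimage_univ, inter_univ] at this

theorem contDiffOn_pull {η : RawForm m k N} (hη : IsSmoothOn η univ) {f : X → N} {O : Set X}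
    (hO : IsOpen O) [FiniteDimensional ℝ X] (hf : ContMDiffOn 𝓘(ℝ, X) (𝓡 m) ∞ f O) :
    ContDiffOn ℝ ∞ (pull f η) O := by
  intro x hx
  have hfx : ContMDiffAt 𝓘(ℝ, X) (𝓡 m) ∞ f x := hf.contMDiffAt (hO.mem_nhds hx)
  let q := f x
  let O' := O ∩ f ⁻¹' (extChartAt (𝓡 m) q).source
  have hO' : IsOpen O' := hf.continuousOn.isOpen_inter_preimage hO (isOpen_extChartAt_source q)
  have hxO' : x ∈ O' := ⟨hx, mem_extChartAt_source q⟩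
  have hg : ContDiffOn ℝ ∞ (extChartAt (𝓡 m) q ∘ f) O' := by
    rw [← contMDiffOn_iff_contDiffOn]
    refine (contMDiffOn_extChartAt (x := q)).comp (hf.mono inter_subset_left) fun z hz => ?_
    simpa [extChartAt_source] using hz.2
  have h1 : ContDiffOn ℝ ∞ (fun z => inChart q η (extChartAt (𝓡 m) q (f z))) O' :=
    (hη.contDiffOn q).comp hg fun z hz => (extChartAt (𝓡 m) q).map_source hz.2
  have h2 : ContDiffOn ℝ ∞ (fderiv ℝ (extChartAt (𝓡 m) q ∘ f)) O' :=
    hg.fderiv_of_isOpen hO' (by simp)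
  have h3 : ContDiffOn ℝ ∞ (pull f η) O' := by
    refine (contDiffOn_alternating_comp h1 h2).congr fun z hz => ?_
    exact pull_eq_inChart η ((hf.contMDiffAt (hO.mem_nhds hz.1)).mdifferentiableAt (by simp)) hz.2
  exact (h3.contDiffAt (hO'.mem_nhds hxO')).contDiffWithinAt

/-- The exterior derivative of a form in an arbitrary chart. -/
theorem pull_extD {η : RawForm m k N} (hη : IsSmoothOn η univ) {f : X → N} {O : Set X}
    (hO : IsOpen O) (hf : ContMDiffOn 𝓘(ℝ, X) (𝓡 m) ∞ f O) {x : X} (hx : x ∈ O) :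
    pull f (extD η) x = extDeriv (pull f η) x := by
  have hfx : ContMDiffAt 𝓘(ℝ, X) (𝓡 m) ∞ f x := hf.contMDiffAt (hO.mem_nhds hx)
  have hev : pull f η =ᶠ[𝓝 x] fun z =>
      (inChart (f x) η ((extChartAt (𝓡 m) (f x) ∘ f) z)).compContinuousLinearMap
        (fderiv ℝ (extChartAt (𝓡 m) (f x) ∘ f) z) := by
    filter_upwards [hO.mem_nhds hx, hfx.continuousAt.preimage_mem_nhds
      ((isOpen_extChartAt_source (I := 𝓡 m) (f x)).mem_nhds (mem_extChartAt_source _))] with z hz hz'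
    exact pull_eq_inChart η ((hf.contMDiffAt (hO.mem_nhds hz)).mdifferentiableAt (by simp)) hz'
  have hg : ContDiffAt ℝ ∞ (extChartAt (𝓡 m) (f x) ∘ f) x := by
    rw [← contMDiffAt_iff_contDiffAt]
    exact (contMDiffAt_extChartAt (x := f x)).comp x hfx
  have hη' : DifferentiableAt ℝ (inChart (f x) η) ((extChartAt (𝓡 m) (f x) ∘ f) x) :=
    ((hη.contDiffOn (f x)).differentiableOn (by simp)).differentiableAt
      (extChartAt_target_mem_nhds (I := 𝓡 m) (f x))
  rw [hev.extDeriv_eq, extDeriv_pullback hη' hg (by simpa using ENat.LEInfty.out)]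
  change ((extDeriv _ _).compContinuousLinearMap (chartDiff (f x) (f x))).compContinuousLinearMap
    (diffFrom f x) = _
  rw [compContinuousLinearMap_comp, chartDiff_comp_diffFrom (hfx.mdifferentiableAt (by simp))
    (mem_extChartAt_source _)]
  rfl

theorem inChart_extD {σ : RawForm n k M} (hσ : IsSmoothOn σ univ) (p : M)
    {y : EuclideanSpace ℝ (Fin n)} (hy : y ∈ (extChartAt (𝓡 n) p).target) :
    inChart p (extD σ) y = extDeriv (inChart p σ) y :=
  pull_extD hσ (isOpen_extChartAt_target p) (contMDiffOn_chart_symm p) hy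

theorem extDeriv_pull_eq_zero {η : RawForm m k N} (hη : IsSmoothOn η univ)
    (hd : ∀ y, extD η y = 0) {f : X → N} {O : Set X}
    (hO : IsOpen O) (hf : ContMDiffOn 𝓘(ℝ, X) (𝓡 m) ∞ f O) {x : X} (hx : x ∈ O) :
    extDeriv (pull f η) x = 0 := by
  rw [← pull_extD hη hO hf hx]
  have : (extD η).at (f x) = 0 := hd _
  rw [pull, this]
  rfl

end Pull

/-! ### The `C^∞` topology on the spaces of forms -/

section FormTopology

variable {n k : ℕ} {M : Type*}
  [TopologicalSpace M] [ChartedSpace (EuclideanSpace ℝ (Fin n)) M]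

theorem tendsto_smoothForm_iff {ι : Type*} {l : Filter ι} {f : ι → SmoothForm n k M}
    {g : SmoothForm n k M} : Tendsto f l (𝓝 g) ↔
      ∀ (p : M) (q : ℕ) (C : Set (EuclideanSpace ℝ (Fin n))), IsCompact C →
        C ⊆ (extChartAt (𝓡 n) p).target →
        TendstoCk l C q (fun i => inChart p (f i).val) (inChart p g.val) := by
  rw [nhds_induced, tendsto_comap_iff, tendsto_pi_nhds]
  simp only [UniformOnFun.tendsto_iff_tendstoUniformlyOn, tendstoCk_iff]
  constructor
  · intro h p q C hC hCt j _
    exact h (p, j) C ⟨hC, hCt⟩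
  · rintro h ⟨p, j⟩ C ⟨hC, hCt⟩
    exact h p j C hC hCt j le_rfl

theorem TendstoCk.extDeriv {E : Type} [NormedAddCommGroup E] [NormedSpace ℝ E] {ι : Type*}
    {l : Filter ι} {C : Set E} {q : ℕ} {V : Set E} (hV : IsOpen V) (hCV : C ⊆ V)
    {f : ι → E → E [⋀^Fin k]→L[ℝ] ℝ} {g : E → E [⋀^Fin k]→L[ℝ] ℝ}
    (hf : ∀ᶠ i in l, ContDiffOn ℝ ∞ (f i) V) (hg : ContDiffOn ℝ ∞ g V)
    (h : TendstoCk l C (q + 1) f g) :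
    TendstoCk l C q (fun i => _root_.extDeriv (f i)) (_root_.extDeriv g) :=
  h.2.clm_comp hV hCV (ContinuousAlternatingMap.alternatizeUncurryFinCLM ℝ E ℝ)
    (hf.mono fun i hi => hi.fderiv_of_isOpen hV (by simp)) (hg.fderiv_of_isOpen hV (by simp))

theorem contDiffOn_extDeriv {E : Type*} [NormedAddCommGroup E] [NormedSpace ℝ E]
    {V : Set E} (hV : IsOpen V) {g : E → E [⋀^Fin k]→L[ℝ] ℝ} (hg : ContDiffOn ℝ ∞ g V) :
    ContDiffOn ℝ ∞ (extDeriv g) V :=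
  (ContinuousAlternatingMap.alternatizeUncurryFinCLM ℝ E ℝ).contDiff.comp_contDiffOn
    (hg.fderiv_of_isOpen hV (by simp))

/-- A smooth form from a field of forms with smooth chart representatives. -/
def SmoothForm.mk' (σ : RawForm n k M)
    (h : ∀ p : M, ContDiffOn ℝ ∞ (inChart p σ) (extChartAt (𝓡 n) p).target) : SmoothForm n k M :=
  ⟨σ, fun p => by rw [preimage_univ, inter_univ]; exact h p⟩

theorem SmoothForm.ext {σ η : SmoothForm n k M} (h : σ.val = η.val) : σ = η := Subtype.ext h

theorem inChart_extD_eventuallyEq [IsManifold (𝓡 n) ∞ M] (σ : SmoothForm n k M) (p : M)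
    {y : EuclideanSpace ℝ (Fin n)} (hy : y ∈ (extChartAt (𝓡 n) p).target) :
    extDeriv (inChart p σ.val) =ᶠ[𝓝 y] inChart p (extD σ.val) := by
  filter_upwards [(isOpen_extChartAt_target p).mem_nhds hy] with z hz
  exact (inChart_extD σ.smooth p hz).symm

variable [IsManifold (𝓡 n) ∞ M]

/-- The exterior derivative as a map to the space of exact forms. -/
def dForm (σ : SmoothForm n k M) : exactForms n k M :=
  ⟨SmoothForm.mk' (extD σ.val) fun p =>
    (contDiffOn_extDeriv (isOpen_extChartAt_target p) (σ.smooth.contDiffOn p)).congr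
      fun _ hy => inChart_extD σ.smooth p hy, σ, rfl⟩

theorem dForm_val (σ : SmoothForm n k M) : (dForm σ).val.val = extD σ.val := rfl

theorem dForm_add (σ η : SmoothForm n k M) : dForm (σ + η) = dForm σ + dForm η :=
  Subtype.ext (SmoothForm.ext (extD_add σ η))

theorem dForm_smul (a : ℝ) (σ : SmoothForm n k M) : dForm (a • σ) = a • dForm σ :=
  Subtype.ext (SmoothForm.ext (extD_smul a σ))

theorem dForm_sub (σ η : SmoothForm n k M) : dForm (σ - η) = dForm σ - dForm η := by
  have h := dForm_add (σ - η) η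
  rw [sub_add_cancel] at h
  rw [h, add_sub_cancel_right]

theorem continuous_dForm : Continuous (dForm : SmoothForm n k M → exactForms n k M) := by
  refine continuous_iff_continuousAt.2 fun σ => ?_
  refine Topology.IsInducing.subtypeVal.tendsto_nhds_iff.2 ?_
  refine tendsto_smoothForm_iff.2 fun p q C hC hCt => ?_
  have h := tendsto_smoothForm_iff.1 (tendsto_id (x := 𝓝 σ)) p (q + 1) C hC hCt
  refine (h.extDeriv (isOpen_extChartAt_target p) hCt
    (Eventually.of_forall fun η => η.smooth.contDiffOn p) (σ.smooth.contDiffOn p)).congr ?_ ?_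
  · exact Eventually.of_forall fun η y hy => inChart_extD_eventuallyEq η p (hCt hy)
  · exact fun y hy => inChart_extD_eventuallyEq σ p (hCt hy)

end FormTopology

/-! ### The bundle of `2`-forms in a chart -/

section FormBundle

local notation "E4" => EuclideanSpace ℝ (Fin 4)

variable {M : Type*} [TopologicalSpace M] [ChartedSpace (EuclideanSpace ℝ (Fin 4)) M]

/-- The value of a field of forms at the point with coordinates `y`, as a function of its
representative in the chart around `p`. -/
def ofChart {n k : ℕ} {M : Type*} [TopologicalSpace M]
    [ChartedSpace (EuclideanSpace ℝ (Fin n)) M] (p : M) (y : EuclideanSpace ℝ (Fin n)) :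
    (EuclideanSpace ℝ (Fin n) [⋀^Fin k]→L[ℝ] ℝ) →L[ℝ]
      (EuclideanSpace ℝ (Fin n) [⋀^Fin k]→L[ℝ] ℝ) :=
  ContinuousAlternatingMap.compContinuousLinearMapCLM
    (chartDiff (n := n) p ((extChartAt (𝓡 n) p).symm y))

/-- The representative in the chart around `p`, as a function of the value of a field of forms at
the point with coordinates `y`. -/
def toChart {n k : ℕ} {M : Type*} [TopologicalSpace M]
    [ChartedSpace (EuclideanSpace ℝ (Fin n)) M] (p : M) (y : EuclideanSpace ℝ (Fin n)) :
    (EuclideanSpace ℝ (Fin n) [⋀^Fin k]→L[ℝ] ℝ) →L[ℝ]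
      (EuclideanSpace ℝ (Fin n) [⋀^Fin k]→L[ℝ] ℝ) :=
  ContinuousAlternatingMap.compContinuousLinearMapCLM (chartSymmDiff (n := n) p y)

theorem toChart_at {n k : ℕ} {M : Type*} [TopologicalSpace M]
    [ChartedSpace (EuclideanSpace ℝ (Fin n)) M] (p : M) (y : EuclideanSpace ℝ (Fin n))
    (σ : RawForm n k M) : toChart p y (σ.at ((extChartAt (𝓡 n) p).symm y)) = inChart p σ y := rfl

theorem toChart_ofChart {n k : ℕ} {M : Type*} [TopologicalSpace M]
    [ChartedSpace (EuclideanSpace ℝ (Fin n)) M] [IsManifold (𝓡 n) ∞ M] {p : M}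
    {y : EuclideanSpace ℝ (Fin n)}
    (hy : y ∈ (extChartAt (𝓡 n) p).target) (β : EuclideanSpace ℝ (Fin n) [⋀^Fin k]→L[ℝ] ℝ) :
    toChart p y (ofChart p y β) = β := by
  change (β.compContinuousLinearMap _).compContinuousLinearMap _ = β
  rw [compContinuousLinearMap_comp, chartDiff_comp_chartSymmDiff hy, compContinuousLinearMap_id']

theorem ofChart_toChart {n k : ℕ} {M : Type*} [TopologicalSpace M]
    [ChartedSpace (EuclideanSpace ℝ (Fin n)) M] [IsManifold (𝓡 n) ∞ M] {p : M}
    {y : EuclideanSpace ℝ (Fin n)}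
    (hy : y ∈ (extChartAt (𝓡 n) p).target) (β : EuclideanSpace ℝ (Fin n) [⋀^Fin k]→L[ℝ] ℝ) :
    ofChart p y (toChart p y β) = β := by
  change (β.compContinuousLinearMap _).compContinuousLinearMap _ = β
  have h := chartSymmDiff_comp_chartDiff ((extChartAt (𝓡 n) p).map_target hy)
  rw [(extChartAt (𝓡 n) p).right_inv hy] at h
  rw [compContinuousLinearMap_comp, h, compContinuousLinearMap_id']

theorem ofChart_inChart {n k : ℕ} {M : Type*} [TopologicalSpace M]
    [ChartedSpace (EuclideanSpace ℝ (Fin n)) M] [IsManifold (𝓡 n) ∞ M] {p : M}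
    {y : EuclideanSpace ℝ (Fin n)}
    (hy : y ∈ (extChartAt (𝓡 n) p).target) (σ : RawForm n k M) :
    ofChart p y (inChart p σ y) = σ.at ((extChartAt (𝓡 n) p).symm y) := by
  rw [← toChart_at, ofChart_toChart hy]

/-- A point of the total space of `Λ² T^*M`, from a point and a form on the model space. -/
def bundleMk (x : M) (β : E4 [⋀^Fin 2]→L[ℝ] ℝ) : TwoFormBundle M := ⟨x, β⟩

/-- The parametrisation of the bundle of `2`-forms by the chart around `p`. -/
def bundleParam (p : M) (z : E4 × (E4 [⋀^Fin 2]→L[ℝ] ℝ)) : TwoFormBundle M :=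
  bundleMk ((extChartAt (𝓡 4) p).symm z.1) (ofChart p z.1 z.2)

/-- The inverse of `bundleParam p`. -/
def bundleCoord (p : M) (u : TwoFormBundle M) : E4 × (E4 [⋀^Fin 2]→L[ℝ] ℝ) :=
  (extChartAt (𝓡 4) p u.1, toChart p (extChartAt (𝓡 4) p u.1) u.2)

variable [IsManifold (𝓡 4) ∞ M]

theorem bundleParam_inChart {p : M} {y : E4} (hy : y ∈ (extChartAt (𝓡 4) p).target)
    (σ : RawForm 4 2 M) :
    bundleParam p (y, inChart p σ y) = ⟨(extChartAt (𝓡 4) p).symm y, σ _⟩ :=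
  congrArg (bundleMk ((extChartAt (𝓡 4) p).symm y)) (ofChart_inChart hy σ)

theorem bundleCoord_bundleParam {p : M} {y : E4} (hy : y ∈ (extChartAt (𝓡 4) p).target)
    (β : E4 [⋀^Fin 2]→L[ℝ] ℝ) : bundleCoord p (bundleParam p (y, β)) = (y, β) := by
  have h := (extChartAt (𝓡 4) p).right_inv hy
  refine Prod.ext h ?_
  change toChart p (extChartAt (𝓡 4) p ((extChartAt (𝓡 4) p).symm y)) (ofChart p y β) = β
  rw [h, toChart_ofChart hy]

theorem trivializationAt_bundle (p : M) (u : TwoFormBundle M)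
    (hu : u.1 ∈ (extChartAt (𝓡 4) p).source) :
    trivializationAt (E4 [⋀^Fin 2]→L[ℝ] ℝ) (fun x : M => FormAt 4 2 x) p u =
      (u.1, toChart p (extChartAt (𝓡 4) p u.1) u.2) := by
  have : IsManifold (𝓡 4) 1 M := IsManifold.of_le (n := ∞) (by simp)
  rw [FiberBundle.trivializationAt_continuousAlternatingMap_apply]
  refine Prod.ext rfl ?_
  have h1 := TangentBundle.symmL_trivializationAt (I := 𝓡 4) (x₀ := p) (x := u.1)
    (by rwa [extChartAt_source] at hu)
  have h2 : (trivializationAt ℝ (Bundle.Trivial M ℝ) p).continuousLinearMapAt ℝ u.1 =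
      ContinuousLinearMap.id ℝ ℝ := Bundle.Trivial.continuousLinearMapAt_trivialization ℝ M ℝ u.1
  have h3 : (trivializationAt E4 (TangentSpace (𝓡 4)) p).symmL ℝ u.1 =
      chartSymmDiff p (extChartAt (𝓡 4) p u.1) := by
    rw [h1, ModelWithCorners.range_eq_univ, mfderivWithin_univ]
    rfl
  change (((trivializationAt ℝ (Bundle.Trivial M ℝ) p).continuousLinearMapAt ℝ
    u.1).compContinuousAlternatingMap u.2).compContinuousLinearMap
    ((trivializationAt E4 (TangentSpace (𝓡 4)) p).symmL ℝ u.1) = _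
  rw [h2, h3]
  rfl

theorem continuousOn_bundleCoord (p : M) :
    ContinuousOn (bundleCoord p) (TotalSpace.proj ⁻¹' (extChartAt (𝓡 4) p).source) := by
  let e := trivializationAt (E4 [⋀^Fin 2]→L[ℝ] ℝ) (fun x : M => FormAt 4 2 x) p
  have hs : e.source = TotalSpace.proj ⁻¹' (extChartAt (𝓡 4) p).source := by
    rw [extChartAt_source]
    ext u
    simp [e]
  have h1 : ContinuousOn e (TotalSpace.proj ⁻¹' (extChartAt (𝓡 4) p).source) :=
    hs ▸ e.continuousOn
  have h2 : ContinuousOn (fun u => (e u).2) (TotalSpace.proj ⁻¹' (extChartAt (𝓡 4) p).source) :=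
    continuous_snd.comp_continuousOn h1
  have h3 : ContinuousOn (fun u : TwoFormBundle M => extChartAt (𝓡 4) p u.1)
      (TotalSpace.proj ⁻¹' (extChartAt (𝓡 4) p).source) :=
    (continuousOn_extChartAt p).comp (FiberBundle.continuous_proj _ _).continuousOn
      fun u hu => hu
  refine (h3.prodMk h2).congr fun u hu => ?_
  refine Prod.ext rfl ?_
  exact (congrArg Prod.snd (trivializationAt_bundle p u hu)).symm

theorem continuousOn_bundleParam (p : M) :
    ContinuousOn (bundleParam p) ((extChartAt (𝓡 4) p).target ×ˢ univ) := by
  let e := trivializationAt (E4 [⋀^Fin 2]→L[ℝ] ℝ) (fun x : M => FormAt 4 2 x) p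
  have hs : ∀ u, u ∈ e.source ↔ u.1 ∈ (extChartAt (𝓡 4) p).source := by
    rw [extChartAt_source]
    intro u
    simp [e]
  have ht : e.target = e.baseSet ×ˢ univ := e.target_eq
  have hb : e.baseSet = (extChartAt (𝓡 4) p).source := by
    rw [extChartAt_source]
    simp [e]
  have h1 : ContinuousOn (fun z : E4 × (E4 [⋀^Fin 2]→L[ℝ] ℝ) =>
      ((extChartAt (𝓡 4) p).symm z.1, z.2)) ((extChartAt (𝓡 4) p).target ×ˢ univ) :=
    ((continuousOn_extChartAt_symm p).comp continuousOn_fst fun z hz => hz.1).prodMk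
      continuousOn_snd
  have h2 := e.continuousOn_invFun.comp h1 fun z hz => by
    refine e.target_eq ▸ ⟨?_, mem_univ _⟩
    rw [hb]
    exact (extChartAt (𝓡 4) p).map_target hz.1
  refine h2.congr fun z hz => ?_
  have hm : bundleParam p z ∈ e.source := (hs _).2 ((extChartAt (𝓡 4) p).map_target hz.1)
  have h3 : e (bundleParam p z) = ((extChartAt (𝓡 4) p).symm z.1, z.2) := by
    refine (trivializationAt_bundle p _ ((hs _).1 hm)).trans ?_
    have h4 := congrArg Prod.snd (bundleCoord_bundleParam hz.1 z.2)
    exact Prod.ext rfl h4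
  have h5 := e.toPartialEquiv.left_inv hm
  refine h5.symm.trans ?_
  exact congrArg e.toPartialEquiv.symm h3

end FormBundle

/-! ### Projections onto smoothly varying subspaces -/

section Projection

variable {X H : Type*} [NormedAddCommGroup X] [NormedSpace ℝ X]
  [NormedAddCommGroup H] [InnerProductSpace ℝ H] [FiniteDimensional ℝ H] {d : ℕ}

/-- The linear combinations of `v`, as a linear map of the coefficients. -/
def combination (v : Fin d → H) : (Fin d → ℝ) →L[ℝ] H :=
  ∑ i, (ContinuousLinearMap.proj i : (Fin d → ℝ) →L[ℝ] ℝ).smulRight (v i)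

theorem combination_apply (v : Fin d → H) (t : Fin d → ℝ) :
    combination v t = ∑ i, t i • v i := by
  simp [combination]

/-- The inner products with the vectors `v`. -/
def innerProducts (v : Fin d → H) : H →L[ℝ] (Fin d → ℝ) :=
  ContinuousLinearMap.pi fun i => innerSL ℝ (v i)

theorem isUnit_gram {v : Fin d → H} (hv : LinearIndependent ℝ v) :
    IsUnit ((innerProducts v).comp (combination v)) := by
  have hinj : Function.Injective ((innerProducts v).comp (combination v)) := by
    refine (injective_iff_map_eq_zero _).2 fun t ht => ?_
    have h1 : inner ℝ (combination v t) (combination v t) = (0 : ℝ) := by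
      nth_rewrite 1 [combination_apply]
      rw [sum_inner]
      refine Finset.sum_eq_zero fun i _ => ?_
      have h2 : inner ℝ (v i) (combination v t) = (0 : ℝ) := congrFun ht i
      rw [inner_smul_left, h2, mul_zero]
    have h3 : combination v t = 0 := inner_self_eq_zero.1 h1
    rw [combination_apply] at h3
    exact funext (Fintype.linearIndependent_iff.1 hv t h3)
  rw [ContinuousLinearMap.isUnit_iff_bijective]
  exact ⟨hinj, LinearMap.injective_iff_surjective.1 hinj⟩

/-- The coefficients of the orthogonal projection onto the span of the linearly independent
vectors `v`. -/
def projCoeff (v : Fin d → H) : H →L[ℝ] (Fin d → ℝ) :=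
  (Ring.inverse ((innerProducts v).comp (combination v))).comp (innerProducts v)

theorem starProjection_span_eq {v : Fin d → H} (hv : LinearIndependent ℝ v) (x : H) :
    (Submodule.span ℝ (range v)).starProjection x = ∑ i, projCoeff v x i • v i := by
  have hG := Ring.mul_inverse_cancel _ (isUnit_gram hv)
  refine (Submodule.eq_starProjection_of_mem_of_inner_eq_zero ?_ ?_)
  · exact Submodule.sum_mem _ fun i _ =>
      Submodule.smul_mem _ _ (Submodule.subset_span (mem_range_self i))
  · have h1 : innerProducts v (x - combination v (projCoeff v x)) = 0 := by
      have h2 := DFunLike.congr_fun hG (innerProducts v x)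
      rw [map_sub]
      exact sub_eq_zero.2 h2.symm
    rw [← combination_apply]
    intro w hw
    induction hw using Submodule.span_induction with
    | mem w hw =>
      obtain ⟨i, rfl⟩ := hw
      rw [real_inner_comm]
      exact congrFun h1 i
    | zero => exact inner_zero_right _
    | add a b _ _ ha hb => rw [inner_add_right, ha, hb, add_zero]
    | smul c a _ ha => rw [inner_smul_right, ha, mul_zero]

theorem contDiffOn_projCoeff {v : X → Fin d → H} {V : Set X} (hv : ContDiffOn ℝ ∞ v V)
    (hli : ∀ y ∈ V, LinearIndependent ℝ (v y)) :
    ContDiffOn ℝ ∞ (fun y => projCoeff (v y)) V := by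
  have hvi := contDiffOn_pi.1 hv
  have hA : ContDiffOn ℝ ∞ (fun y => combination (v y)) V :=
    ContDiffOn.sum fun i _ => contDiffOn_const.smulRight (hvi i)
  have hB : ContDiffOn ℝ ∞ (fun y => innerProducts (v y)) V := by
    let P : (Fin d → (H →L[ℝ] ℝ)) →L[ℝ] (H →L[ℝ] (Fin d → ℝ)) :=
      LinearMap.toContinuousLinearMap
        { toFun := fun f => ContinuousLinearMap.pi f
          map_add' := fun _ _ => rfl
          map_smul' := fun _ _ => rfl }
    exact P.contDiff.comp_contDiffOn
      (contDiffOn_pi.2 fun i => (innerSL ℝ).contDiff.comp_contDiffOn (hvi i))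
  refine ContDiffOn.clm_comp (fun y hy => ?_) hB
  obtain ⟨u, hu⟩ := isUnit_gram (hli y hy)
  have h := contDiffAt_ringInverse ℝ (n := ∞) u
  rw [hu] at h
  exact h.comp_contDiffWithinAt y ((hB.clm_comp hA) y hy)

variable {W : Type*} [NormedAddCommGroup W] [NormedSpace ℝ W] [FiniteDimensional ℝ W]

/-- A linear projection onto the subspace `S`: the orthogonal one for some auxiliary inner product
on `W`. -/
def linearProj (S : Submodule ℝ W) : W →L[ℝ] W :=
  (toEuclidean (E := W)).symm.toContinuousLinearMap ∘L
    (S.map (toEuclidean (E := W)).toLinearMap).starProjection ∘L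
    (toEuclidean (E := W)).toContinuousLinearMap

theorem linearProj_mem (S : Submodule ℝ W) (β : W) : linearProj S β ∈ S := by
  obtain ⟨γ, hγ, h⟩ := Submodule.starProjection_apply_mem
    (S.map (toEuclidean (E := W)).toLinearMap) (toEuclidean β)
  have : linearProj S β = γ := by
    change (toEuclidean (E := W)).symm _ = γ
    rw [ContinuousLinearEquiv.symm_apply_eq]
    exact h.symm
  rwa [this]

theorem linearProj_of_mem {S : Submodule ℝ W} {β : W} (h : β ∈ S) : linearProj S β = β := by
  have h1 : (S.map (toEuclidean (E := W)).toLinearMap).starProjection (toEuclidean β) =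
      toEuclidean β := Submodule.starProjection_eq_self_iff.2 ⟨β, h, rfl⟩
  change (toEuclidean (E := W)).symm _ = β
  rw [ContinuousLinearEquiv.symm_apply_eq]
  exact h1

/-- The coefficients of `linearProj` with respect to a basis of the subspace. -/
def linearProjCoeff (v : Fin d → W) : W →L[ℝ] (Fin d → ℝ) :=
  (projCoeff fun i => toEuclidean (v i)) ∘L (toEuclidean (E := W)).toContinuousLinearMap

theorem linearProj_span_eq {v : Fin d → W} (hv : LinearIndependent ℝ v) (β : W) :
    linearProj (Submodule.span ℝ (range v)) β = ∑ i, linearProjCoeff v β i • v i := by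
  have hv' : LinearIndependent ℝ fun i => toEuclidean (v i) :=
    hv.map' (toEuclidean (E := W)).toLinearMap
      (LinearMap.ker_eq_bot.2 (toEuclidean (E := W)).injective)
  have h1 : (Submodule.span ℝ (range v)).map (toEuclidean (E := W)).toLinearMap =
      Submodule.span ℝ (range fun i => toEuclidean (v i)) := by
    rw [Submodule.map_span, ← range_comp]
    rfl
  change (toEuclidean (E := W)).symm (((Submodule.span ℝ (range v)).map
    (toEuclidean (E := W)).toLinearMap).starProjection (toEuclidean β)) = _
  have h2 : ∀ (K K' : Submodule ℝ (EuclideanSpace ℝ (Fin (Module.finrank ℝ W))))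
      [K.HasOrthogonalProjection] [K'.HasOrthogonalProjection], K = K' →
      ∀ x, K.starProjection x = K'.starProjection x := by
    rintro K _ _ _ rfl x
    rfl
  rw [ContinuousLinearEquiv.symm_apply_eq, h2 _ _ h1, starProjection_span_eq hv', map_sum]
  simp only [map_smul]
  rfl

theorem contDiffOn_linearProjCoeff {v : X → Fin d → W} {V : Set X} (hv : ContDiffOn ℝ ∞ v V)
    (hli : ∀ y ∈ V, LinearIndependent ℝ (v y)) :
    ContDiffOn ℝ ∞ (fun y => linearProjCoeff (v y)) V := by
  refine (contDiffOn_projCoeff (v := fun y i => toEuclidean (v y i)) ?_ fun y hy =>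
    (hli y hy).map' (toEuclidean (E := W)).toLinearMap
      (LinearMap.ker_eq_bot.2 (toEuclidean (E := W)).injective)).clm_comp contDiffOn_const
  exact contDiffOn_pi.2 fun i => (toEuclidean (E := W)).contDiff.comp_contDiffOn
    (contDiffOn_pi.1 hv i)

/-- The projections onto a smoothly varying family of subspaces are smooth. -/
theorem contDiffOn_linearProj {S : X → Submodule ℝ W} {v : X → Fin d → W} {V : Set X}
    (hv : ContDiffOn ℝ ∞ v V) (hli : ∀ y ∈ V, LinearIndependent ℝ (v y))
    (hspan : ∀ y ∈ V, Submodule.span ℝ (range (v y)) = S y) :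
    ContDiffOn ℝ ∞ (fun y => linearProj (S y)) V := by
  have h1 := contDiffOn_linearProjCoeff hv hli
  have h2 : ContDiffOn ℝ ∞ (fun y => ∑ i, (((ContinuousLinearMap.proj i :
      (Fin d → ℝ) →L[ℝ] ℝ).comp (linearProjCoeff (v y))).smulRight (v y i))) V :=
    ContDiffOn.sum fun i _ => (contDiffOn_const.clm_comp h1).smulRight (contDiffOn_pi.1 hv i)
  refine h2.congr fun y hy => ?_
  ext1 β
  rw [← hspan y hy, linearProj_span_eq (hli y hy)]
  simp

end Projection

/-! ### Local frames of the bundle of self-dual forms -/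

section Frames

local notation "E4" => EuclideanSpace ℝ (Fin 4)
local notation "V7" => EuclideanSpace ℝ (Fin 7)

variable {M Y : Type*}
  [TopologicalSpace M] [ChartedSpace (EuclideanSpace ℝ (Fin 4)) M] [IsManifold (𝓡 4) ∞ M]
  [TopologicalSpace Y] [ChartedSpace (EuclideanSpace ℝ (Fin 7)) Y] [IsManifold (𝓡 7) ∞ Y]
  {φ : RawForm 7 3 Y} {ι : M → Y}

theorem contDiffOn_contract {X : Type*} {A V : Type*} [NormedAddCommGroup X] [NormedSpace ℝ X]
    [NormedAddCommGroup A] [NormedSpace ℝ A] [FiniteDimensional ℝ A]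
    [NormedAddCommGroup V] [NormedSpace ℝ V] {k : ℕ} {s : Set X}
    {β : X → V [⋀^Fin (k + 1)]→L[ℝ] ℝ} {w : X → V} {B : X → A →L[ℝ] V}
    (hβ : ContDiffOn ℝ ∞ β s) (hw : ContDiffOn ℝ ∞ w s) (hB : ContDiffOn ℝ ∞ B s) :
    ContDiffOn ℝ ∞ (fun x => ((β x).curryLeft (w x)).compContinuousLinearMap (B x)) s := by
  refine contDiffOn_alternating fun v => ?_
  refine (contDiffOn_alternating_apply (v := fun x => Fin.cons (w x) fun i => B x (v i)) hβ
    fun i => ?_).congr fun x _ => rfl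
  refine Fin.cases ?_ (fun j => ?_) i
  · exact hw
  · exact hB.clm_apply contDiffOn_const

/-- The field of forms `ι^* (i_w φ)`, for a vector `w` that is constant in the chart around `q`. -/
def contractField (φ : RawForm 7 3 Y) (ι : M → Y) (q : Y) (w : V7) : RawForm 4 2 M := fun x =>
  contractAt φ ι x (chartSymmDiff q (extChartAt (𝓡 7) q (ι x)) w)

theorem contractField_at (φ : RawForm 7 3 Y) (ι : M → Y) (q : Y) (w : V7) (x : M) :
    (contractField φ ι q w).at x =
      contractAt φ ι x (chartSymmDiff q (extChartAt (𝓡 7) q (ι x)) w) := rfl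

theorem inChart_contractField (hι : ContMDiff (𝓡 4) (𝓡 7) ∞ ι) (q : Y) (w : V7) {p : M} {y : E4}
    (hy : y ∈ (extChartAt (𝓡 4) p).target)
    (hq : ι ((extChartAt (𝓡 4) p).symm y) ∈ (extChartAt (𝓡 7) q).source) :
    inChart p (contractField φ ι q w) y =
      ((inChart q φ (extChartAt (𝓡 7) q (ι ((extChartAt (𝓡 4) p).symm y)))).curryLeft
        w).compContinuousLinearMap
        (fderiv ℝ (extChartAt (𝓡 7) q ∘ ι ∘ (extChartAt (𝓡 4) p).symm) y) := by
  set x := (extChartAt (𝓡 4) p).symm y with hx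
  have hd : MDifferentiableAt (𝓡 4) (𝓡 7) ι x := (hι x).mdifferentiableAt (by simp)
  have h1 : diffFrom (ι ∘ (extChartAt (𝓡 4) p).symm) y =
      (diffAt (n := 4) (m := 7) ι x).comp (chartSymmDiff p y) :=
    mfderiv_comp y hd (mdifferentiableAt_chart_symm hy)
  have h2 := chartDiff_comp_diffFrom (q := q) (f := ι ∘ (extChartAt (𝓡 4) p).symm)
    (hd.comp y (mdifferentiableAt_chart_symm hy)) hq
  rw [h1] at h2
  rw [← h2, inChart_apply_eq, ← hx, contractField_at, contractAt, at_eq_inChart φ hq]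
  have h3 : chartDiff q (ι x) (chartSymmDiff q (extChartAt (𝓡 7) q (ι x)) w) = w := by
    have h4 := chartDiff_comp_chartSymmDiff ((extChartAt (𝓡 7) q).map_source hq)
    rw [(extChartAt (𝓡 7) q).left_inv hq] at h4
    exact DFunLike.congr_fun h4 w
  ext v
  change inChart q φ _ (fun i => _) = inChart q φ _ _
  congr 1
  funext i
  refine Fin.cases ?_ (fun j => ?_) i
  · exact h3
  · rfl

theorem isSmoothOn_contractField (hφ : IsSmoothOn φ univ) (hι : ContMDiff (𝓡 4) (𝓡 7) ∞ ι)
    (q : Y) (w : V7) : IsSmoothOn (contractField φ ι q w)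
      (ι ⁻¹' (extChartAt (𝓡 7) q).source) := by
  intro p
  have hO : IsOpen ((extChartAt (𝓡 4) p).target ∩
      (extChartAt (𝓡 4) p).symm ⁻¹' (ι ⁻¹' (extChartAt (𝓡 7) q).source)) :=
    (continuousOn_extChartAt_symm p).isOpen_inter_preimage (isOpen_extChartAt_target p)
      ((isOpen_extChartAt_source q).preimage hι.continuous)
  have hg : ContDiffOn ℝ ∞ (extChartAt (𝓡 7) q ∘ ι ∘ (extChartAt (𝓡 4) p).symm)
      ((extChartAt (𝓡 4) p).target ∩
      (extChartAt (𝓡 4) p).symm ⁻¹' (ι ⁻¹' (extChartAt (𝓡 7) q).source)) := by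
    rw [← contMDiffOn_iff_contDiffOn]
    refine (contMDiffOn_extChartAt (x := q)).comp
      (hι.comp_contMDiffOn ((contMDiffOn_chart_symm p).mono inter_subset_left)) fun z hz => ?_
    simpa [extChartAt_source] using hz.2
  refine (contDiffOn_contract (w := fun _ => w) ((hφ.contDiffOn q).comp hg
    fun z hz => (extChartAt (𝓡 7) q).map_source hz.2) contDiffOn_const
    (hg.fderiv_of_isOpen hO (by simp))).congr fun y hy => ?_
  exact inChart_contractField hι q w hy.1 hy.2

theorem linearIndependent_toChart_iff {n k d : ℕ} {M : Type*} [TopologicalSpace M]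
    [ChartedSpace (EuclideanSpace ℝ (Fin n)) M] [IsManifold (𝓡 n) ∞ M] {p : M}
    {y : EuclideanSpace ℝ (Fin n)} (hy : y ∈ (extChartAt (𝓡 n) p).target)
    {s : Fin d → RawForm n k M} :
    LinearIndependent ℝ (fun i => inChart p (s i) y) ↔
      LinearIndependent ℝ (fun i => (s i).at ((extChartAt (𝓡 n) p).symm y)) := by
  refine ⟨fun h => LinearIndependent.of_comp (toChart p y).toLinearMap h, fun h => ?_⟩
  refine h.map' (toChart p y).toLinearMap (LinearMap.ker_eq_bot.2 ?_)
  exact Function.LeftInverse.injective (g := ofChart p y) fun β => ofChart_toChart hy β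

/-- The bundle of self-dual forms has smooth local frames. -/
theorem exists_selfDualFrame (hφ : IsClosedG2Structure φ) (hι : IsCoassociativeImmersion φ ι)
    (x₀ : M) : ∃ (V : Set M) (s : Fin 3 → RawForm 4 2 M), x₀ ∈ V ∧ IsSelfDualFrame φ ι V s := by
  obtain ⟨L₀, hL₀⟩ := hφ.exists_frame (ι x₀)
  obtain ⟨⟨w, hw⟩, -⟩ := exists_contractAt_linearIndependent (hι.immersion x₀)
    (hι.pullback_eq_zero x₀) hL₀
  let q := ι x₀
  let s : Fin 3 → RawForm 4 2 M := fun i => contractField φ ι q (chartDiff q (ι x₀) (w i))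
  have hq : ι x₀ ∈ (extChartAt (𝓡 7) q).source := mem_extChartAt_source _
  have hs0 : LinearIndependent ℝ (fun i => (s i).at x₀) := by
    have : (fun i => (s i).at x₀) = fun i => contractAt φ ι x₀ (w i) := by
      funext i
      change contractAt φ ι x₀ _ = _
      have h4 := chartSymmDiff_comp_chartDiff hq
      exact congrArg _ (DFunLike.congr_fun h4 (w i))
    rwa [this]
  have hsm : ∀ i, IsSmoothOn (s i) (ι ⁻¹' (extChartAt (𝓡 7) q).source) := fun i =>
    isSmoothOn_contractField hφ.smooth hι.smooth q _
  have hVo : IsOpen (ι ⁻¹' (extChartAt (𝓡 7) q).source) :=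
    (isOpen_extChartAt_source q).preimage hι.smooth.continuous
  let O := (extChartAt (𝓡 4) x₀).target ∩
      (extChartAt (𝓡 4) x₀).symm ⁻¹' (ι ⁻¹' (extChartAt (𝓡 7) q).source)
  have hO : IsOpen O := (continuousOn_extChartAt_symm x₀).isOpen_inter_preimage
    (isOpen_extChartAt_target x₀) hVo
  have hcont : ContinuousOn (fun y i => inChart x₀ (s i) y) O :=
    continuousOn_pi.2 fun i => (hsm i x₀).continuousOn
  have hO' : IsOpen (O ∩ (fun y i => inChart x₀ (s i) y) ⁻¹'
      {f : Fin 3 → (E4 [⋀^Fin 2]→L[ℝ] ℝ) | LinearIndependent ℝ f}) :=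
    hcont.isOpen_inter_preimage hO isOpen_setOfPred_linearIndependent
  have hy0 : extChartAt (𝓡 4) x₀ x₀ ∈ (extChartAt (𝓡 4) x₀).target := mem_extChartAt_target x₀
  have hV : IsOpen ((extChartAt (𝓡 4) x₀).source ∩ extChartAt (𝓡 4) x₀ ⁻¹'
      (O ∩ (fun y i => inChart x₀ (s i) y) ⁻¹'
      {f : Fin 3 → (E4 [⋀^Fin 2]→L[ℝ] ℝ) | LinearIndependent ℝ f})) :=
    (continuousOn_extChartAt x₀).isOpen_inter_preimage (isOpen_extChartAt_source x₀) hO'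
  refine ⟨_, s, ?_, hV, ?_, ?_, ?_⟩
  · refine ⟨mem_extChartAt_source _, ⟨hy0, ?_⟩, ?_⟩
    · rw [mem_preimage, extChartAt_to_inv]; exact hq
    · refine (linearIndependent_toChart_iff hy0).2 ?_
      rwa [extChartAt_to_inv]
  · intro i p
    refine (hsm i p).mono fun y hy => ⟨hy.1, ?_⟩
    have := hy.2.2.1.2
    rw [mem_preimage, (extChartAt (𝓡 4) x₀).left_inv hy.2.1] at this
    exact this
  · rintro x ⟨hx, hxO, hli⟩
    have := (linearIndependent_toChart_iff hxO.1).1 hli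
    rw [(extChartAt (𝓡 4) x₀).left_inv hx] at this
    exact this
  · rintro x ⟨hx, hxO, hli⟩
    have hli' := (linearIndependent_toChart_iff hxO.1).1 hli
    rw [(extChartAt (𝓡 4) x₀).left_inv hx] at hli'
    obtain ⟨L, hL⟩ := hφ.exists_frame (ι x)
    obtain ⟨-, hfr⟩ := exists_contractAt_linearIndependent (hι.immersion x)
      (hι.pullback_eq_zero x) hL
    change Submodule.span ℝ (range fun i => (s i).at x) = selfDual φ ι x
    refine Submodule.eq_of_le_of_finrank_eq ?_ ?_
    · rw [Submodule.span_le]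
      rintro _ ⟨i, rfl⟩
      exact contractAt_mem (hι.pullback_eq_zero x) _
    · rw [hfr, finrank_span_eq_card hli', Fintype.card_fin]

end Frames

/-! ### The tubular neighborhood in a chart -/

section Chart

local notation "E4" => EuclideanSpace ℝ (Fin 4)
local notation "W2" => EuclideanSpace ℝ (Fin 4) [⋀^Fin 2]→L[ℝ] ℝ

variable {M Y : Type*}
  [TopologicalSpace M] [ChartedSpace (EuclideanSpace ℝ (Fin 4)) M] [IsManifold (𝓡 4) ∞ M]
  [TopologicalSpace Y] [ChartedSpace (EuclideanSpace ℝ (Fin 7)) Y] [IsManifold (𝓡 7) ∞ Y]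
  {φ : RawForm 7 3 Y} {ι : M → Y}

/-- The self-dual forms at the point with coordinates `y` in the chart around `p`. -/
def selfDualChart (φ : RawForm 7 3 Y) (ι : M → Y) (p : M) (y : E4) : Submodule ℝ W2 :=
  (selfDual φ ι ((extChartAt (𝓡 4) p).symm y)).map (toChart p y).toLinearMap

/-- A projection of the `2`-forms onto the self-dual ones, depending smoothly on the point. -/
def chartProj (φ : RawForm 7 3 Y) (ι : M → Y) (p : M) (y : E4) : W2 →L[ℝ] W2 :=
  linearProj (selfDualChart φ ι p y)

theorem ofChart_mem {p : M} {y : E4} (hy : y ∈ (extChartAt (𝓡 4) p).target) {β : W2}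
    (hβ : β ∈ selfDualChart φ ι p y) :
    ofChart p y β ∈ selfDual φ ι ((extChartAt (𝓡 4) p).symm y) := by
  obtain ⟨γ, hγ, rfl⟩ := hβ
  have : ofChart p y (toChart p y γ) = γ := ofChart_toChart hy γ
  exact (congrArg (· ∈ selfDual φ ι ((extChartAt (𝓡 4) p).symm y)) this).mpr hγ

theorem inChart_mem_selfDualChart (σ : selfDualForms φ ι) (p : M) (y : E4) :
    inChart p (formOf σ) y ∈ selfDualChart φ ι p y :=
  ⟨(formOf σ).at ((extChartAt (𝓡 4) p).symm y), σ.2 _, rfl⟩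

theorem chartProj_inChart (σ : selfDualForms φ ι) (p : M) (y : E4) :
    chartProj φ ι p y (inChart p (formOf σ) y) = inChart p (formOf σ) y :=
  linearProj_of_mem (inChart_mem_selfDualChart σ p y)

theorem exists_chart_frame (hφ : IsClosedG2Structure φ) (hι : IsCoassociativeImmersion φ ι)
    {p : M} {y₀ : E4} (hy₀ : y₀ ∈ (extChartAt (𝓡 4) p).target) :
    ∃ (V : Set M) (s : Fin 3 → RawForm 4 2 M) (N : Set E4), IsSelfDualFrame φ ι V s ∧
      IsOpen N ∧ y₀ ∈ N ∧ N ⊆ (extChartAt (𝓡 4) p).target ∧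
      (∀ y ∈ N, (extChartAt (𝓡 4) p).symm y ∈ V) ∧
      ContDiffOn ℝ ∞ (fun y i => inChart p (s i) y) N ∧
      (∀ y ∈ N, LinearIndependent ℝ fun i => inChart p (s i) y) ∧
      ∀ y ∈ N, Submodule.span ℝ (range fun i => inChart p (s i) y) = selfDualChart φ ι p y := by
  obtain ⟨V, s, hV, hs⟩ := exists_selfDualFrame hφ hι ((extChartAt (𝓡 4) p).symm y₀)
  refine ⟨V, s, (extChartAt (𝓡 4) p).target ∩ (extChartAt (𝓡 4) p).symm ⁻¹' V, hs,
    (continuousOn_extChartAt_symm p).isOpen_inter_preimage (isOpen_extChartAt_target p) hs.isOpen,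
    ⟨hy₀, hV⟩, inter_subset_left, fun y hy => hy.2, contDiffOn_pi.2 fun i => hs.smooth i p, ?_, ?_⟩
  · exact fun y hy => (linearIndependent_toChart_iff hy.1).2 (hs.linearIndependent _ hy.2)
  · intro y hy
    have h1 : Submodule.span ℝ (range fun i => (s i).at ((extChartAt (𝓡 4) p).symm y)) =
        selfDual φ ι ((extChartAt (𝓡 4) p).symm y) := hs.span_eq _ hy.2
    rw [selfDualChart, ← h1, Submodule.map_span, ← range_comp]
    rfl

theorem contDiffOn_chartProj (hφ : IsClosedG2Structure φ) (hι : IsCoassociativeImmersion φ ι)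
    (p : M) : ContDiffOn ℝ ∞ (chartProj φ ι p) (extChartAt (𝓡 4) p).target := by
  intro y₀ hy₀
  obtain ⟨V, s, N, -, hN, hyN, -, -, hv, hli, hsp⟩ := exists_chart_frame hφ hι hy₀
  exact ((contDiffOn_linearProj hv hli hsp).contDiffAt (hN.mem_nhds hyN)).contDiffWithinAt

theorem contDiffOn_chartProj_apply (hφ : IsClosedG2Structure φ)
    (hι : IsCoassociativeImmersion φ ι) (p : M) :
    ContDiffOn ℝ ∞ (fun z : E4 × W2 => chartProj φ ι p z.1 z.2)
      ((extChartAt (𝓡 4) p).target ×ˢ univ) :=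
  ((contDiffOn_chartProj hφ hι p).comp contDiffOn_fst fun _ hz => hz.1).clm_apply contDiffOn_snd

namespace TubularNeighborhood

variable (T : TubularNeighborhood φ ι)

/-- The open set of those `(y, β)` for which `J` is defined at the self-dual part of `β`. -/
def chartDom (p : M) : Set (E4 × W2) :=
  {z | z.1 ∈ (extChartAt (𝓡 4) p).target ∧ bundleParam p (z.1, chartProj φ ι p z.1 z.2) ∈ T.U}

/-- The map `J` in the chart around `p`, extended to all `2`-forms by means of `chartProj`. -/
def chartMap (p : M) (z : E4 × W2) : Y :=
  T.J (bundleParam p (z.1, chartProj φ ι p z.1 z.2))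

variable {T}

theorem isOpen_chartDom (hφ : IsClosedG2Structure φ) (hι : IsCoassociativeImmersion φ ι) (p : M) :
    IsOpen (T.chartDom p) := by
  obtain ⟨O, hO, hU⟩ := T.isOpen
  have h1 : ContinuousOn (fun z : E4 × W2 => bundleParam p (z.1, chartProj φ ι p z.1 z.2))
      ((extChartAt (𝓡 4) p).target ×ˢ univ) :=
    (continuousOn_bundleParam p).comp
      (continuousOn_fst.prodMk (contDiffOn_chartProj_apply hφ hι p).continuousOn)
      fun z hz => ⟨hz.1, mem_univ _⟩
  have h2 := h1.isOpen_inter_preimage ((isOpen_extChartAt_target p).prod isOpen_univ) hO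
  convert! h2 using 1
  ext z
  constructor
  · rintro ⟨h, h'⟩
    rw [hU] at h'
    exact ⟨⟨h, mem_univ _⟩, h'.1⟩
  · rintro ⟨⟨h, -⟩, h'⟩
    refine ⟨h, ?_⟩
    rw [hU]
    exact ⟨h', ofChart_mem h (linearProj_mem _ _)⟩

theorem mem_chartDom_iff {p : M} {y : E4} (hy : y ∈ (extChartAt (𝓡 4) p).target)
    (σ : selfDualForms φ ι) : (y, inChart p (formOf σ) y) ∈ T.chartDom p ↔
      (⟨(extChartAt (𝓡 4) p).symm y, formOf σ _⟩ : TwoFormBundle M) ∈ T.U := by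
  rw [← bundleParam_inChart hy]
  simp only [chartDom, mem_ofPred_eq, chartProj_inChart, hy, true_and]

theorem convex_chartDom (p : M) (y : E4) : Convex ℝ {β | (y, β) ∈ T.chartDom p} := by
  intro β hβ γ hγ a b ha hb hab
  refine ⟨hβ.1, ?_⟩
  have h : bundleParam p (y, chartProj φ ι p y (a • β + b • γ)) =
      bundleMk ((extChartAt (𝓡 4) p).symm y) (a • ofChart p y (chartProj φ ι p y β) +
        b • ofChart p y (chartProj φ ι p y γ)) := by
    simp only [bundleParam, map_add, map_smul]
  exact (congrArg (· ∈ T.U) h).mpr (T.convex _ hβ.2 hγ.2 ha hb hab)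

theorem bundleParam_zero (p : M) (y : E4) :
    bundleParam p (y, 0) = ⟨(extChartAt (𝓡 4) p).symm y, 0⟩ :=
  congrArg (bundleMk ((extChartAt (𝓡 4) p).symm y)) (map_zero _)

theorem zero_mem_chartDom {p : M} {y : E4} (hy : y ∈ (extChartAt (𝓡 4) p).target) :
    (y, (0 : W2)) ∈ T.chartDom p := by
  refine ⟨hy, ?_⟩
  have h : bundleParam p (y, chartProj φ ι p y 0) = ⟨(extChartAt (𝓡 4) p).symm y, 0⟩ := by
    rw [map_zero, bundleParam_zero]
  exact h ▸ T.zero_mem _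

theorem smul_mem_chartDom {p : M} {y : E4} {β : W2} (h : (y, β) ∈ T.chartDom p) {t : ℝ}
    (ht : t ∈ Icc (0 : ℝ) 1) : (y, t • β) ∈ T.chartDom p := by
  have := T.convex_chartDom p y (zero_mem_chartDom h.1) h (sub_nonneg.2 ht.2) ht.1 (by ring)
  simpa using this

theorem chartMap_inChart {p : M} {y : E4} (hy : y ∈ (extChartAt (𝓡 4) p).target)
    (σ : selfDualForms φ ι) :
    T.chartMap p (y, inChart p (formOf σ) y) = T.map σ ((extChartAt (𝓡 4) p).symm y) := by
  rw [chartMap]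
  simp only [chartProj_inChart]
  rw [bundleParam_inChart hy]
  rfl

theorem contMDiffOn_chartMap (hφ : IsClosedG2Structure φ) (hι : IsCoassociativeImmersion φ ι)
    (p : M) : ContMDiffOn 𝓘(ℝ, E4 × W2) (𝓡 7) ∞ (T.chartMap p) (T.chartDom p) := by
  rintro ⟨y₀, β₀⟩ hz₀
  obtain ⟨V, s, N, hs, hN, hyN, hNt, hNV, hv, hli, hsp⟩ := exists_chart_frame hφ hι hz₀.1
  have hDo : IsOpen (T.chartDom p ∩ N ×ˢ univ) :=
    (isOpen_chartDom hφ hι p).inter (hN.prod isOpen_univ)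
  let c : E4 × W2 → EuclideanSpace ℝ (Fin 3) := fun z =>
    (EuclideanSpace.equiv (Fin 3) ℝ).symm (linearProjCoeff (fun i => inChart p (s i) z.1) z.2)
  have hc : ContDiffOn ℝ ∞ c (T.chartDom p ∩ N ×ˢ univ) := by
    refine (EuclideanSpace.equiv (Fin 3) ℝ).symm.contDiff.comp_contDiffOn ?_
    exact (((contDiffOn_linearProjCoeff hv hli).comp contDiffOn_fst
      fun z hz => hz.2.1).clm_apply contDiffOn_snd)
  have hb : ∀ z ∈ T.chartDom p ∩ N ×ˢ univ, bundleParam p (z.1, chartProj φ ι p z.1 z.2) =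
      frameParam s ((extChartAt (𝓡 4) p).symm z.1, c z) := by
    rintro ⟨y, β⟩ ⟨-, hy, -⟩
    have h1 : chartProj φ ι p y β =
        ∑ i, linearProjCoeff (fun i => inChart p (s i) y) β i • inChart p (s i) y := by
      rw [chartProj, ← hsp y hy, linearProj_span_eq (hli y hy)]
    have h2 : ofChart p y (chartProj φ ι p y β) = ∑ i,
        linearProjCoeff (fun i => inChart p (s i) y) β i •
          (s i).at ((extChartAt (𝓡 4) p).symm y) := by
      rw [h1, map_sum]
      refine Finset.sum_congr rfl fun i _ => ?_
      rw [map_smul, ofChart_inChart (hNt hy)]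
    exact congrArg (bundleMk ((extChartAt (𝓡 4) p).symm y)) h2
  have h1 : ContMDiffOn 𝓘(ℝ, E4 × W2) ((𝓡 4).prod (𝓡 3)) ∞
      (fun z : E4 × W2 => ((extChartAt (𝓡 4) p).symm z.1, c z)) (T.chartDom p ∩ N ×ˢ univ) := by
    refine ContMDiffOn.prodMk ?_ hc.contMDiffOn
    exact (contMDiffOn_chart_symm p).comp contDiffOn_fst.contMDiffOn fun z hz => hNt hz.2.1
  have h2 := (T.smooth V s hs).comp h1 fun z hz => ⟨hNV _ hz.2.1, by
    rw [← hb z hz]; exact hz.1.2⟩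
  have h3 : ContMDiffOn 𝓘(ℝ, E4 × W2) (𝓡 7) ∞ (T.chartMap p) (T.chartDom p ∩ N ×ˢ univ) :=
    h2.congr fun z hz => congrArg T.J (hb z hz)
  exact (h3.contMDiffAt (hDo.mem_nhds ⟨hz₀, hyN, mem_univ _⟩)).contMDiffWithinAt

variable (T) in
/-- The pull-back of `φ` under `J`, in the chart around `p`. -/
def chartForm (p : M) : E4 × W2 → (E4 × W2) [⋀^Fin 3]→L[ℝ] ℝ := pull (T.chartMap p) φ

theorem contDiffOn_chartForm (hφ : IsClosedG2Structure φ) (hι : IsCoassociativeImmersion φ ι)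
    (p : M) : ContDiffOn ℝ ∞ (T.chartForm p) (T.chartDom p) :=
  contDiffOn_pull hφ.smooth (isOpen_chartDom hφ hι p) (contMDiffOn_chartMap hφ hι p)

theorem extDeriv_chartForm (hφ : IsClosedG2Structure φ) (hι : IsCoassociativeImmersion φ ι)
    {p : M} {z : E4 × W2} (hz : z ∈ T.chartDom p) : extDeriv (T.chartForm p) z = 0 :=
  extDeriv_pull_eq_zero hφ.smooth hφ.closed (isOpen_chartDom hφ hι p)
    (contMDiffOn_chartMap hφ hι p) hz

theorem mdifferentiableAt_chartMap (hφ : IsClosedG2Structure φ)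
    (hι : IsCoassociativeImmersion φ ι) {p : M} {z : E4 × W2} (hz : z ∈ T.chartDom p) :
    MDifferentiableAt 𝓘(ℝ, E4 × W2) (𝓡 7) (T.chartMap p) z :=
  ((contMDiffOn_chartMap hφ hι p).contMDiffAt
    ((isOpen_chartDom hφ hι p).mem_nhds hz)).mdifferentiableAt (by simp)

end TubularNeighborhood

end Chart

/-! ### The homotopy formula -/

section Homotopy

variable {E : Type} [NormedAddCommGroup E] [NormedSpace ℝ E] [FiniteDimensional ℝ E] {k : ℕ}

theorem fderiv_clm_comp {X F G : Type*} [NormedAddCommGroup X] [NormedSpace ℝ X]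
    [NormedAddCommGroup F] [NormedSpace ℝ F] [NormedAddCommGroup G] [NormedSpace ℝ G]
    (L : F →L[ℝ] G) {f : X → F} {x : X} (hf : DifferentiableAt ℝ f x) :
    fderiv ℝ (fun z => L (f z)) x = L.comp (fderiv ℝ f x) :=
  (L.hasFDerivAt.comp x hf.hasFDerivAt).fderiv

theorem clm_integral {X F G : Type*} [NormedAddCommGroup X] [NormedSpace ℝ X]
    [NormedAddCommGroup F] [NormedSpace ℝ F] [CompleteSpace F]
    [NormedAddCommGroup G] [NormedSpace ℝ G] [CompleteSpace G] (A : F →L[ℝ] G) (P : X →L[ℝ] F)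
    {f : ℝ → X} (hf : ContinuousOn f (uIcc 0 1)) :
    A (∫ t in (0 : ℝ)..1, P (f t)) = ∫ t in (0 : ℝ)..1, A (P (f t)) :=
  (A.intervalIntegral_comp_comm (P.continuous.comp_continuousOn hf).intervalIntegrable).symm

/-- The contraction of a form on `ℝ × E` with the unit vector of `ℝ`, restricted to `E`. -/
def contractTime : ((ℝ × E) [⋀^Fin (k + 1)]→L[ℝ] ℝ) →L[ℝ] (E [⋀^Fin k]→L[ℝ] ℝ) :=
  LinearMap.toContinuousLinearMap
    { toFun := fun θ => (θ.curryLeft (1, 0)).compContinuousLinearMap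
        (ContinuousLinearMap.inr ℝ ℝ E)
      map_add' := fun _ _ => rfl
      map_smul' := fun _ _ => rfl }

/-- The restriction of a form on `ℝ × E` to `E`. -/
def restrictSpace : ((ℝ × E) [⋀^Fin k]→L[ℝ] ℝ) →L[ℝ] (E [⋀^Fin k]→L[ℝ] ℝ) :=
  ContinuousAlternatingMap.compContinuousLinearMapCLM (ContinuousLinearMap.inr ℝ ℝ E)

theorem restrictSpace_apply (θ : (ℝ × E) [⋀^Fin k]→L[ℝ] ℝ) (w : Fin k → E) :
    restrictSpace θ w = θ fun i => ((0, w i) : ℝ × E) := rfl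

/-- For a closed form on `ℝ × E`, the time derivative of its restriction to `E` is exact. -/
theorem alternatize_fderiv_contractTime {θ : ℝ × E → (ℝ × E) [⋀^Fin (k + 1)]→L[ℝ] ℝ} {z : ℝ × E}
    (hθ : DifferentiableAt ℝ θ z) (hd : extDeriv θ z = 0) :
    ContinuousAlternatingMap.alternatizeUncurryFin
      ((fderiv ℝ (fun z => contractTime (θ z)) z).comp (ContinuousLinearMap.inr ℝ ℝ E)) =
      restrictSpace (fderiv ℝ θ z (1, 0)) := by
  have h1 : fderiv ℝ (fun z => contractTime (θ z)) z = contractTime.comp (fderiv ℝ θ z) :=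
    fderiv_clm_comp contractTime hθ
  ext v
  have h2 := DFunLike.congr_fun hd (Fin.cons ((1, 0) : ℝ × E) fun i => ((0, v i) : ℝ × E))
  rw [extDeriv, ContinuousAlternatingMap.alternatizeUncurryFin_apply, Fin.sum_univ_succ] at h2
  rw [ContinuousAlternatingMap.alternatizeUncurryFin_apply, h1, restrictSpace_apply]
  have h3 : ∀ j : Fin (k + 1), j.succ.removeNth
      (Fin.cons ((1, 0) : ℝ × E) fun i => ((0, v i) : ℝ × E) : Fin (k + 2) → ℝ × E) =
      Fin.cons ((1, 0) : ℝ × E) fun i => ((0, j.removeNth v i) : ℝ × E) := by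
    intro j
    funext i
    refine Fin.cases ?_ (fun l => ?_) i
    · simp [Fin.removeNth]
    · simp [Fin.removeNth]
  have h4 : (0 : Fin (k + 2)).removeNth
      (Fin.cons ((1, 0) : ℝ × E) fun i => ((0, v i) : ℝ × E) : Fin (k + 2) → ℝ × E) =
      fun i => ((0, v i) : ℝ × E) := by
    funext i
    simp [Fin.removeNth]
  simp only [h3, h4, Fin.cons_zero, Fin.cons_succ, Fin.val_zero, pow_zero, one_smul,
    Fin.val_succ, pow_succ, mul_neg, mul_one, neg_smul, Finset.sum_neg_distrib] at h2
  have h5 := (eq_neg_of_add_eq_zero_left h2).trans (neg_neg _)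
  rw [h5]
  rfl

/-- The homotopy formula for closed forms on `[0, 1] × E`. -/
theorem extDeriv_integral_contractTime {O : Set (ℝ × E)} (hO : IsOpen O)
    {θ : ℝ × E → (ℝ × E) [⋀^Fin (k + 1)]→L[ℝ] ℝ} (hθ : ContDiffOn ℝ ∞ θ O)
    (hd : ∀ z ∈ O, extDeriv θ z = 0) {y : E} (hy : ∀ t ∈ Icc (0 : ℝ) 1, (t, y) ∈ O) :
    extDeriv (fun y => ∫ t in (0 : ℝ)..1, contractTime (θ (t, y))) y =
      restrictSpace (θ (1, y)) - restrictSpace (θ (0, y)) := by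
  have hg : ContDiffOn ℝ ∞ (fun z => contractTime (θ z)) O := 
    (contractTime (k := k) (E := E)).contDiff.comp_contDiffOn hθ
  have hcd : ContinuousOn (fderiv ℝ (fun z => contractTime (θ z))) O :=
    (hg.fderiv_of_isOpen hO (m := ∞) (by simp)).continuousOn
  have hty : ContinuousOn (fun t : ℝ => (t, y)) (uIcc 0 1) :=
    (continuous_id.prodMk continuous_const).continuousOn
  have hmaps : MapsTo (fun t : ℝ => (t, y)) (uIcc 0 1) O := fun t ht => by
    rw [uIcc_of_le zero_le_one] at ht
    exact hy t ht
  have h1 := (hasFDerivAt_integral_param hO hg hy).fderiv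
  let A := ContinuousAlternatingMap.alternatizeUncurryFinCLM ℝ E ℝ (n := k)
  let P : (ℝ × E →L[ℝ] (E [⋀^Fin k]→L[ℝ] ℝ)) →L[ℝ] (E →L[ℝ] (E [⋀^Fin k]→L[ℝ] ℝ)) :=
    (ContinuousLinearMap.compL ℝ E (ℝ × E) (E [⋀^Fin k]→L[ℝ] ℝ)).flip
      (ContinuousLinearMap.inr ℝ ℝ E)
  have h2 : extDeriv (fun y => ∫ t in (0 : ℝ)..1, contractTime (θ (t, y))) y =
      ∫ t in (0 : ℝ)..1, A (P (fderiv ℝ (fun z => contractTime (θ z)) (t, y))) := by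
    rw [extDeriv, h1]
    exact clm_integral (X := ℝ × E →L[ℝ] (E [⋀^Fin k]→L[ℝ] ℝ)) (F := E →L[ℝ] (E [⋀^Fin k]→L[ℝ] ℝ))
      (G := E [⋀^Fin (k + 1)]→L[ℝ] ℝ) A P (hcd.comp hty hmaps)
  have hθd : ∀ t ∈ uIcc (0 : ℝ) 1, DifferentiableAt ℝ θ (t, y) := fun t ht =>
    (hθ.differentiableOn (by simp)).differentiableAt (hO.mem_nhds (hmaps ht))
  have h3 : ∫ t in (0 : ℝ)..1, A (P (fderiv ℝ (fun z => contractTime (θ z)) (t, y))) =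
      ∫ t in (0 : ℝ)..1, restrictSpace (fderiv ℝ θ (t, y) (1, 0)) :=
    intervalIntegral.integral_congr fun t ht =>
      alternatize_fderiv_contractTime (hθd t ht) (hd _ (hmaps ht))
  have h4 : ∀ t ∈ uIcc (0 : ℝ) 1, HasDerivAt (fun t : ℝ => restrictSpace (θ (t, y)))
      (restrictSpace (fderiv ℝ θ (t, y) (1, 0))) t := fun t ht => by
    have h5 : HasDerivAt (fun t : ℝ => (t, y)) ((1 : ℝ), (0 : E)) t :=
      (hasDerivAt_id t).prodMk (hasDerivAt_const t y)
    exact (restrictSpace (k := k + 1) (E := E)).hasFDerivAt.comp_hasDerivAt t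
      ((hθd t ht).hasFDerivAt.comp_hasDerivAt t h5)
  have hcθ : ContinuousOn (fderiv ℝ θ) O :=
    (hθ.fderiv_of_isOpen hO (m := ∞) (by simp)).continuousOn
  have h6 : ContinuousOn (fun t : ℝ => restrictSpace (fderiv ℝ θ (t, y) (1, 0))) (uIcc 0 1) :=
    (restrictSpace (k := k + 1) (E := E)).continuous.comp_continuousOn
      ((hcθ.comp hty hmaps).clm_apply continuousOn_const)
  rw [h2, h3, intervalIntegral.integral_eq_sub_of_hasDerivAt h4 h6.intervalIntegrable]

end Homotopy

/-! ### Generalities on `1`-jets -/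

section Jets

variable {E W A : Type} [NormedAddCommGroup E] [NormedSpace ℝ E]
  [NormedAddCommGroup W] [NormedSpace ℝ W] [NormedAddCommGroup A] [NormedSpace ℝ A]

theorem contDiff_smul_snd_snd_snd :
    ContDiff ℝ ∞ (fun z : ℝ × (E × (W × A)) => z.1 • z.2.2.2) :=
  contDiff_fst.smul (contDiff_snd.comp (contDiff_snd.comp contDiff_snd))

theorem contDiffOn_integral_sub [FiniteDimensional ℝ E] [FiniteDimensional ℝ W]
    [FiniteDimensional ℝ A] {O : Set (ℝ × (E × (W × A)))} (hO : IsOpen O)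
    {g : ℝ × (E × (W × A)) → W} (hg : ContDiffOn ℝ ∞ g O) {S : Set (E × (W × A))}
    (hS : ∀ z ∈ S, ∀ t ∈ Icc (0 : ℝ) 1, (t, z) ∈ O) :
    ContDiffOn ℝ ∞ (fun z => (∫ t in (0 : ℝ)..1, g (t, z)) - z.2.1) S := by
  have : CompleteSpace W := FiniteDimensional.complete ℝ W
  exact ((contDiffOn_integral_param hO hg).mono hS).sub
    (contDiff_fst.comp contDiff_snd).contDiffOn

/-- The `1`-jet of `f`. -/
def jet (f : E → W) (y : E) : W × (E →L[ℝ] W) := (f y, fderiv ℝ f y)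

theorem contDiffOn_jet {f : E → W} {V : Set E} (hV : IsOpen V) (hf : ContDiffOn ℝ ∞ f V) :
    ContDiffOn ℝ ∞ (jet f) V :=
  hf.prodMk (hf.fderiv_of_isOpen hV (by simp))

theorem finiteDimensional_jet [FiniteDimensional ℝ E] [FiniteDimensional ℝ W] :
    FiniteDimensional ℝ (W × (E →L[ℝ] W)) := inferInstance

end Jets

/-! ### The pull-back of `φ` and its primitive -/

section Primitive

local notation "E4" => EuclideanSpace ℝ (Fin 4)
local notation "W2" => EuclideanSpace ℝ (Fin 4) [⋀^Fin 2]→L[ℝ] ℝ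

/-- The space of `1`-jets of `2`-forms on `ℝ⁴`. It is a type of its own, which keeps the unifier
from unfolding its instances. -/
def FormJet : Type := W2 × (E4 →L[ℝ] W2)

instance : NormedAddCommGroup FormJet :=
  inferInstanceAs (NormedAddCommGroup (W2 × (E4 →L[ℝ] W2)))

instance : NormedSpace ℝ FormJet := inferInstanceAs (NormedSpace ℝ (W2 × (E4 →L[ℝ] W2)))

instance : FiniteDimensional ℝ FormJet := @finiteDimensional_jet E4 W2 _ _ _ _ _ _

variable {M Y : Type*}
  [TopologicalSpace M] [ChartedSpace (EuclideanSpace ℝ (Fin 4)) M] [IsManifold (𝓡 4) ∞ M]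
  [TopologicalSpace Y] [ChartedSpace (EuclideanSpace ℝ (Fin 7)) Y] [IsManifold (𝓡 7) ∞ Y]
  {φ : RawForm 7 3 Y} {ι : M → Y}

theorem contDiffOn_formOf (σ : selfDualForms φ ι) (p : M) :
    ContDiffOn ℝ ∞ (inChart p (formOf σ)) (extChartAt (𝓡 4) p).target :=
  σ.1.smooth.contDiffOn p

theorem differentiableAt_formOf (σ : selfDualForms φ ι) {p : M} {y : E4}
    (hy : y ∈ (extChartAt (𝓡 4) p).target) : DifferentiableAt ℝ (inChart p (formOf σ)) y :=
  ((contDiffOn_formOf σ p).differentiableOn (by simp)).differentiableAt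
    ((isOpen_extChartAt_target p).mem_nhds hy)

/-- The differential of the graph `y ↦ (y, f y)`, if `B` is the differential of `f`. -/
abbrev graphDiff (B : E4 →L[ℝ] W2) : E4 →L[ℝ] E4 × W2 :=
  (ContinuousLinearMap.id ℝ E4).prod B

theorem graphDiff_eq (B : E4 →L[ℝ] W2) :
    graphDiff B = graphDiff 0 + (ContinuousLinearMap.inr ℝ E4 W2).comp B := by
  ext1 v
  simp

theorem contDiff_graphDiff : ContDiff ℝ ∞ (graphDiff : (E4 →L[ℝ] W2) → E4 →L[ℝ] E4 × W2) := by
  rw [funext graphDiff_eq]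
  exact contDiff_const.add (contDiff_const.clm_comp contDiff_id)

/-- The `1`-jet of a self-dual form in a chart. -/
def formJet (σ : selfDualForms φ ι) (p : M) (y : E4) : FormJet := jet (inChart p (formOf σ)) y

theorem contDiffOn_formJet (σ : selfDualForms φ ι) (p : M) :
    ContDiffOn ℝ ∞ (formJet σ p) (extChartAt (𝓡 4) p).target := by
  have h := @contDiffOn_jet E4 W2 _ _ _ _ _ _ (isOpen_extChartAt_target p) (contDiffOn_formOf σ p)
  exact h

theorem formJet_add_smul (σ v : selfDualForms φ ι) {p : M} {y : E4}
    (hy : y ∈ (extChartAt (𝓡 4) p).target) (t : ℝ) :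
    formJet (σ + t • v) p y = formJet σ p y + t • formJet v p y := by
  have h1 := (differentiableAt_formOf σ hy).hasFDerivAt.add
    ((differentiableAt_formOf v hy).hasFDerivAt.const_smul t)
  exact Prod.ext rfl h1.fderiv

namespace TubularNeighborhood

variable {T : TubularNeighborhood φ ι}

theorem map_comp_eventuallyEq (σ : selfDualForms φ ι) {p : M} {y : E4}
    (hy : y ∈ (extChartAt (𝓡 4) p).target) :
    T.map σ ∘ (extChartAt (𝓡 4) p).symm =ᶠ[𝓝 y]
      T.chartMap p ∘ fun z => (z, inChart p (formOf σ) z) := by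
  filter_upwards [(isOpen_extChartAt_target p).mem_nhds hy] with z hz
  exact (chartMap_inChart hz σ).symm

theorem hasFDerivAt_graph (σ : selfDualForms φ ι) {p : M} {y : E4}
    (hy : y ∈ (extChartAt (𝓡 4) p).target) :
    HasFDerivAt (fun z => (z, inChart p (formOf σ) z))
      (graphDiff (fderiv ℝ (inChart p (formOf σ)) y)) y :=
  (hasFDerivAt_id y).prodMk (differentiableAt_formOf σ hy).hasFDerivAt

theorem mdifferentiableAt_map (hφ : IsClosedG2Structure φ) (hι : IsCoassociativeImmersion φ ι)
    (σ : selfDualForms φ ι) {p : M} {y : E4} (hy : y ∈ (extChartAt (𝓡 4) p).target)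
    (h : (y, inChart p (formOf σ) y) ∈ T.chartDom p) :
    MDifferentiableAt (𝓡 4) (𝓡 7) (T.map σ) ((extChartAt (𝓡 4) p).symm y) := by
  have h1 : MDifferentiableAt 𝓘(ℝ, E4) (𝓡 7) (T.map σ ∘ (extChartAt (𝓡 4) p).symm) y := by
    refine MDifferentiableAt.congr_of_eventuallyEq ?_ (map_comp_eventuallyEq σ hy)
    exact (mdifferentiableAt_chartMap hφ hι h).comp y
      (hasFDerivAt_graph σ hy).differentiableAt.mdifferentiableAt
  have hx := (extChartAt (𝓡 4) p).map_target hy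
  have h2 : MDifferentiableAt (𝓡 4) (𝓡 7)
      ((T.map σ ∘ (extChartAt (𝓡 4) p).symm) ∘ extChartAt (𝓡 4) p)
      ((extChartAt (𝓡 4) p).symm y) := by
    refine MDifferentiableAt.comp (I' := 𝓘(ℝ, E4)) _ ?_ (mdifferentiableAt_chart hx)
    rwa [(extChartAt (𝓡 4) p).right_inv hy]
  refine h2.congr_of_eventuallyEq ?_
  filter_upwards [(isOpen_extChartAt_source p).mem_nhds hx] with z hz
  exact congrArg (T.map σ) ((extChartAt (𝓡 4) p).left_inv hz).symm

theorem diffFrom_map (hφ : IsClosedG2Structure φ) (hι : IsCoassociativeImmersion φ ι)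
    (σ : selfDualForms φ ι) {p : M} {y : E4} (hy : y ∈ (extChartAt (𝓡 4) p).target)
    (h : (y, inChart p (formOf σ) y) ∈ T.chartDom p) :
    (diffAt (n := 4) (m := 7) (T.map σ) ((extChartAt (𝓡 4) p).symm y)).comp (chartSymmDiff p y) =
      (diffFrom (m := 7) (T.chartMap p) (y, inChart p (formOf σ) y)).comp
        (graphDiff (fderiv ℝ (inChart p (formOf σ)) y)) := by
  have h1 := mfderiv_comp y (mdifferentiableAt_map hφ hι σ hy h) (mdifferentiableAt_chart_symm hy)
  have h2 := mfderiv_comp y (f := fun z => (z, inChart p (formOf σ) z))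
    (mdifferentiableAt_chartMap hφ hι h) (hasFDerivAt_graph σ hy).differentiableAt.mdifferentiableAt
  rw [(map_comp_eventuallyEq σ hy).mfderiv_eq] at h1
  rw [mfderiv_eq_fderiv, (hasFDerivAt_graph σ hy).fderiv] at h2
  exact h1.symm.trans h2

/-- The representative of `F(σ)` in a chart. -/
theorem inChart_F (hφ : IsClosedG2Structure φ) (hι : IsCoassociativeImmersion φ ι)
    (σ : selfDualForms φ ι) {p : M} {y : E4} (hy : y ∈ (extChartAt (𝓡 4) p).target)
    (h : (y, inChart p (formOf σ) y) ∈ T.chartDom p) :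
    inChart p (T.F σ) y = (T.chartForm p (y, inChart p (formOf σ) y)).compContinuousLinearMap
      (graphDiff (fderiv ℝ (inChart p (formOf σ)) y)) := by
  have h1 := diffFrom_map hφ hι σ hy h
  change ((φ.at (T.map σ ((extChartAt (𝓡 4) p).symm y))).compContinuousLinearMap
    (diffAt (T.map σ) _)).compContinuousLinearMap (chartSymmDiff p y) = _
  rw [compContinuousLinearMap_comp, h1, chartForm, pull, compContinuousLinearMap_comp,
    chartMap_inChart hy]

/-- The integrand of the homotopy operator along the path `t ↦ J (t σ)`. -/
def primitiveIntegrand (T : TubularNeighborhood φ ι) (σ : selfDualForms φ ι) (t : ℝ) (x : M) :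
    W2 :=
  ((φ.at (T.map (t • σ) x)).curryLeft
    (diffFrom (m := 7) (fun s : ℝ => T.map (s • σ) x) t 1)).compContinuousLinearMap
      (diffAt (T.map (t • σ)) x)

/-- The chart representative of `primitiveIntegrand`, as a function of time and of the `1`-jet. -/
def chartIntegrand (T : TubularNeighborhood φ ι) (p : M)
    (z : ℝ × (E4 × (W2 × (E4 →L[ℝ] W2)))) : W2 :=
  ((T.chartForm p (z.2.1, z.1 • z.2.2.1)).curryLeft (0, z.2.2.1)).compContinuousLinearMap
    (graphDiff (z.1 • z.2.2.2))

theorem toChart_primitiveIntegrand (hφ : IsClosedG2Structure φ)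
    (hι : IsCoassociativeImmersion φ ι) (σ : selfDualForms φ ι) {p : M} {y : E4} {t : ℝ}
    (hy : y ∈ (extChartAt (𝓡 4) p).target)
    (h : (y, t • inChart p (formOf σ) y) ∈ T.chartDom p) :
    toChart p y (T.primitiveIntegrand σ t ((extChartAt (𝓡 4) p).symm y)) =
      T.chartIntegrand p (t, (y, (inChart p (formOf σ) y, fderiv ℝ (inChart p (formOf σ)) y))) := by
  set β := inChart p (formOf σ) y with hβ
  have hline : HasFDerivAt (fun s : ℝ => (y, s • β))
      ((0 : ℝ →L[ℝ] E4).prod (ContinuousLinearMap.toSpanSingleton ℝ β)) t := by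
    refine (hasFDerivAt_const y t).prodMk ?_
    exact (ContinuousLinearMap.toSpanSingleton ℝ β).hasFDerivAt
  have h1 : diffFrom (m := 7) (fun s : ℝ => T.map (s • σ) ((extChartAt (𝓡 4) p).symm y)) t 1 =
      diffFrom (m := 7) (T.chartMap p) (y, t • β) (0, β) := by
    have h2 : (fun s : ℝ => T.map (s • σ) ((extChartAt (𝓡 4) p).symm y)) =
        T.chartMap p ∘ fun s : ℝ => (y, s • β) :=
      funext fun s => (chartMap_inChart hy (s • σ)).symm
    have h3 := mfderiv_comp t (f := fun s : ℝ => (y, s • β))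
      (mdifferentiableAt_chartMap hφ hι h) hline.differentiableAt.mdifferentiableAt
    rw [mfderiv_eq_fderiv, hline.fderiv] at h3
    rw [h2]
    refine (DFunLike.congr_fun h3 (1 : ℝ)).trans ?_
    change diffFrom (m := 7) (T.chartMap p) (y, t • β) (0, (1 : ℝ) • β) = _
    rw [one_smul]
  have h2 := diffFrom_map hφ hι (t • σ) hy h
  have h3 : fderiv ℝ (inChart p (formOf (t • σ))) y = t • fderiv ℝ (inChart p (formOf σ)) y :=
    fderiv_const_smul (differentiableAt_formOf σ hy) t
  rw [h3] at h2
  change ((φ.at _).curryLeft _).compContinuousLinearMap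
    ((diffAt (T.map (t • σ)) _).comp (chartSymmDiff p y)) = _
  rw [h2, h1, ← chartMap_inChart hy]
  ext v
  change φ.at (T.chartMap p (y, t • β)) _ = φ.at (T.chartMap p (y, t • β)) (fun i => _)
  congr 1
  funext i
  refine Fin.cases ?_ (fun j => ?_) i
  · rfl
  · rfl

/-- The domain of `chartIntegrand`. -/
def integrandDom (T : TubularNeighborhood φ ι) (p : M) :
    Set (ℝ × (E4 × (W2 × (E4 →L[ℝ] W2)))) :=
  (fun z => (z.2.1, z.1 • z.2.2.1)) ⁻¹' T.chartDom p

theorem isOpen_integrandDom (hφ : IsClosedG2Structure φ) (hι : IsCoassociativeImmersion φ ι)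
    (p : M) : IsOpen (T.integrandDom p) :=
  (isOpen_chartDom hφ hι p).preimage (by fun_prop)

theorem contDiffOn_chartIntegrand (hφ : IsClosedG2Structure φ)
    (hι : IsCoassociativeImmersion φ ι) (p : M) :
    ContDiffOn ℝ ∞ (T.chartIntegrand p) (T.integrandDom p) := by
  refine contDiffOn_contract ?_ ?_ ?_
  · exact (contDiffOn_chartForm hφ hι p).comp
      (ContDiff.contDiffOn (by fun_prop)) fun z hz => hz
  · exact ContDiff.contDiffOn (by fun_prop)
  · have h1 : ContDiff ℝ ∞ (fun z : ℝ × (E4 × (W2 × (E4 →L[ℝ] W2))) => z.1 • z.2.2.2) :=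
      contDiff_smul_snd_snd_snd (E := E4) (W := W2) (A := E4 →L[ℝ] W2)
    exact (contDiff_graphDiff.comp h1).contDiffOn

/-- The chart representative of `T.primitive`, as a function of the `1`-jet. -/
def chartPrimitive (T : TubularNeighborhood φ ι) (p : M) (z : E4 × FormJet) : W2 :=
  (∫ t in (0 : ℝ)..1, T.chartIntegrand p (t, z)) - z.2.1

/-- The domain of `chartPrimitive`. -/
def jetDom (T : TubularNeighborhood φ ι) (p : M) : Set (E4 × FormJet) :=
  {z | (z.1, z.2.1) ∈ T.chartDom p}

theorem isOpen_jetDom (hφ : IsClosedG2Structure φ) (hι : IsCoassociativeImmersion φ ι)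
    (p : M) : IsOpen (T.jetDom p) := by
  have h : Continuous fun z : E4 × (W2 × (E4 →L[ℝ] W2)) => (z.1, z.2.1) := by fun_prop
  exact (isOpen_chartDom hφ hι p).preimage h

theorem contDiffOn_chartPrimitive (hφ : IsClosedG2Structure φ)
    (hι : IsCoassociativeImmersion φ ι) (p : M) :
    ContDiffOn ℝ ∞ (T.chartPrimitive p) (T.jetDom p) := by
  have h1 := contDiffOn_chartIntegrand (T := T) hφ hι p
  have h2 := isOpen_integrandDom (T := T) hφ hι p
  have h3 : ∀ z ∈ T.jetDom p, ∀ t ∈ Icc (0 : ℝ) 1, (t, z) ∈ T.integrandDom p :=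
    fun z hz t ht => smul_mem_chartDom hz ht
  have h0 := @contDiffOn_integral_sub E4 W2 (E4 →L[ℝ] W2) _ _ _ _ _ _ inferInstance
    inferInstance inferInstance
  exact h0 h2 h1 h3

/-- A form `A σ` such that `d (A σ) = F(σ) - d σ`, see `extD_primitive`. -/
def primitive (T : TubularNeighborhood φ ι) (σ : selfDualForms φ ι) : RawForm 4 2 M :=
  fun x => (∫ t in (0 : ℝ)..1, T.primitiveIntegrand σ t x) - (formOf σ).at x

theorem inChart_primitive (hφ : IsClosedG2Structure φ) (hι : IsCoassociativeImmersion φ ι)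
    (σ : selfDualForms φ ι) {p : M} {y : E4} (hy : y ∈ (extChartAt (𝓡 4) p).target)
    (h : (y, inChart p (formOf σ) y) ∈ T.chartDom p) :
    inChart p (T.primitive σ) y =
      T.chartPrimitive p (y, formJet σ p y) := by
  let ξ := (inChart p (formOf σ) y, fderiv ℝ (inChart p (formOf σ)) y)
  have h1 : ∀ t ∈ uIcc (0 : ℝ) 1, T.primitiveIntegrand σ t ((extChartAt (𝓡 4) p).symm y) =
      ofChart p y (T.chartIntegrand p (t, (y, ξ))) := fun t ht => by
    rw [uIcc_of_le zero_le_one] at ht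
    rw [← toChart_primitiveIntegrand hφ hι σ hy (smul_mem_chartDom h ht), ofChart_toChart hy]
  have h2 : ContinuousOn (fun t => T.chartIntegrand p (t, (y, ξ))) (uIcc 0 1) := by
    refine (contDiffOn_chartIntegrand hφ hι p).continuousOn.comp
      (continuous_id.prodMk continuous_const).continuousOn fun t ht => ?_
    rw [uIcc_of_le zero_le_one] at ht
    exact smul_mem_chartDom h ht
  have h3 : ∫ t in (0 : ℝ)..1, T.primitiveIntegrand σ t ((extChartAt (𝓡 4) p).symm y) =
      ofChart p y (∫ t in (0 : ℝ)..1, T.chartIntegrand p (t, (y, ξ))) := by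
    rw [intervalIntegral.integral_congr h1]
    exact (clm_integral (ofChart p y) (ContinuousLinearMap.id ℝ W2) h2).symm
  have h4 : (T.primitive σ).at ((extChartAt (𝓡 4) p).symm y) =
      ofChart p y (∫ t in (0 : ℝ)..1, T.chartIntegrand p (t, (y, ξ))) -
        (formOf σ).at ((extChartAt (𝓡 4) p).symm y) := by
    rw [← h3]; rfl
  rw [← toChart_at, h4, map_sub, toChart_ofChart hy, toChart_at]
  rfl

theorem map_zero_section : T.map (0 : selfDualForms φ ι) = ι := funext T.zero_section

theorem chartForm_zero_section (hφ : IsClosedG2Structure φ) (hι : IsCoassociativeImmersion φ ι)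
    {p : M} {y : E4} (hy : y ∈ (extChartAt (𝓡 4) p).target) :
    (T.chartForm p (y, 0)).compContinuousLinearMap (graphDiff 0) = 0 := by
  have h0 : inChart p (formOf (0 : selfDualForms φ ι)) = 0 := rfl
  have h1 := inChart_F (T := T) hφ hι (0 : selfDualForms φ ι) hy
    (by rw [h0]; exact zero_mem_chartDom hy)
  have h2 : (T.F (0 : selfDualForms φ ι)).at ((extChartAt (𝓡 4) p).symm y) = 0 := by
    rw [F, map_zero_section]
    exact hι.pullback_eq_zero _
  rw [← toChart_at, h2, map_zero, h0] at h1
  rw [h1]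
  congr 2
  exact (fderiv_const_apply (0 : W2)).symm

/-- The family `t ↦ t • f` of graphs, as a function of `(t, y)`. -/
def timeGraph (f : E4 → W2) (z : ℝ × E4) : E4 × W2 := (z.2, z.1 • f z.2)

/-- The domain of `timeForm`. -/
def timeDom (T : TubularNeighborhood φ ι) (p : M) (f : E4 → W2) : Set (ℝ × E4) :=
  {z | z.2 ∈ (extChartAt (𝓡 4) p).target} ∩ timeGraph f ⁻¹' T.chartDom p

/-- The pull-back of `φ` to `ℝ × ℝ⁴` under the family of maps to `Y` given by the sections
`t • f`. -/
def timeForm (T : TubularNeighborhood φ ι) (p : M) (f : E4 → W2) (z : ℝ × E4) :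
    (ℝ × E4) [⋀^Fin 3]→L[ℝ] ℝ :=
  (T.chartForm p (timeGraph f z)).compContinuousLinearMap (fderiv ℝ (timeGraph f) z)

section TimeForm

variable {p : M} {f : E4 → W2}

theorem contDiffOn_timeGraph (hf : ContDiffOn ℝ ∞ f (extChartAt (𝓡 4) p).target) :
    ContDiffOn ℝ ∞ (timeGraph f) {z : ℝ × E4 | z.2 ∈ (extChartAt (𝓡 4) p).target} :=
  contDiffOn_snd.prodMk (contDiffOn_fst.smul (hf.comp contDiffOn_snd fun _ hz => hz))

theorem isOpen_timeDom (hφ : IsClosedG2Structure φ) (hι : IsCoassociativeImmersion φ ι)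
    (hf : ContDiffOn ℝ ∞ f (extChartAt (𝓡 4) p).target) : IsOpen (T.timeDom p f) :=
  (contDiffOn_timeGraph hf).continuousOn.isOpen_inter_preimage
    ((isOpen_extChartAt_target p).preimage continuous_snd) (isOpen_chartDom hφ hι p)

theorem contDiffOn_timeForm (hφ : IsClosedG2Structure φ) (hι : IsCoassociativeImmersion φ ι)
    (hf : ContDiffOn ℝ ∞ f (extChartAt (𝓡 4) p).target) :
    ContDiffOn ℝ ∞ (T.timeForm p f) (T.timeDom p f) := by
  have hk : ContDiffOn ℝ ∞ (timeGraph f) (T.timeDom p f) :=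
    (contDiffOn_timeGraph hf).mono inter_subset_left
  exact contDiffOn_alternating_comp
    ((contDiffOn_chartForm hφ hι p).comp hk fun z hz => hz.2)
    (hk.fderiv_of_isOpen (isOpen_timeDom hφ hι hf) (by simp))

theorem extDeriv_timeForm (hφ : IsClosedG2Structure φ) (hι : IsCoassociativeImmersion φ ι)
    (hf : ContDiffOn ℝ ∞ f (extChartAt (𝓡 4) p).target) {z : ℝ × E4} (hz : z ∈ T.timeDom p f) :
    extDeriv (T.timeForm p f) z = 0 := by
  have h1 := extDeriv_pullback (r := ∞) (x := z) (f := timeGraph f)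
    (((contDiffOn_chartForm hφ hι p).differentiableOn (by simp)).differentiableAt
      ((isOpen_chartDom hφ hι p).mem_nhds hz.2))
    (((contDiffOn_timeGraph hf).mono inter_subset_left).contDiffAt
      ((isOpen_timeDom hφ hι hf).mem_nhds hz))
    (by simpa using ENat.LEInfty.out)
  refine h1.trans ?_
  rw [extDeriv_chartForm hφ hι hz.2]
  rfl

theorem fderiv_timeGraph {y : E4} (hf : DifferentiableAt ℝ f y) (t s : ℝ) (a : E4) :
    fderiv ℝ (timeGraph f) (t, y) (s, a) = (a, s • f y + t • fderiv ℝ f y a) := by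
  have h1 : HasFDerivAt f (fderiv ℝ f y) ((t, y) : ℝ × E4).2 := hf.hasFDerivAt
  have h2 := h1.comp (t, y) (hasFDerivAt_snd (𝕜 := ℝ) (p := (t, y)))
  have h3 := (hasFDerivAt_snd (𝕜 := ℝ) (p := (t, y))).prodMk
    ((hasFDerivAt_fst (𝕜 := ℝ) (p := (t, y))).smul h2)
  have h4 : fderiv ℝ (timeGraph f) (t, y) = _ := h3.fderiv
  rw [h4]
  simp [add_comm]

theorem contractTime_timeForm {y : E4} (hf : DifferentiableAt ℝ f y) (t : ℝ) :
    contractTime (T.timeForm p f (t, y)) = T.chartIntegrand p (t, (y, (f y, fderiv ℝ f y))) := by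
  ext v
  change T.chartForm p (timeGraph f (t, y)) (fun i => fderiv ℝ (timeGraph f) (t, y) _) =
    T.chartForm p (timeGraph f (t, y)) _
  congr 1
  funext i
  refine Fin.cases ?_ (fun j => ?_) i
  · refine (fderiv_timeGraph hf t 1 0).trans ?_
    simp
  · refine (fderiv_timeGraph hf t 0 (v j)).trans ?_
    simp

theorem restrictSpace_timeForm {y : E4} (hf : DifferentiableAt ℝ f y) (t : ℝ) :
    restrictSpace (T.timeForm p f (t, y)) =
      (T.chartForm p (y, t • f y)).compContinuousLinearMap (graphDiff (t • fderiv ℝ f y)) := by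
  ext v
  change T.chartForm p (timeGraph f (t, y)) (fun i => fderiv ℝ (timeGraph f) (t, y) (0, v i)) =
    T.chartForm p (timeGraph f (t, y)) _
  congr 1
  funext i
  refine (fderiv_timeGraph hf t 0 (v i)).trans ?_
  simp

end TimeForm

/-- The homotopy formula in a chart. The contribution of `t = 0` vanishes, because `ι^* φ = 0`. -/
theorem extDeriv_inChart_primitive (hφ : IsClosedG2Structure φ)
    (hι : IsCoassociativeImmersion φ ι) (σ : selfDualForms φ ι) (hσ : σ ∈ T.sections) {p : M}
    {y : E4} (hy : y ∈ (extChartAt (𝓡 4) p).target) :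
    extDeriv (inChart p (T.primitive σ)) y =
      inChart p (T.F σ) y - extDeriv (inChart p (formOf σ)) y := by
  set f := inChart p (formOf σ) with hf
  have hfs : ContDiffOn ℝ ∞ f (extChartAt (𝓡 4) p).target := contDiffOn_formOf σ p
  have hfd : ∀ z ∈ (extChartAt (𝓡 4) p).target, DifferentiableAt ℝ f z :=
    fun z hz => differentiableAt_formOf σ hz
  have hmem : ∀ z ∈ (extChartAt (𝓡 4) p).target, (z, f z) ∈ T.chartDom p := fun z hz =>
    (mem_chartDom_iff hz σ).2 (hσ _)
  have hO : IsOpen (T.timeDom p f) := isOpen_timeDom hφ hι hfs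
  have hθ : ContDiffOn ℝ ∞ (T.timeForm p f) (T.timeDom p f) := contDiffOn_timeForm hφ hι hfs
  have hyO : ∀ t ∈ Icc (0 : ℝ) 1, (t, y) ∈ T.timeDom p f :=
    fun t ht => ⟨hy, smul_mem_chartDom (hmem y hy) ht⟩
  have hev : inChart p (T.primitive σ) =ᶠ[𝓝 y]
      (fun z => ∫ t in (0 : ℝ)..1, contractTime (T.timeForm p f (t, z))) + (-1 : ℝ) • f := by
    filter_upwards [(isOpen_extChartAt_target p).mem_nhds hy] with z hz
    have h1 : ∫ t in (0 : ℝ)..1, contractTime (T.timeForm p f (t, z)) =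
        ∫ t in (0 : ℝ)..1, T.chartIntegrand p (t, (z, (f z, fderiv ℝ f z))) :=
      intervalIntegral.integral_congr fun t _ => contractTime_timeForm (hfd z hz) t
    have h2 : (-1 : ℝ) • f z = -f z := neg_one_smul ℝ (f z)
    rw [inChart_primitive hφ hι σ hz (hmem z hz), chartPrimitive, Pi.add_apply, Pi.smul_apply,
      h1, h2, ← sub_eq_add_neg]
    rfl
  have hI : DifferentiableAt ℝ
      (fun z => ∫ t in (0 : ℝ)..1, contractTime (T.timeForm p f (t, z))) y :=
    (hasFDerivAt_integral_param (X := E4) (F := W2) hO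
      ((contractTime (k := 2) (E := E4)).contDiff.comp_contDiffOn hθ) hyO).differentiableAt
  have h0 : (T.chartForm p (y, (0 : ℝ) • f y)).compContinuousLinearMap
      (graphDiff ((0 : ℝ) • fderiv ℝ f y)) = 0 := by
    have h1 : (0 : ℝ) • f y = 0 := zero_smul ℝ (f y)
    have h2 : (0 : ℝ) • fderiv ℝ f y = 0 := zero_smul ℝ (fderiv ℝ f y)
    rw [h1, h2, chartForm_zero_section hφ hι hy]
  have h1 : (1 : ℝ) • f y = f y := one_smul ℝ (f y)
  have h2 : (1 : ℝ) • fderiv ℝ f y = fderiv ℝ f y := one_smul ℝ (fderiv ℝ f y)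
  rw [hev.extDeriv_eq, extDeriv_add hI ((differentiableAt_formOf σ hy).const_smul _),
    extDeriv_smul, extDeriv_integral_contractTime hO hθ
      (fun z hz => extDeriv_timeForm hφ hι hfs hz) hyO,
    restrictSpace_timeForm (hfd y hy), restrictSpace_timeForm (hfd y hy), h0, h1,
    h2, sub_zero, inChart_F hφ hι σ hy (hmem y hy)]
  exact congrArg _ (neg_one_smul ℝ _) |>.trans (sub_eq_add_neg _ _).symm

/-- The smooth form underlying `T.primitive σ`. -/
def primitiveForm (hφ : IsClosedG2Structure φ) (hι : IsCoassociativeImmersion φ ι)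
    (σ : selfDualForms φ ι) (hσ : σ ∈ T.sections) : SmoothForm 4 2 M :=
  SmoothForm.mk' (T.primitive σ) fun p => by
    have h1 := (contDiffOn_chartPrimitive (T := T) hφ hι p).comp
      (contDiffOn_id.prodMk (contDiffOn_formJet σ p))
      fun y hy => (mem_chartDom_iff hy σ).2 (hσ _)
    exact h1.congr fun y hy => inChart_primitive hφ hι σ hy ((mem_chartDom_iff hy σ).2 (hσ _))

theorem F_eq (hφ : IsClosedG2Structure φ) (hι : IsCoassociativeImmersion φ ι)
    (σ : selfDualForms φ ι) (hσ : σ ∈ T.sections) :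
    T.F σ = extD (formOf σ) + extD (T.primitive σ) := by
  funext x
  have hx := mem_extChartAt_target (I := 𝓡 4) x
  have h1 := extDeriv_inChart_primitive hφ hι σ hσ hx
  have h4 : inChart x (extD (T.primitive σ)) (extChartAt (𝓡 4) x x) =
      extDeriv (inChart x (T.primitive σ)) (extChartAt (𝓡 4) x x) :=
    inChart_extD (primitiveForm hφ hι σ hσ).smooth x hx
  rw [← inChart_extD σ.1.smooth x hx, ← h4] at h1
  have h2 := eq_sub_iff_add_eq'.1 h1
  rw [← toChart_at, ← toChart_at, ← toChart_at, ← map_add] at h2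
  have h3 := congrArg (ofChart x (extChartAt (𝓡 4) x x)) h2
  rw [ofChart_toChart hx, ofChart_toChart hx, extChartAt_to_inv] at h3
  exact h3.symm

end TubularNeighborhood

end Primitive

/-! ### Iterated derivatives of a nonlinear differential operator -/

section JetDeriv

variable {E F W Z : Type} [NormedAddCommGroup E] [NormedSpace ℝ E]
  [NormedAddCommGroup F] [NormedSpace ℝ F] [NormedAddCommGroup W] [NormedSpace ℝ W]
  [NormedAddCommGroup Z] [NormedSpace ℝ Z]

theorem TendstoCk.jet {ι : Type*} {l : Filter ι} {C V : Set E} {q : ℕ} (hV : IsOpen V)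
    (hCV : C ⊆ V) {f : ι → E → W} {g : E → W} (hf : ∀ᶠ i in l, ContDiffOn ℝ ∞ (f i) V)
    (hg : ContDiffOn ℝ ∞ g V) (h : TendstoCk l C (q + 1) f g) :
    TendstoCk l C q (fun i => jet (f i)) (jet g) :=
  TendstoCk.prodMk hV hCV h.of_succ h.2 hf hg
    (hf.mono fun _ hi => hi.fderiv_of_isOpen hV (by simp)) (hg.fderiv_of_isOpen hV (by simp))

/-- The `j`-th derivative of `f ↦ Ξ(y, f)` at `f = ξ`, on the vectors `h₀, …, h_{j-1}`. -/
def jetDeriv (Ξ : E × Z → F) : (j : ℕ) → E × (Z × (Fin j → Z)) → F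
  | 0, z => Ξ (z.1, z.2.1)
  | j + 1, z => fderiv ℝ (jetDeriv Ξ j) (z.1, (z.2.1, Fin.init z.2.2))
      (0, (z.2.2 (Fin.last j), 0))

variable {Ω : Set (E × Z)} {Ξ : E × Z → F}

theorem isOpen_jetDerivDom (hΩ : IsOpen Ω) (j : ℕ) :
    IsOpen {z : E × (Z × (Fin j → Z)) | (z.1, z.2.1) ∈ Ω} :=
  hΩ.preimage (by fun_prop)

theorem contDiff_init (j : ℕ) :
    ContDiff ℝ ∞ (Fin.init : (Fin (j + 1) → Z) → (Fin j → Z)) :=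
  contDiff_pi.2 fun i => contDiff_apply ℝ Z i.castSucc

theorem contDiffOn_jetDeriv (hΩ : IsOpen Ω) (hΞ : ContDiffOn ℝ ∞ Ξ Ω) (j : ℕ) :
    ContDiffOn ℝ ∞ (jetDeriv Ξ j) {z | (z.1, z.2.1) ∈ Ω} := by
  induction j with
  | zero => exact hΞ.comp (ContDiff.contDiffOn (by fun_prop)) fun z hz => hz
  | succ j ih =>
    have h1 : ContDiff ℝ ∞ (fun z : E × (Z × (Fin (j + 1) → Z)) =>
        ((z.1, (z.2.1, Fin.init z.2.2)) : E × (Z × (Fin j → Z)))) :=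
      contDiff_fst.prodMk ((contDiff_fst.comp contDiff_snd).prodMk
        ((contDiff_init j).comp (contDiff_snd.comp contDiff_snd)))
    have h2 : ContDiff ℝ ∞ (fun z : E × (Z × (Fin (j + 1) → Z)) =>
        ((0, (z.2.2 (Fin.last j), 0)) : E × (Z × (Fin j → Z)))) :=
      contDiff_const.prodMk (((contDiff_apply ℝ Z (Fin.last j)).comp
        (contDiff_snd.comp contDiff_snd)).prodMk contDiff_const)
    exact ((ih.fderiv_of_isOpen (m := ∞) (isOpen_jetDerivDom hΩ j) (by simp)).comp h1.contDiffOn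
      fun z hz => hz).clm_apply h2.contDiffOn

theorem hasFDerivAt_jetDeriv (hΩ : IsOpen Ω) (hΞ : ContDiffOn ℝ ∞ Ξ Ω) {j : ℕ}
    {z : E × (Z × (Fin j → Z))} (hz : (z.1, z.2.1) ∈ Ω) :
    HasFDerivAt (jetDeriv Ξ j) (fderiv ℝ (jetDeriv Ξ j) z) z :=
  (((contDiffOn_jetDeriv hΩ hΞ j).differentiableOn (by simp)).differentiableAt
    ((isOpen_jetDerivDom hΩ j).mem_nhds hz)).hasFDerivAt

theorem hasDerivAt_jetDeriv (hΩ : IsOpen Ω) (hΞ : ContDiffOn ℝ ∞ Ξ Ω) {j : ℕ} {y : E} {ξ v : Z}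
    (h : Fin j → Z) (hz : (y, ξ) ∈ Ω) :
    HasDerivAt (fun t : ℝ => jetDeriv Ξ j (y, (ξ + t • v, h)))
      (jetDeriv Ξ (j + 1) (y, (ξ, Fin.snoc (α := fun _ => Z) h v))) 0 := by
  have h1 : HasDerivAt (fun t : ℝ => (y, (ξ + t • v, h))) (0, (v, 0)) 0 := by
    have h2 : HasDerivAt (fun t : ℝ => ξ + t • v) v 0 := by
      simpa using ((hasDerivAt_id (0 : ℝ)).smul_const v).const_add ξ
    exact (hasDerivAt_const _ _).prodMk (h2.prodMk (hasDerivAt_const _ _))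
  have h3 := hasFDerivAt_jetDeriv hΩ hΞ (j := j) (z := (y, (ξ, h))) hz
  have h4 : (y, (ξ, h)) = (y, (ξ + (0 : ℝ) • v, h)) := by simp
  have h5 : jetDeriv Ξ (j + 1) (y, (ξ, Fin.snoc (α := fun _ => Z) h v)) =
      fderiv ℝ (jetDeriv Ξ j) (y, (ξ, h)) (0, (v, 0)) := by
    simp [jetDeriv]
  rw [h5]
  exact HasFDerivAt.comp_hasDerivAt_of_eq 0 h3 h1 h4

/-- The difference quotients of the `j`-th derivative converge, together with all their
derivatives in the base point `y`, to the `(j + 1)`-st derivative. -/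
theorem tendstoCk_slope_jetDeriv [FiniteDimensional ℝ E] [CompleteSpace F] (hΩ : IsOpen Ω)
    (hΞ : ContDiffOn ℝ ∞ Ξ Ω) {j : ℕ}
    {C V : Set E} (hC : IsCompact C) (hV : IsOpen V) (hCV : C ⊆ V) {f v : E → Z}
    {h : E → Fin j → Z} (hf : ContDiffOn ℝ ∞ f V) (hv : ContDiffOn ℝ ∞ v V)
    (hh : ContDiffOn ℝ ∞ h V) (hfΩ : ∀ y ∈ C, (y, f y) ∈ Ω) (q : ℕ) :
    TendstoCk (𝓝[≠] (0 : ℝ)) C q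
      (fun t y => t⁻¹ • (jetDeriv Ξ j (y, (f y + t • v y, h y)) - jetDeriv Ξ j (y, (f y, h y))))
      (fun y => jetDeriv Ξ (j + 1) (y, (f y, Fin.snoc (α := fun _ => Z) (h y) (v y)))) := by
  let k : E × ℝ → E × (Z × (Fin j → Z)) := fun z => (z.1, (f z.1 + z.2 • v z.1, h z.1))
  have hk : ContDiffOn ℝ ∞ k {z : E × ℝ | z.1 ∈ V} := by
    have h1 : ∀ {G : Type} [NormedAddCommGroup G] [NormedSpace ℝ G] {g : E → G},
        ContDiffOn ℝ ∞ g V → ContDiffOn ℝ ∞ (fun z : E × ℝ => g z.1) {z | z.1 ∈ V} :=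
      fun hg => hg.comp contDiffOn_fst fun z hz => hz
    exact contDiffOn_fst.prodMk (((h1 hf).add (contDiffOn_snd.smul (h1 hv))).prodMk (h1 hh))
  let O : Set (E × ℝ) := {z : E × ℝ | z.1 ∈ V} ∩ k ⁻¹' {z | (z.1, z.2.1) ∈ Ω}
  have hO : IsOpen O := hk.continuousOn.isOpen_inter_preimage (hV.preimage continuous_fst)
    (isOpen_jetDerivDom hΩ j)
  have hG : ContDiffOn ℝ ∞ (jetDeriv Ξ j ∘ k) O :=
    (contDiffOn_jetDeriv hΩ hΞ j).comp (hk.mono inter_subset_left) fun z hz => hz.2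
  have hCO : ∀ y ∈ C, (y, (0 : ℝ)) ∈ O := fun y hy => ⟨hCV hy, by simpa [k] using hfΩ y hy⟩
  refine (tendstoCk_slope hO hG hC hCO q).congr (.of_forall fun t y _ => .of_eq ?_)
    fun y hy => ?_
  · funext z
    simp [k]
  · have h1 : ∀ᶠ z in 𝓝 y, (z, (0 : ℝ)) ∈ O :=
      (Continuous.prodMk_left (0 : ℝ)).continuousAt.eventually (hO.mem_nhds (hCO y hy))
    filter_upwards [h1] with z hz
    have h2 : HasFDerivAt (jetDeriv Ξ j ∘ k) (fderiv ℝ (jetDeriv Ξ j ∘ k) (z, 0)) (z, (0 : ℝ)) :=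
      ((hG.differentiableOn (by simp)).differentiableAt (hO.mem_nhds hz)).hasFDerivAt
    have h3 : HasDerivAt (fun t : ℝ => (z, t)) (0, 1) 0 :=
      (hasDerivAt_const _ _).prodMk (hasDerivAt_id _)
    have h4 := h2.comp_hasDerivAt 0 h3
    have h5 : (z, f z) ∈ Ω := by simpa [k] using hz.2
    exact h4.unique (hasDerivAt_jetDeriv hΩ hΞ (v := v z) (h z) h5)

/-- Appending a last entry to a finite sequence, as a linear map. -/
def snocCLM (j : ℕ) : (Fin j → Z) × Z →L[ℝ] (Fin (j + 1) → Z) :=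
  ContinuousLinearMap.pi (Fin.lastCases (motive := fun _ => (Fin j → Z) × Z →L[ℝ] Z)
    (ContinuousLinearMap.snd ℝ _ _)
    fun i => (ContinuousLinearMap.proj i).comp (ContinuousLinearMap.fst ℝ _ _))

theorem snocCLM_init (j : ℕ) (h : Fin (j + 1) → Z) :
    snocCLM j (Fin.init h, h (Fin.last j)) = h := by
  funext i
  refine Fin.lastCases ?_ (fun i => ?_) i <;> simp [snocCLM, Fin.init]

theorem TendstoCk.pi {ι : Type*} {l : Filter ι} {C V : Set E} (hV : IsOpen V)
    (hCV : C ⊆ V) {q j : ℕ} {f : ι → E → Fin j → Z} {g : E → Fin j → Z}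
    (hf : ∀ᶠ i in l, ContDiffOn ℝ ∞ (f i) V) (hg : ContDiffOn ℝ ∞ g V)
    (h : ∀ k, TendstoCk l C q (fun i y => f i y k) (fun y => g y k)) :
    TendstoCk l C q f g := by
  induction j with
  | zero =>
    have h1 : f = fun _ => g := funext₂ fun _ _ => Subsingleton.elim _ _
    rw [h1]
    exact TendstoCk.const
  | succ j ih =>
    have hf' : ∀ᶠ i in l, ContDiffOn ℝ ∞ (fun y => Fin.init (f i y)) V :=
      hf.mono fun i hi => (contDiff_init j).comp_contDiffOn hi
    have hg' : ContDiffOn ℝ ∞ (fun y => Fin.init (g y)) V := (contDiff_init j).comp_contDiffOn hg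
    have hf'' : ∀ᶠ i in l, ContDiffOn ℝ ∞ (fun y => f i y (Fin.last j)) V :=
      hf.mono fun i hi => contDiffOn_pi.1 hi _
    have h1 := ih hf' hg' fun k => h k.castSucc
    have h2 := (h1.prodMk hV hCV (h (Fin.last j)) hf' hg' hf'' (contDiffOn_pi.1 hg _)).clm_comp
      hV hCV (snocCLM j) ((hf'.and hf'').mono fun i hi => hi.1.prodMk hi.2)
      (hg'.prodMk (contDiffOn_pi.1 hg _))
    simpa only [snocCLM_init] using h2

end JetDeriv

theorem tendstoCk_add_smul {E F : Type} [NormedAddCommGroup E] [NormedSpace ℝ E]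
    [NormedAddCommGroup F] [NormedSpace ℝ F] {C V : Set E} (hC : IsCompact C) (hV : IsOpen V)
    (hCV : C ⊆ V) {f v : E → F} (hf : ContDiffOn ℝ ∞ f V) (hv : ContDiffOn ℝ ∞ v V) (q : ℕ) :
    TendstoCk (𝓝 (0 : ℝ)) C q (fun t y => f y + t • v y) f := by
  have hH : ContDiffOn ℝ ∞ (fun z : E × ℝ => f z.1 + z.2 • v z.1) {z | z.1 ∈ V} :=
    (hf.comp contDiffOn_fst fun z hz => hz).add
      (contDiffOn_snd.smul (hv.comp contDiffOn_fst fun z hz => hz))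
  have h := TendstoCk.comp_graph hC hV hCV (hV.preimage continuous_fst) hH
    (f := fun (t : ℝ) _ => t) (g := fun _ => 0) (l := 𝓝 (0 : ℝ)) (q := q)
    (.of_forall fun _ => contDiffOn_const) contDiffOn_const (fun y hy => hCV hy)
    (tendstoCk_of_tendsto q tendsto_id)
  simpa using h

/-! ### Smoothness of the nonlinear part between Fréchet spaces -/

section Frechet

local notation "E4" => EuclideanSpace ℝ (Fin 4)
local notation "W2" => EuclideanSpace ℝ (Fin 4) [⋀^Fin 2]→L[ℝ] ℝ

variable {M Y : Type*}
  [TopologicalSpace M] [ChartedSpace (EuclideanSpace ℝ (Fin 4)) M] [IsManifold (𝓡 4) ∞ M]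
  [TopologicalSpace Y] [ChartedSpace (EuclideanSpace ℝ (Fin 7)) Y] [IsManifold (𝓡 7) ∞ Y]
  {φ : RawForm 7 3 Y} {ι : M → Y}

theorem tendsto_selfDualForms_iff {κ : Type*} {l : Filter κ} {f : κ → selfDualForms φ ι}
    {σ : selfDualForms φ ι} : Tendsto f l (𝓝 σ) ↔
      ∀ (p : M) (q : ℕ) (C : Set E4), IsCompact C → C ⊆ (extChartAt (𝓡 4) p).target →
        TendstoCk l C q (fun i => inChart p (formOf (f i))) (inChart p (formOf σ)) :=
  tendsto_subtype_rng.trans tendsto_smoothForm_iff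

theorem tendsto_add_smul (σ v : selfDualForms φ ι) :
    Tendsto (fun t : ℝ => σ + t • v) (𝓝 0) (𝓝 σ) :=
  tendsto_selfDualForms_iff.2 fun p q _ hC hCt =>
    tendstoCk_add_smul hC (isOpen_extChartAt_target p) hCt (contDiffOn_formOf σ p)
      (contDiffOn_formOf v p) q

theorem contDiffOn_formJet_pi {j : ℕ} (h : Fin j → selfDualForms φ ι) (p : M) :
    ContDiffOn ℝ ∞ (fun y k => formJet (h k) p y) (extChartAt (𝓡 4) p).target :=
  contDiffOn_pi.2 fun k => contDiffOn_formJet (h k) p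

namespace TubularNeighborhood

variable {T : TubularNeighborhood φ ι}

theorem isOpen_sections [CompactSpace M] (hφ : IsClosedG2Structure φ)
    (hι : IsCoassociativeImmersion φ ι) : IsOpen T.sections := by
  refine isOpen_iff_mem_nhds.2 fun σ hσ => ?_
  have h1 : ∀ x : M, ∃ C : Set E4, IsCompact C ∧ extChartAt (𝓡 4) x x ∈ interior C ∧
      C ⊆ (extChartAt (𝓡 4) x).target := fun x =>
    exists_compact_subset (isOpen_extChartAt_target x) (mem_extChartAt_target x)
  choose C hC hxC hCt using h1
  obtain ⟨t, -, ht⟩ := isCompact_univ.elim_nhds_subcover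
    (fun x : M => (extChartAt (𝓡 4) x).source ∩ extChartAt (𝓡 4) x ⁻¹' interior (C x))
    fun x _ => ((continuousOn_extChartAt x).isOpen_inter_preimage (isOpen_extChartAt_source x)
      isOpen_interior).mem_nhds ⟨mem_extChartAt_source x, hxC x⟩
  have h2 : ∀ p ∈ t, ∀ᶠ η in 𝓝 σ, ∀ y ∈ C p, (y, inChart p (formOf η) y) ∈ T.chartDom p :=
    fun p _ => eventually_graph_mem (hC p) (isOpen_chartDom hφ hι p)
      (tendsto_selfDualForms_iff.1 tendsto_id p 0 (C p) (hC p) (hCt p)).uniformly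
      ((contDiffOn_formOf σ p).continuousOn.mono (hCt p))
      fun y hy => (mem_chartDom_iff (hCt p hy) σ).2 (hσ _)
  filter_upwards [(Finset.eventually_all t).2 h2] with η hη x
  obtain ⟨p, hp, hxp⟩ := mem_iUnion₂.1 (ht (mem_univ x))
  have h3 := hη p hp _ (interior_subset hxp.2)
  rw [mem_chartDom_iff (hCt p (interior_subset hxp.2)), (extChartAt (𝓡 4) p).left_inv hxp.1] at h3
  exact h3

/-- The iterated directional derivatives of `σ ↦ T.primitive σ`, computed pointwise. -/
def primitiveDeriv (T : TubularNeighborhood φ ι) :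
    (j : ℕ) → selfDualForms φ ι → (Fin j → selfDualForms φ ι) → RawForm 4 2 M
  | 0, σ, _ => T.primitive σ
  | j + 1, σ, h => fun x =>
      deriv (fun t : ℝ => (primitiveDeriv T j (σ + t • h (Fin.last j)) (Fin.init h)).at x) 0

/-- In a chart, the derivatives of `σ ↦ T.primitive σ` are those of `T.chartPrimitive`. -/
theorem inChart_primitiveDeriv (hφ : IsClosedG2Structure φ) (hι : IsCoassociativeImmersion φ ι)
    {j : ℕ} (σ : selfDualForms φ ι) (h : Fin j → selfDualForms φ ι) {p : M} {y : E4}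
    (hy : y ∈ (extChartAt (𝓡 4) p).target) (hσ : (y, inChart p (formOf σ) y) ∈ T.chartDom p) :
    inChart p (T.primitiveDeriv j σ h) y =
      jetDeriv (T.chartPrimitive p) j (y, (formJet σ p y, fun k => formJet (h k) p y)) := by
  induction j generalizing σ with
  | zero => exact inChart_primitive hφ hι σ hy hσ
  | succ j ih =>
    set v := h (Fin.last j) with hv
    let x := (extChartAt (𝓡 4) p).symm y
    have h1 : ∀ᶠ t : ℝ in 𝓝 0, (y, inChart p (formOf (σ + t • v)) y) ∈ T.chartDom p := by
      have h2 : ContinuousAt (fun t : ℝ =>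
          (y, inChart p (formOf σ) y + t • inChart p (formOf v) y)) 0 := by fun_prop
      refine h2.eventually ((isOpen_chartDom hφ hι p).mem_nhds ?_)
      simpa using hσ
    have h3 : (fun t : ℝ => (T.primitiveDeriv j (σ + t • v) (Fin.init h)).at x) =ᶠ[𝓝 0]
        fun t => ofChart p y (jetDeriv (T.chartPrimitive p) j
          (y, (formJet σ p y + t • formJet v p y, fun k => formJet (Fin.init h k) p y))) := by
      filter_upwards [h1] with t ht
      rw [← formJet_add_smul σ v hy t, ← ih (σ + t • v) (Fin.init h) ht, ofChart_inChart hy]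
    have h4 := hasDerivAt_jetDeriv (isOpen_jetDom (T := T) hφ hι p)
      (contDiffOn_chartPrimitive hφ hι p) (j := j) (y := y) (ξ := formJet σ p y)
      (v := formJet v p y) (fun k => formJet (Fin.init h k) p y) hσ
    have h5 := (ofChart p y).hasFDerivAt.comp_hasDerivAt 0 h4
    have h6 := (h5.congr_of_eventuallyEq h3).deriv
    have h7 : (T.primitiveDeriv (j + 1) σ h).at x = _ := h6
    rw [← toChart_at, h7, toChart_ofChart hy]
    congr 3
    funext k
    refine Fin.lastCases ?_ (fun k => ?_) k
    · rw [Fin.snoc_last]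
    · rw [Fin.snoc_castSucc]
      rfl

open Classical in
/-- The smooth form underlying `T.primitiveDeriv j σ h`, for sections `σ` of `U`. -/
def primitiveDerivForm (T : TubularNeighborhood φ ι) (hφ : IsClosedG2Structure φ)
    (hι : IsCoassociativeImmersion φ ι) (j : ℕ) (σ : selfDualForms φ ι)
    (h : Fin j → selfDualForms φ ι) : SmoothForm 4 2 M :=
  if hσ : σ ∈ T.sections then
    SmoothForm.mk' (T.primitiveDeriv j σ h) fun p => by
      have h1 := (contDiffOn_jetDeriv (isOpen_jetDom (T := T) hφ hι p)
        (contDiffOn_chartPrimitive hφ hι p) j).comp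
        (contDiffOn_id.prodMk ((contDiffOn_formJet σ p).prodMk (contDiffOn_formJet_pi h p)))
        fun y hy => (mem_chartDom_iff hy σ).2 (hσ _)
      exact h1.congr fun y hy =>
        inChart_primitiveDeriv hφ hι σ h hy ((mem_chartDom_iff hy σ).2 (hσ _))
  else 0

theorem primitiveDerivForm_val (hφ : IsClosedG2Structure φ) (hι : IsCoassociativeImmersion φ ι)
    {j : ℕ} {σ : selfDualForms φ ι} (hσ : σ ∈ T.sections) (h : Fin j → selfDualForms φ ι) :
    (T.primitiveDerivForm hφ hι j σ h).val = T.primitiveDeriv j σ h := by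
  rw [primitiveDerivForm, dif_pos hσ]
  rfl

theorem inChart_primitiveDerivForm (hφ : IsClosedG2Structure φ)
    (hι : IsCoassociativeImmersion φ ι) {j : ℕ} {σ : selfDualForms φ ι} (hσ : σ ∈ T.sections)
    (h : Fin j → selfDualForms φ ι) {p : M} {y : E4}
    (hy : y ∈ (extChartAt (𝓡 4) p).target) :
    jetDeriv (T.chartPrimitive p) j (y, (formJet σ p y, fun k => formJet (h k) p y)) =
      inChart p (T.primitiveDerivForm hφ hι j σ h).val y := by
  rw [primitiveDerivForm_val hφ hι hσ]
  exact (inChart_primitiveDeriv hφ hι σ h hy ((mem_chartDom_iff hy σ).2 (hσ _))).symm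

theorem tendsto_slope_primitiveDerivForm [CompactSpace M] (hφ : IsClosedG2Structure φ)
    (hι : IsCoassociativeImmersion φ ι) {j : ℕ} {σ : selfDualForms φ ι} (hσ : σ ∈ T.sections)
    (h : Fin j → selfDualForms φ ι) (v : selfDualForms φ ι) :
    Tendsto (fun t : ℝ => t⁻¹ • (T.primitiveDerivForm hφ hι j (σ + t • v) h -
      T.primitiveDerivForm hφ hι j σ h)) (𝓝[≠] 0)
      (𝓝 (T.primitiveDerivForm hφ hι (j + 1) σ (Fin.snoc h v))) := by
  refine tendsto_smoothForm_iff.2 fun p q C hC hCt => ?_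
  have hopen := isOpen_extChartAt_target (I := 𝓡 4) p
  have h1 := tendstoCk_slope_jetDeriv (isOpen_jetDom (T := T) hφ hι p)
    (contDiffOn_chartPrimitive hφ hι p) (j := j) hC hopen hCt (contDiffOn_formJet σ p)
    (contDiffOn_formJet v p) (contDiffOn_formJet_pi h p)
    (fun y hy => (mem_chartDom_iff (hCt hy) σ).2 (hσ _)) q
  have h2 : ∀ᶠ t : ℝ in 𝓝[≠] 0, σ + t • v ∈ T.sections :=
    (tendsto_add_smul σ v).mono_left nhdsWithin_le_nhds
      ((isOpen_sections hφ hι).mem_nhds hσ)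
  refine h1.congr ?_ fun y hy => ?_
  · filter_upwards [h2] with t ht y hy
    filter_upwards [hopen.mem_nhds (hCt hy)] with z hz
    rw [← formJet_add_smul σ v hz, inChart_primitiveDerivForm hφ hι ht h hz,
      inChart_primitiveDerivForm hφ hι hσ h hz]
    rfl
  · filter_upwards [hopen.mem_nhds (hCt hy)] with z hz
    rw [← inChart_primitiveDerivForm hφ hι hσ _ hz]
    congr 3
    funext k
    refine Fin.lastCases ?_ (fun k => ?_) k
    · rw [Fin.snoc_last, Fin.snoc_last]
    · rw [Fin.snoc_castSucc, Fin.snoc_castSucc]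

theorem continuousOn_primitiveDerivForm [CompactSpace M] (hφ : IsClosedG2Structure φ)
    (hι : IsCoassociativeImmersion φ ι) (j : ℕ) :
    ContinuousOn (fun z : selfDualForms φ ι × (Fin j → selfDualForms φ ι) =>
      T.primitiveDerivForm hφ hι j z.1 z.2) (T.sections ×ˢ univ) := by
  rintro ⟨σ, h⟩ ⟨hσ : σ ∈ T.sections, -⟩
  refine ContinuousAt.continuousWithinAt ?_
  refine tendsto_smoothForm_iff.2 fun p q C hC hCt => ?_
  have hopen := isOpen_extChartAt_target (I := 𝓡 4) p
  have hjet : ∀ {f : selfDualForms φ ι × (Fin j → selfDualForms φ ι) → selfDualForms φ ι},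
      ContinuousAt f (σ, h) →
      TendstoCk (𝓝 (σ, h)) C q (fun z => formJet (f z) p) (formJet (f (σ, h)) p) := fun hf =>
    TendstoCk.jet hopen hCt (.of_forall fun z => contDiffOn_formOf _ p) (contDiffOn_formOf _ p)
      (tendsto_selfDualForms_iff.1 hf p (q + 1) C hC hCt)
  have h1 := hjet continuousAt_fst
  have h2 : TendstoCk (𝓝 (σ, h)) C q
      (fun (z : selfDualForms φ ι × (Fin j → selfDualForms φ ι)) y k => formJet (z.2 k) p y)
      (fun y k => formJet (h k) p y) :=
    TendstoCk.pi hopen hCt (.of_forall fun z => contDiffOn_formJet_pi z.2 p)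
      (contDiffOn_formJet_pi h p) fun k =>
        hjet (f := fun z => z.2 k) (by fun_prop)
  have h3 := TendstoCk.comp_graph (l := 𝓝 (σ, h))
    (f := fun z y => (formJet z.1 p y, fun k => formJet (z.2 k) p y)) hC hopen hCt
    (isOpen_jetDerivDom (isOpen_jetDom (T := T) hφ hι p) j)
    (contDiffOn_jetDeriv (isOpen_jetDom (T := T) hφ hι p) (contDiffOn_chartPrimitive hφ hι p) j)
    (.of_forall fun z => (contDiffOn_formJet z.1 p).prodMk (contDiffOn_formJet_pi z.2 p))
    ((contDiffOn_formJet σ p).prodMk (contDiffOn_formJet_pi h p))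
    (fun y hy => (mem_chartDom_iff (hCt hy) σ).2 (hσ _))
    (h1.prodMk hopen hCt h2 (.of_forall fun z => contDiffOn_formJet z.1 p)
      (contDiffOn_formJet σ p) (.of_forall fun z => contDiffOn_formJet_pi z.2 p)
      (contDiffOn_formJet_pi h p))
  have h4 : ∀ᶠ z : selfDualForms φ ι × (Fin j → selfDualForms φ ι) in 𝓝 (σ, h),
      z.1 ∈ T.sections := continuousAt_fst.eventually ((isOpen_sections hφ hι).mem_nhds hσ)
  refine h3.congr ?_ fun y hy => ?_
  · filter_upwards [h4] with z hz y hy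
    filter_upwards [hopen.mem_nhds (hCt hy)] with w hw
    exact inChart_primitiveDerivForm hφ hι hz _ hw
  · filter_upwards [hopen.mem_nhds (hCt hy)] with w hw
    exact inChart_primitiveDerivForm hφ hι hσ _ hw

/-- The nonlinear part `N(σ) = F(σ) - dσ`, for sections `σ` of `U`. -/
def nonlinearPart (T : TubularNeighborhood φ ι) (hφ : IsClosedG2Structure φ)
    (hι : IsCoassociativeImmersion φ ι) (σ : selfDualForms φ ι) : exactForms 4 2 M :=
  dForm (T.primitiveDerivForm hφ hι 0 σ ![])

theorem F_eq_nonlinearPart (hφ : IsClosedG2Structure φ) (hι : IsCoassociativeImmersion φ ι)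
    {σ : selfDualForms φ ι} (hσ : σ ∈ T.sections) :
    T.F σ = extD (formOf σ) + (T.nonlinearPart hφ hι σ).val.val := by
  rw [F_eq hφ hι σ hσ, nonlinearPart, dForm_val, primitiveDerivForm_val hφ hι hσ]
  rfl

theorem isFrechetSmoothOn_nonlinearPart [CompactSpace M] (hφ : IsClosedG2Structure φ)
    (hι : IsCoassociativeImmersion φ ι) :
    IsFrechetSmoothOn (T.nonlinearPart hφ hι) T.sections := by
  refine ⟨isOpen_sections hφ hι, fun j σ h => dForm (T.primitiveDerivForm hφ hι j σ h),
    fun σ _ h => ?_, fun j σ hσ h v => ?_, fun j => ?_⟩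
  · rw [nonlinearPart, Subsingleton.elim h ![]]
  · have h1 := (continuous_dForm.tendsto _).comp
      (tendsto_slope_primitiveDerivForm (T := T) hφ hι hσ h v)
    refine h1.congr fun t => ?_
    rw [Function.comp_apply, dForm_smul, dForm_sub]
  · exact continuous_dForm.comp_continuousOn (continuousOn_primitiveDerivForm hφ hι j)

end TubularNeighborhood

end Frechet

/-! ### Hölder estimates for functions with vanishing linearization -/

section QuadraticEstimate

variable {E F Z W : Type} [NormedAddCommGroup E] [NormedSpace ℝ E]
  [NormedAddCommGroup F] [NormedSpace ℝ F] [NormedAddCommGroup Z] [NormedSpace ℝ Z]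
  [NormedAddCommGroup W] [NormedSpace ℝ W] {α : ℝ} {S V : Set E}

theorem exists_hnorm_apply_le (hα : α ∈ Ioo (0 : ℝ) 1) {d : ℝ≥0}
    (hd : ∀ y ∈ S, ∀ z ∈ S, ‖y - z‖ₑ ≤ d) (hconv : Convex ℝ S) (hV : IsOpen V) (hS : S ⊆ V)
    (r : ℕ) : ∃ c : ℝ≥0, ∀ {F G : Type} [NormedAddCommGroup F] [NormedSpace ℝ F]
      [NormedAddCommGroup G] [NormedSpace ℝ G] {A : E → F →L[ℝ] G} {f : E → F},
      ContDiffOn ℝ ∞ A V → ContDiffOn ℝ ∞ f V →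
      hnorm r α S (fun y => A y (f y)) ≤ c * hnorm r α S A * hnorm r α S f := by
  obtain ⟨c, hc⟩ := exists_hnorm_bilin_le hα hd hconv hV hS r
  refine ⟨c, fun {F G} _ _ _ _ {A f} hA hf => ?_⟩
  have h := hc (ContinuousLinearMap.id ℝ (F →L[ℝ] G)) 1
    (fun x y => by simpa using x.le_opNorm y) hA hf
  simpa using h

theorem exists_hnorm_jet_le (hα : α ∈ Ioo (0 : ℝ) 1) {d : ℝ≥0}
    (hd : ∀ y ∈ S, ∀ z ∈ S, ‖y - z‖ₑ ≤ d) (hconv : Convex ℝ S) (hV : IsOpen V) (hS : S ⊆ V)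
    (r : ℕ) : ∃ c : ℝ≥0, ∀ f : E → W, ContDiffOn ℝ ∞ f V →
      hnorm r α S (fun y => (f y, fderiv ℝ f y)) ≤ c * hnorm (r + 1) α S f := by
  refine ⟨1 + d ^ (1 - α) + 1, fun f hf => ?_⟩
  have h1 := hnorm_prodMk_le (r := r) (α := α) hV hS hf
    (hf.fderiv_of_isOpen (m := ∞) hV (by simp))
  refine h1.trans ?_
  push_cast
  rw [add_mul _ 1, one_mul, ENNReal.coe_rpow_of_nonneg _ (by linarith [hα.2])]
  exact add_le_add (hnorm_le_hnorm_succ hα hd hconv hV hS hf) (hnorm_fderiv_le f)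

theorem isCompact_fibreProd {K : Set (E × Z)} (hK : IsCompact K) :
    IsCompact {p : E × (Z × Z) | (p.1, p.2.1) ∈ K ∧ (p.1, p.2.2) ∈ K} := by
  have h1 : IsCompact ((fun q : (E × Z) × (E × Z) => (q.1.1, (q.1.2, q.2.2))) '' (K ×ˢ K)) :=
    (hK.prod hK).image (by fun_prop)
  refine h1.of_isClosed_subset ?_ ?_
  · exact (hK.isClosed.preimage (by fun_prop)).inter (hK.isClosed.preimage (by fun_prop))
  · rintro ⟨y, ξ, ζ⟩ ⟨h, h'⟩
    exact ⟨((y, ξ), (y, ζ)), ⟨h, h'⟩, rfl⟩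

/-- If the linearization of `f ↦ G(y, f)` at `0` vanishes, the difference of its values at two
functions is bounded by the product of their size and of their distance. -/
theorem exists_hnorm_sub_le_of_fderiv_eq_zero [FiniteDimensional ℝ E] [FiniteDimensional ℝ Z]
    [CompleteSpace F] (hα : α ∈ Ioo (0 : ℝ) 1) {d : ℝ≥0}
    (hd : ∀ y ∈ S, ∀ z ∈ S, ‖y - z‖ₑ ≤ d) (hconv : Convex ℝ S) (hV : IsOpen V) (hS : S ⊆ V)
    (r : ℕ) {Ω : Set (E × Z)} (hΩ : IsOpen Ω) {G : E × Z → F} (hG : ContDiffOn ℝ ∞ G Ω)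
    (hΩc : ∀ y, Convex ℝ {z | (y, z) ∈ Ω}) (h0 : ∀ y z, (y, z) ∈ Ω → (y, (0 : Z)) ∈ Ω)
    (hG0 : ∀ y, (y, (0 : Z)) ∈ Ω →
      (fderiv ℝ G (y, 0)).comp (ContinuousLinearMap.inr ℝ E Z) = 0)
    {K : Set (E × Z)} (hK : IsCompact K) (hKΩ : K ⊆ Ω) (R : ℝ≥0) :
    ∃ c : ℝ≥0, ∀ f g : E → Z, ContDiffOn ℝ ∞ f V → ContDiffOn ℝ ∞ g V →
      (∀ y ∈ V, (y, f y) ∈ Ω) → (∀ y ∈ V, (y, g y) ∈ Ω) →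
      (∀ y ∈ S, (y, f y) ∈ K) → (∀ y ∈ S, (y, g y) ∈ K) →
      hnorm r α S f ≤ R → hnorm r α S g ≤ R →
      hnorm r α S (fun y => G (y, f y) - G (y, g y)) ≤
        c * (hnorm r α S f + hnorm r α S g) * hnorm r α S (fun y => f y - g y) := by
  obtain ⟨H, hH, hGH⟩ := exists_quadratic_remainder hΩ hG hΩc h0 hG0
  have hΩ' : IsOpen {p : E × (Z × Z) | (p.1, p.2.1) ∈ Ω ∧ (p.1, p.2.2) ∈ Ω} :=
    (hΩ.preimage (f := fun p : E × (Z × Z) => (p.1, p.2.1)) (by fun_prop)).inter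
      (hΩ.preimage (f := fun p : E × (Z × Z) => (p.1, p.2.2)) (by fun_prop))
  obtain ⟨c₁, hc₁⟩ := exists_hnorm_comp_graph_le hα hd hconv hV hS r hΩ' hH
    (isCompact_fibreProd hK) (fun p hp => ⟨hKΩ hp.1, hKΩ hp.2⟩) (R + R)
  obtain ⟨c₂, hc₂⟩ := exists_hnorm_apply_le hα hd hconv hV hS r
  refine ⟨c₂ * (c₂ * c₁), fun f g hf hg hfΩ hgΩ hfK hgK hfR hgR => ?_⟩
  have hfg := hf.prodMk hg
  have hHfg : ContDiffOn ℝ ∞ (fun y => H (y, (f y, g y))) V :=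
    hH.comp (contDiffOn_id.prodMk hfg) fun y hy => ⟨hfΩ y hy, hgΩ y hy⟩
  have h1 : hnorm r α S (fun y => (f y, g y)) ≤ hnorm r α S f + hnorm r α S g :=
    hnorm_prodMk_le hV hS hf hg
  have h2 : hnorm r α S (fun y => H (y, (f y, g y))) ≤ c₁ :=
    hc₁ _ hfg (fun y hy => ⟨hfK y hy, hgK y hy⟩)
      (h1.trans (by push_cast; exact add_le_add hfR hgR))
  have h3 : hnorm r α S (fun y => H (y, (f y, g y)) (f y, g y)) ≤
      c₂ * c₁ * (hnorm r α S f + hnorm r α S g) :=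
    (hc₂ hHfg hfg).trans (by gcongr)
  have h4 : hnorm r α S (fun y => G (y, f y) - G (y, g y)) =
      hnorm r α S (fun y => H (y, (f y, g y)) (f y, g y) (f y - g y)) :=
    hnorm_congr fun y hy => by
      filter_upwards [hV.mem_nhds (hS hy)] with z hz
      exact hGH (z, (f z, g z)) (hfΩ z hz) (hgΩ z hz)
  rw [h4]
  refine (hc₂ (hHfg.clm_apply hfg) (hf.sub hg)).trans ?_
  rw [ENNReal.coe_mul, ENNReal.coe_mul, mul_assoc (c₂ : ℝ≥0∞) (c₂ * c₁)]
  gcongr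

end QuadraticEstimate

/-! ### The linearization of `F` -/

section VaryingProjection

variable {E W : Type} [NormedAddCommGroup E] [NormedSpace ℝ E]
  [NormedAddCommGroup W] [NormedSpace ℝ W]

theorem fderiv_clm_apply_apply {P : E → W →L[ℝ] W} {f : E → W} {y : E} (hP : DifferentiableAt ℝ P y)
    (hf : DifferentiableAt ℝ f y) :
    fderiv ℝ (fun z => P z (f z)) y =
      (P y).comp (fderiv ℝ f y) + (fderiv ℝ P y).flip (f y) :=
  (hP.hasFDerivAt.clm_apply hf.hasFDerivAt).fderiv

theorem contDiffOn_comp_add_flip [FiniteDimensional ℝ E] {V : Set E} (hV : IsOpen V)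
    {P : E → W →L[ℝ] W} (hP : ContDiffOn ℝ ∞ P V) :
    ContDiffOn ℝ ∞ (fun z : E × (W × (E →L[ℝ] W)) =>
      (P z.1).comp z.2.2 + (fderiv ℝ P z.1).flip z.2.1) {z | z.1 ∈ V} := by
  have h1 : ContDiffOn ℝ ∞ (fun z : E × (W × (E →L[ℝ] W)) => P z.1) {z | z.1 ∈ V} :=
    hP.comp contDiffOn_fst fun z hz => hz
  have h2 : ContDiffOn ℝ ∞ (fun z : E × (W × (E →L[ℝ] W)) => fderiv ℝ P z.1) {z | z.1 ∈ V} :=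
    (hP.fderiv_of_isOpen (m := ∞) hV (by simp)).comp contDiffOn_fst fun z hz => hz
  refine contDiffOn_clm_apply.2 fun v => ?_
  exact (h1.clm_apply ((contDiff_snd.comp contDiff_snd).contDiffOn.clm_apply
    contDiffOn_const)).add ((h2.clm_apply contDiffOn_const).clm_apply
      (contDiff_fst.comp contDiff_snd).contDiffOn)

end VaryingProjection

section Linearization

local notation "E4" => EuclideanSpace ℝ (Fin 4)
local notation "W2" => EuclideanSpace ℝ (Fin 4) [⋀^Fin 2]→L[ℝ] ℝ
local notation "W3" => EuclideanSpace ℝ (Fin 4) [⋀^Fin 3]→L[ℝ] ℝ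

variable {M Y : Type*}
  [TopologicalSpace M] [ChartedSpace (EuclideanSpace ℝ (Fin 4)) M] [IsManifold (𝓡 4) ∞ M]
  [TopologicalSpace Y] [ChartedSpace (EuclideanSpace ℝ (Fin 7)) Y] [IsManifold (𝓡 7) ∞ Y]
  {φ : RawForm 7 3 Y} {ι : M → Y}

namespace TubularNeighborhood

variable {T : TubularNeighborhood φ ι}

theorem diffFrom_chartMap_zero (hφ : IsClosedG2Structure φ) (hι : IsCoassociativeImmersion φ ι)
    {p : M} {y : E4} (hy : y ∈ (extChartAt (𝓡 4) p).target) (a : E4) :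
    diffFrom (m := 7) (T.chartMap p) (y, (0 : W2)) (a, 0) =
      diffAt (n := 4) (m := 7) ι ((extChartAt (𝓡 4) p).symm y) (chartSymmDiff p y a) := by
  have h := diffFrom_map (T := T) hφ hι (0 : selfDualForms φ ι) hy (zero_mem_chartDom hy)
  rw [map_zero_section] at h
  have h0 : inChart p (formOf (0 : selfDualForms φ ι)) = fun _ => (0 : W2) := rfl
  have h1 : fderiv ℝ (fun _ : E4 => (0 : W2)) y = 0 := fderiv_const_apply (0 : W2)
  rw [h0, h1] at h
  exact (DFunLike.congr_fun h a).symm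

theorem chartIntegrand_smul (p : M) (w : E4) (a : ℝ) (β : W2) (B : E4 →L[ℝ] W2) :
    T.chartIntegrand p (0, (w, (a • β, B))) = a • T.chartIntegrand p (0, (w, (β, B))) := by
  have h1 : (0 : ℝ) • β = 0 := zero_smul ℝ β
  have h2 : (0 : ℝ) • (a • β) = 0 := zero_smul ℝ (a • β)
  have h3 : ((0 : E4), a • β) = a • ((0 : E4), β) := by simp
  simp only [chartIntegrand]
  rw [h1, h2, h3]
  ext v
  change (T.chartForm p (w, 0)).curryLeft (a • ((0 : E4), β)) _ = _
  rw [map_smul]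
  rfl

/-- The contraction of `φ` with the derivative of `J` in the direction of the fibre is the
identity along the zero section. -/
theorem chartIntegrand_zero (hφ : IsClosedG2Structure φ) (hι : IsCoassociativeImmersion φ ι)
    {p : M} {y : E4} (hy : y ∈ (extChartAt (𝓡 4) p).target) (β : W2) (B : E4 →L[ℝ] W2) :
    T.chartIntegrand p (0, (y, (β, B))) = chartProj φ ι p y β := by
  -- by linearity, it is enough to consider `β` so small that it belongs to the domain of `J`
  suffices h : ∀ β : W2, (y, β) ∈ T.chartDom p →
      T.chartIntegrand p (0, (y, (β, B))) = chartProj φ ι p y β by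
    have h1 : ∀ᶠ s : ℝ in 𝓝[≠] 0, (y, s • β) ∈ T.chartDom p := by
      have h2 : ContinuousAt (fun s : ℝ => (y, s • β)) 0 := by fun_prop
      refine (h2.eventually ((isOpen_chartDom hφ hι p).mem_nhds ?_)).filter_mono nhdsWithin_le_nhds
      simpa using zero_mem_chartDom hy
    obtain ⟨s, hs, hs0⟩ := (h1.and self_mem_nhdsWithin).exists
    have h3 := h (s • β) hs
    rw [chartIntegrand_smul, map_smul] at h3
    exact smul_right_injective _ hs0 h3
  intro β hβ
  set x := (extChartAt (𝓡 4) p).symm y with hx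
  set u : W2 := ofChart p y (chartProj φ ι p y β) with hu
  have hline : HasFDerivAt (fun s : ℝ => (y, s • β))
      ((0 : ℝ →L[ℝ] E4).prod (ContinuousLinearMap.toSpanSingleton ℝ β)) 0 :=
    (hasFDerivAt_const y (0 : ℝ)).prodMk
      (ContinuousLinearMap.toSpanSingleton ℝ β).hasFDerivAt
  have hz : (y, (0 : ℝ) • β) = (y, (0 : W2)) := by simp
  have h1 : mfderiv 𝓘(ℝ, ℝ) (𝓡 7) (fun t : ℝ => T.J (bundleMk x (t • u))) 0 (1 : ℝ) =
      diffFrom (m := 7) (T.chartMap p) (y, 0) (0, β) := by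
    have h2 : (fun t : ℝ => T.J (bundleMk x (t • u))) = T.chartMap p ∘ fun s : ℝ => (y, s • β) := by
      funext t
      simp only [Function.comp_apply, chartMap, bundleParam, map_smul]
      rfl
    have h3 := mfderiv_comp (0 : ℝ) (f := fun s : ℝ => (y, s • β)) (g := T.chartMap p)
      (I := 𝓘(ℝ, ℝ)) (I' := 𝓘(ℝ, E4 × W2)) (I'' := 𝓡 7)
      (by rw [hz]; exact mdifferentiableAt_chartMap hφ hι (zero_mem_chartDom hy))
      hline.differentiableAt.mdifferentiableAt
    rw [mfderiv_eq_fderiv, hline.fderiv] at h3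
    rw [h2]
    refine (DFunLike.congr_fun h3 (1 : ℝ)).trans ?_
    change diffFrom (m := 7) (T.chartMap p) (y, (0 : ℝ) • β) (0, (1 : ℝ) • β) = _
    rw [hz, one_smul]
  ext v
  have h4 := T.deriv_zero x u hβ.2 _ h1.symm (chartSymmDiff p y (v 0)) (chartSymmDiff p y (v 1))
  have h5 : T.chartMap p (y, (0 : W2)) = ι x := by
    have h6 := chartMap_inChart (T := T) hy (0 : selfDualForms φ ι)
    rw [map_zero_section] at h6
    exact h6
  have h7 : chartProj φ ι p y β v = u fun i => chartSymmDiff p y (v i) :=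
    DFunLike.congr_fun (toChart_ofChart hy (chartProj φ ι p y β)).symm v
  have h8 : (fun i => chartSymmDiff p y (v i)) =
      ![chartSymmDiff p y (v 0), chartSymmDiff p y (v 1)] := by
    funext i
    fin_cases i <;> rfl
  have h9 : (0 : ℝ) • β = 0 := zero_smul ℝ β
  have h10 : (0 : ℝ) • B = 0 := ContinuousLinearMap.ext fun a => zero_smul ℝ (B a)
  rw [h7, h8]
  refine Eq.trans ?_ h4
  simp only [chartIntegrand]
  rw [h9, h10]
  change φ.at (T.chartMap p (y, (0 : W2))) _ = φ.at (ι x) _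
  rw [h5]
  congr 1
  funext i
  fin_cases i
  · rfl
  · exact diffFrom_chartMap_zero hφ hι hy (v 0)
  · exact diffFrom_chartMap_zero hφ hι hy (v 1)

/-- The chart representative of `F`, as a function of the `1`-jet. -/
def chartF (T : TubularNeighborhood φ ι) (p : M) (z : E4 × FormJet) : W3 :=
  (T.chartForm p (z.1, z.2.1)).compContinuousLinearMap (graphDiff z.2.2)

/-- The chart representative of `d`, as a function of the `1`-jet. The projection onto the
self-dual forms makes it agree with the linearization of `chartF` on all `1`-jets. -/
def chartD (φ : RawForm 7 3 Y) (ι : M → Y) (p : M) (z : E4 × FormJet) : W3 :=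
  ContinuousAlternatingMap.alternatizeUncurryFin
    ((chartProj φ ι p z.1).comp z.2.2 + (fderiv ℝ (chartProj φ ι p) z.1).flip z.2.1)

theorem contDiffOn_chartF (hφ : IsClosedG2Structure φ) (hι : IsCoassociativeImmersion φ ι)
    (p : M) : ContDiffOn ℝ ∞ (T.chartF p) (T.jetDom p) := by
  have h1 : ContDiff ℝ ∞ fun z : E4 × (W2 × (E4 →L[ℝ] W2)) => (z.1, z.2.1) := by fun_prop
  have h2 : ContDiff ℝ ∞ fun z : E4 × (W2 × (E4 →L[ℝ] W2)) => z.2.2 :=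
    contDiff_snd.comp contDiff_snd
  exact contDiffOn_alternating_comp
    ((contDiffOn_chartForm hφ hι p).comp h1.contDiffOn fun z hz => hz)
    (contDiff_graphDiff.comp h2).contDiffOn

theorem contDiffOn_chartD (hφ : IsClosedG2Structure φ) (hι : IsCoassociativeImmersion φ ι)
    (p : M) : ContDiffOn ℝ ∞ (chartD φ ι p) {z | z.1 ∈ (extChartAt (𝓡 4) p).target} := by
  have h0 := @contDiffOn_comp_add_flip E4 W2 _ _ _ _ inferInstance _ (isOpen_extChartAt_target p) _
    (contDiffOn_chartProj hφ hι p)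
  have h1 := (ContinuousAlternatingMap.alternatizeUncurryFinCLM ℝ E4 ℝ
    (n := 2)).contDiff.comp_contDiffOn h0 (n := ∞)
  exact h1

theorem extDeriv_chartProj (hφ : IsClosedG2Structure φ) (hι : IsCoassociativeImmersion φ ι)
    {p : M} {y : E4} (hy : y ∈ (extChartAt (𝓡 4) p).target) {f : E4 → W2}
    (hf : DifferentiableAt ℝ f y) :
    extDeriv (fun z => chartProj φ ι p z (f z)) y = chartD φ ι p (y, (f y, fderiv ℝ f y)) := by
  have hP : DifferentiableAt ℝ (chartProj φ ι p) y :=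
    ((contDiffOn_chartProj hφ hι p).differentiableOn (by simp)).differentiableAt
      ((isOpen_extChartAt_target p).mem_nhds hy)
  exact congrArg ContinuousAlternatingMap.alternatizeUncurryFin (fderiv_clm_apply_apply hP hf)

/-- On self-dual forms, `chartD` represents the exterior derivative. -/
theorem inChart_extD_formOf (hφ : IsClosedG2Structure φ) (hι : IsCoassociativeImmersion φ ι)
    (σ : selfDualForms φ ι) {p : M} {y : E4} (hy : y ∈ (extChartAt (𝓡 4) p).target) :
    inChart p (extD (formOf σ)) y = chartD φ ι p (y, formJet σ p y) := by
  rw [inChart_extD σ.1.smooth p hy]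
  refine Eq.trans ?_ (extDeriv_chartProj hφ hι hy (differentiableAt_formOf σ hy))
  congr 1
  funext z
  exact (chartProj_inChart σ p z).symm

/-- The chart representative of the nonlinear part, as a function of the `1`-jet. -/
def chartN (T : TubularNeighborhood φ ι) (p : M) (z : E4 × FormJet) : W3 :=
  T.chartF p z - chartD φ ι p z

theorem contDiffOn_chartN (hφ : IsClosedG2Structure φ) (hι : IsCoassociativeImmersion φ ι)
    (p : M) : ContDiffOn ℝ ∞ (T.chartN p) (T.jetDom p) :=
  (contDiffOn_chartF hφ hι p).sub ((contDiffOn_chartD hφ hι p).mono fun _ hz => hz.1)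

theorem inChart_nonlinearPart (hφ : IsClosedG2Structure φ) (hι : IsCoassociativeImmersion φ ι)
    {σ : selfDualForms φ ι} (hσ : σ ∈ T.sections) {p : M} {y : E4}
    (hy : y ∈ (extChartAt (𝓡 4) p).target) :
    inChart p (T.nonlinearPart hφ hι σ).val.val y = T.chartN p (y, formJet σ p y) := by
  have h1 := inChart_F hφ hι σ hy ((mem_chartDom_iff hy σ).2 (hσ _))
  rw [F_eq_nonlinearPart hφ hι hσ, inChart_add, Pi.add_apply,
    inChart_extD_formOf hφ hι σ hy] at h1
  exact eq_sub_iff_add_eq'.2 h1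

theorem chartF_smul (p : M) (y : E4) (ξ : FormJet) {f : E4 → W2}
    (hf : HasFDerivAt f ξ.2 y) (hfy : f y = ξ.1) (s : ℝ) :
    T.chartF p (y, s • ξ) = restrictSpace (T.timeForm p f (s, y)) := by
  rw [restrictSpace_timeForm hf.differentiableAt, hf.fderiv, hfy]
  rfl

/-- The linearization of `F` along the zero section is the exterior derivative. This is
Cartan's formula for the closed form `φ`. -/
theorem hasDerivAt_chartF (hφ : IsClosedG2Structure φ) (hι : IsCoassociativeImmersion φ ι)
    {p : M} {y : E4} (hy : y ∈ (extChartAt (𝓡 4) p).target) (ξ : FormJet) :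
    HasDerivAt (fun s : ℝ => T.chartF p (y, s • ξ)) (chartD φ ι p (y, ξ)) 0 := by
  let β : W2 := ξ.1
  let B : E4 →L[ℝ] W2 := ξ.2
  let f : E4 → W2 := fun z => β + B (z - y)
  have hfs : ContDiff ℝ ∞ f := contDiff_const.add (B.contDiff.comp (contDiff_id.sub contDiff_const))
  have hfB : ∀ z, HasFDerivAt f B z := fun z =>
    (B.hasFDerivAt.comp z ((hasFDerivAt_id z).sub_const y)).const_add β
  have hfy : f y = β := by simp [f]
  have hmem : ((0 : ℝ), y) ∈ T.timeDom p f := by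
    refine ⟨hy, ?_⟩
    have h0 : timeGraph f (0, y) = (y, 0) := Prod.ext rfl (zero_smul ℝ (f y))
    rw [mem_preimage, h0]
    exact zero_mem_chartDom hy
  have hO := isOpen_timeDom (T := T) hφ hι (p := p) hfs.contDiffOn
  have hθ := (contDiffOn_timeForm (T := T) hφ hι (p := p) hfs.contDiffOn)
  have hθd : DifferentiableAt ℝ (T.timeForm p f) (0, y) :=
    (hθ.differentiableOn (by simp)).differentiableAt (hO.mem_nhds hmem)
  have h1 := alternatize_fderiv_contractTime hθd (extDeriv_timeForm hφ hι hfs.contDiffOn hmem)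
  have h2 : HasDerivAt (fun t : ℝ => (t, y)) ((1 : ℝ), (0 : E4)) 0 :=
    (hasDerivAt_id _).prodMk (hasDerivAt_const _ y)
  have h2' := hθd.hasFDerivAt.comp_hasDerivAt (0 : ℝ) h2
  have h3 : HasDerivAt (fun t : ℝ => restrictSpace (T.timeForm p f (t, y)))
      (restrictSpace (fderiv ℝ (T.timeForm p f) (0, y) (1, 0))) 0 :=
    (restrictSpace (k := 3) (E := E4)).hasFDerivAt.comp_hasDerivAt (0 : ℝ) h2'
  have h4 : (fun s : ℝ => T.chartF p (y, s • ξ)) =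
      fun t : ℝ => restrictSpace (T.timeForm p f (t, y)) :=
    funext fun s => chartF_smul p y ξ (hfB y) hfy s
  have h5 : (fderiv ℝ (fun z => contractTime (T.timeForm p f z)) (0, y)).comp
      (ContinuousLinearMap.inr ℝ ℝ E4) = fderiv ℝ (fun z => chartProj φ ι p z (f z)) y := by
    have h6 : HasFDerivAt (fun z => contractTime (T.timeForm p f z))
        (fderiv ℝ (fun z => contractTime (T.timeForm p f z)) (0, y)) (0, y) :=
      ((contractTime (k := 2) (E := E4)).differentiableAt.comp (0, y) hθd).hasFDerivAt
    have h7 := (h6.comp y (hasFDerivAt_prodMk_right (0 : ℝ) y)).fderiv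
    rw [← h7]
    refine Filter.EventuallyEq.fderiv_eq ?_
    filter_upwards [(isOpen_extChartAt_target p).mem_nhds hy] with z hz
    refine (contractTime_timeForm (hfB z).differentiableAt 0).trans ?_
    exact chartIntegrand_zero hφ hι hz _ _
  have h8 := extDeriv_chartProj hφ hι hy (hfB y).differentiableAt
  rw [extDeriv, ← h5, h1, hfy, (hfB y).fderiv] at h8
  have h9 : restrictSpace (fderiv ℝ (T.timeForm p f) (0, y) (1, 0)) = chartD φ ι p (y, ξ) := h8
  rw [h4, ← h9]
  exact h3

theorem chartD_smul (p : M) (y : E4) (s : ℝ) (ξ : FormJet) :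
    chartD φ ι p (y, s • ξ) = s • chartD φ ι p (y, ξ) := by
  have h1 : (chartProj φ ι p y).comp (s • ξ).2 + (fderiv ℝ (chartProj φ ι p) y).flip (s • ξ).1 =
      s • ((chartProj φ ι p y).comp ξ.2 + (fderiv ℝ (chartProj φ ι p) y).flip ξ.1) := by
    ext1 v
    change chartProj φ ι p y (s • ξ.2 v) + fderiv ℝ (chartProj φ ι p) y v (s • ξ.1) =
      s • (chartProj φ ι p y (ξ.2 v) + fderiv ℝ (chartProj φ ι p) y v ξ.1)
    rw [map_smul, map_smul, smul_add]
  exact (congrArg _ h1).trans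
    (ContinuousAlternatingMap.alternatizeUncurryFin_smul s _)

theorem zero_mem_jetDom {p : M} {y : E4} (hy : y ∈ (extChartAt (𝓡 4) p).target) :
    (y, (0 : FormJet)) ∈ T.jetDom p := by
  have h := zero_mem_chartDom (T := T) hy
  exact h

/-- The linearization of the nonlinear part vanishes along the zero section. -/
theorem fderiv_chartN_zero (hφ : IsClosedG2Structure φ) (hι : IsCoassociativeImmersion φ ι)
    {p : M} {y : E4} (hy : y ∈ (extChartAt (𝓡 4) p).target) :
    (fderiv ℝ (T.chartN p) (y, 0)).comp (ContinuousLinearMap.inr ℝ E4 FormJet) = 0 := by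
  ext1 ξ
  have h1 : HasFDerivAt (T.chartN p) (fderiv ℝ (T.chartN p) (y, 0)) (y, 0) :=
    (((contDiffOn_chartN hφ hι p).differentiableOn (by simp)).differentiableAt
      ((isOpen_jetDom hφ hι p).mem_nhds (zero_mem_jetDom hy))).hasFDerivAt
  have h2 : HasDerivAt (fun s : ℝ => (y, s • ξ)) ((0 : E4), ξ) 0 := by
    simpa using (hasDerivAt_const (0 : ℝ) y).prodMk ((hasDerivAt_id (0 : ℝ)).smul_const ξ)
  have h3 : HasDerivAt (fun s : ℝ => T.chartN p (y, s • ξ))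
      (fderiv ℝ (T.chartN p) (y, 0) (0, ξ)) 0 :=
    HasFDerivAt.comp_hasDerivAt_of_eq 0 h1 h2 (by simp)
  have h4 : HasDerivAt (fun s : ℝ => chartD φ ι p (y, s • ξ)) (chartD φ ι p (y, ξ)) 0 := by
    simp only [chartD_smul]
    simpa using (hasDerivAt_id (0 : ℝ)).smul_const (chartD φ ι p (y, ξ))
  have h5 := (hasDerivAt_chartF (T := T) hφ hι hy ξ).sub h4
  rw [sub_self] at h5
  exact h3.unique h5

end TubularNeighborhood

end Linearization

/-! ### The quadratic estimate -/

section Estimate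

local notation "E4" => EuclideanSpace ℝ (Fin 4)
local notation "W2" => EuclideanSpace ℝ (Fin 4) [⋀^Fin 2]→L[ℝ] ℝ
local notation "W3" => EuclideanSpace ℝ (Fin 4) [⋀^Fin 3]→L[ℝ] ℝ

variable {M Y : Type*}
  [TopologicalSpace M] [ChartedSpace (EuclideanSpace ℝ (Fin 4)) M] [IsManifold (𝓡 4) ∞ M]
  [TopologicalSpace Y] [ChartedSpace (EuclideanSpace ℝ (Fin 7)) Y] [IsManifold (𝓡 7) ∞ Y]
  {φ : RawForm 7 3 Y} {ι : M → Y}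

theorem bundleParam_bundleCoord {p : M} {u : TwoFormBundle M}
    (hu : u.1 ∈ (extChartAt (𝓡 4) p).source) : bundleParam p (bundleCoord p u) = u := by
  obtain ⟨x, β⟩ := u
  have h1 : (extChartAt (𝓡 4) p).symm (extChartAt (𝓡 4) p x) = x :=
    (extChartAt (𝓡 4) p).left_inv hu
  change bundleMk ((extChartAt (𝓡 4) p).symm (extChartAt (𝓡 4) p x))
    (ofChart p (extChartAt (𝓡 4) p x) (toChart p (extChartAt (𝓡 4) p x) β)) = bundleMk x β
  rw [h1]
  exact congrArg (bundleMk x) (ofChart_toChart ((extChartAt (𝓡 4) p).map_source hu) β)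

/-- The part of a compact set of `2`-forms over a compact subset of a chart is compact in the
corresponding parametrisation of the bundle. -/
theorem isCompact_bundleCoord_image [T2Space M] {K : Set (TwoFormBundle M)} (hK : IsCompact K)
    {p : M} {S : Set E4} (hS : IsCompact S) (hSt : S ⊆ (extChartAt (𝓡 4) p).target) :
    IsCompact (bundleCoord p '' (K ∩ TotalSpace.proj ⁻¹' ((extChartAt (𝓡 4) p).symm '' S))) := by
  have h1 : IsCompact ((extChartAt (𝓡 4) p).symm '' S) :=
    hS.image_of_continuousOn ((continuousOn_extChartAt_symm p).mono hSt)
  have h2 : IsClosed ((TotalSpace.proj : TwoFormBundle M → M) ⁻¹'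
      ((extChartAt (𝓡 4) p).symm '' S)) :=
    h1.isClosed.preimage (FiberBundle.continuous_proj _ _)
  refine (hK.inter_right h2).image_of_continuousOn ((continuousOn_bundleCoord p).mono ?_)
  rintro u ⟨-, y, hy, hyu⟩
  rw [mem_preimage, ← hyu]
  exact (extChartAt (𝓡 4) p).map_target (hSt hy)

theorem formJet_sub (σ η : selfDualForms φ ι) {p : M} {y : E4}
    (hy : y ∈ (extChartAt (𝓡 4) p).target) :
    formJet (σ - η) p y = formJet σ p y - formJet η p y := by
  have h1 := (differentiableAt_formOf σ hy).hasFDerivAt.sub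
    (differentiableAt_formOf η hy).hasFDerivAt
  exact Prod.ext rfl h1.fderiv

theorem isCompact_prod_ball {E W A : Type} [NormedAddCommGroup E] [NormedSpace ℝ E]
    [FiniteDimensional ℝ E] [NormedAddCommGroup W] [NormedSpace ℝ W] [FiniteDimensional ℝ W]
    [NormedAddCommGroup A] [NormedSpace ℝ A] [FiniteDimensional ℝ A]
    {K : Set (E × W)} (hK : IsCompact K) (R : ℝ) :
    IsCompact {z : E × (W × A) | (z.1, z.2.1) ∈ K ∧ ‖z.2.2‖ ≤ R} := by
  have : ProperSpace A := FiniteDimensional.proper_real A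
  have h1 : IsCompact ((fun q : (E × W) × A => (q.1.1, (q.1.2, q.2))) ''
      (K ×ˢ Metric.closedBall 0 R)) :=
    (hK.prod (isCompact_closedBall 0 R)).image (by fun_prop)
  convert h1 using 1
  ext ⟨y, β, B⟩
  simp

namespace TubularNeighborhood

variable {T : TubularNeighborhood φ ι}

theorem bundleCoord_mem_chartDom {p : M} {u : TwoFormBundle M}
    (hu : u.1 ∈ (extChartAt (𝓡 4) p).source) (huU : u ∈ T.U) :
    bundleCoord p u ∈ T.chartDom p := by
  have hy := (extChartAt (𝓡 4) p).map_source hu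
  refine ⟨hy, ?_⟩
  have h1 : (bundleCoord p u).2 ∈ selfDualChart φ ι p (bundleCoord p u).1 := by
    refine ⟨u.2, ?_, rfl⟩
    change (u.2 : W2) ∈ selfDual φ ι ((extChartAt (𝓡 4) p).symm (extChartAt (𝓡 4) p u.1))
    rw [(extChartAt (𝓡 4) p).left_inv hu]
    exact T.subset huU
  have h2 : chartProj φ ι p (bundleCoord p u).1 (bundleCoord p u).2 = (bundleCoord p u).2 :=
    linearProj_of_mem h1
  rw [h2]
  exact (congrArg (· ∈ T.U) (bundleParam_bundleCoord hu)).mpr huU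

/-- The quadratic estimate on one coordinate ball. -/
theorem exists_hnorm_nonlinearPart_sub_le [T2Space M] (hφ : IsClosedG2Structure φ)
    (hι : IsCoassociativeImmersion φ ι) (r : ℕ) {α : ℝ} (hα : α ∈ Ioo (0 : ℝ) 1) {p : M}
    {a : E4} {ρ : ℝ} (hS : Metric.closedBall a ρ ⊆ (extChartAt (𝓡 4) p).target)
    {K : Set (TwoFormBundle M)} (hK : IsCompact K) (hKU : K ⊆ T.U) (R : ℝ≥0) :
    ∃ c : ℝ≥0, ∀ σ ∈ T.sections, ∀ η ∈ T.sections,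
      (∀ x, (⟨x, formOf σ x⟩ : TwoFormBundle M) ∈ K) →
      (∀ x, (⟨x, formOf η x⟩ : TwoFormBundle M) ∈ K) →
      hnorm (r + 1) α (Metric.closedBall a ρ) (inChart p (formOf σ)) ≤ R →
      hnorm (r + 1) α (Metric.closedBall a ρ) (inChart p (formOf η)) ≤ R →
      hnorm r α (Metric.closedBall a ρ)
          (inChart p (T.nonlinearPart hφ hι σ - T.nonlinearPart hφ hι η).val.val) ≤
        c * (hnorm (r + 1) α (Metric.closedBall a ρ) (inChart p (formOf σ)) +
          hnorm (r + 1) α (Metric.closedBall a ρ) (inChart p (formOf η))) *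
        hnorm (r + 1) α (Metric.closedBall a ρ) (inChart p (formOf (σ - η))) := by
  set S := Metric.closedBall a ρ
  have hV := isOpen_extChartAt_target (I := 𝓡 4) p
  have hd : ∀ y ∈ S, ∀ z ∈ S, ‖y - z‖ₑ ≤ ((ρ + ρ).toNNReal : ℝ≥0∞) := fun y hy z hz => by
    rw [← edist_eq_enorm_sub, edist_dist]
    refine ENNReal.ofReal_le_ofReal ?_
    exact (dist_triangle_right y z a).trans (add_le_add hy hz)
  have hconv : Convex ℝ S := convex_closedBall a ρ
  obtain ⟨c₁, hc₁⟩ := exists_hnorm_jet_le (W := W2) hα hd hconv hV hS r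
  have hjet : ∀ σ : selfDualForms φ ι,
      hnorm r α S (formJet σ p) ≤ c₁ * hnorm (r + 1) α S (inChart p (formOf σ)) :=
    fun σ => hc₁ _ (contDiffOn_formOf σ p)
  let K₁ := bundleCoord p '' (K ∩ TotalSpace.proj ⁻¹' ((extChartAt (𝓡 4) p).symm '' S))
  have hK₁ : IsCompact K₁ := isCompact_bundleCoord_image hK (isCompact_closedBall a ρ) hS
  let K₂ : Set (E4 × FormJet) := {z | (z.1, z.2.1) ∈ K₁ ∧ ‖z.2.2‖ ≤ (c₁ * R : ℝ≥0)}
  have hK₂ : IsCompact K₂ := by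
    have h := @isCompact_prod_ball E4 W2 (E4 →L[ℝ] W2) _ _ inferInstance _ _ inferInstance _ _
      inferInstance K₁ hK₁ (c₁ * R : ℝ≥0)
    exact h
  have hK₂Ω : K₂ ⊆ T.jetDom p := by
    rintro ⟨y, ξ⟩ ⟨⟨u, ⟨huK, z, hz, hzu⟩, hu⟩, -⟩
    have hus : u.1 ∈ (extChartAt (𝓡 4) p).source := by
      change (extChartAt (𝓡 4) p).symm z = u.1 at hzu
      rw [← hzu]
      exact (extChartAt (𝓡 4) p).map_target (hS hz)
    have h := bundleCoord_mem_chartDom hus (hKU huK)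
    rw [hu] at h
    exact h
  have hΩc : ∀ y, Convex ℝ {ξ : FormJet | (y, ξ) ∈ T.jetDom p} := fun y =>
    (convex_chartDom (T := T) p y).linear_preimage (LinearMap.fst ℝ W2 (E4 →L[ℝ] W2))
  obtain ⟨c₂, hc₂⟩ := exists_hnorm_sub_le_of_fderiv_eq_zero (E := E4) (F := W3) (Z := FormJet)
    hα hd hconv hV hS r (isOpen_jetDom (T := T) hφ hι p) (contDiffOn_chartN hφ hι p)
    hΩc (fun y ξ hξ => zero_mem_jetDom hξ.1)
    (fun y hy => fderiv_chartN_zero hφ hι hy.1) hK₂ hK₂Ω (c₁ * R)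
  refine ⟨c₂ * c₁ * c₁, fun σ hσ η hη hσK hηK hσR hηR => ?_⟩
  have hR : ∀ σ : selfDualForms φ ι, hnorm (r + 1) α S (inChart p (formOf σ)) ≤ R →
      hnorm r α S (formJet σ p) ≤ (c₁ * R : ℝ≥0) := fun σ h =>
    (hjet σ).trans (by push_cast; gcongr)
  have hmem : ∀ σ : selfDualForms φ ι, (∀ x, (⟨x, formOf σ x⟩ : TwoFormBundle M) ∈ K) →
      hnorm (r + 1) α S (inChart p (formOf σ)) ≤ R → ∀ y ∈ S, (y, formJet σ p y) ∈ K₂ := by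
    intro σ hσK h y hy
    refine ⟨⟨bundleParam p (y, inChart p (formOf σ) y), ⟨?_, y, hy, rfl⟩, ?_⟩, ?_⟩
    · rw [bundleParam_inChart (hS hy)]
      exact hσK _
    · exact bundleCoord_bundleParam (hS hy) _
    · have h1 : ‖formJet σ p y‖ₑ ≤ (c₁ * R : ℝ≥0) :=
        ((enorm_le_supNorm hy).trans (supNorm_le_hnorm _)).trans (hR σ h)
      have h2 : ‖formJet σ p y‖ ≤ (c₁ * R : ℝ≥0) := by
        rw [enorm_eq_nnnorm, ENNReal.coe_le_coe] at h1
        exact h1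
      exact (norm_snd_le _).trans h2
  have hΩ : ∀ σ ∈ T.sections, ∀ y ∈ (extChartAt (𝓡 4) p).target,
      (y, formJet σ p y) ∈ T.jetDom p := fun σ hσ y hy => (mem_chartDom_iff hy σ).2 (hσ _)
  have h1 := hc₂ (formJet σ p) (formJet η p) (contDiffOn_formJet σ p) (contDiffOn_formJet η p)
    (hΩ σ hσ) (hΩ η hη) (hmem σ hσK hσR) (hmem η hηK hηR) (hR σ hσR) (hR η hηR)
  have h2 : hnorm r α S
      (inChart p (T.nonlinearPart hφ hι σ - T.nonlinearPart hφ hι η).val.val) =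
      hnorm r α S (fun y => T.chartN p (y, formJet σ p y) - T.chartN p (y, formJet η p y)) :=
    hnorm_congr fun y hy => by
      filter_upwards [hV.mem_nhds (hS hy)] with z hz
      rw [← inChart_nonlinearPart hφ hι hσ hz, ← inChart_nonlinearPart hφ hι hη hz]
      rfl
  have h3 : hnorm r α S (fun y => formJet σ p y - formJet η p y) =
      hnorm r α S (formJet (σ - η) p) :=
    hnorm_congr fun y hy => by
      filter_upwards [hV.mem_nhds (hS hy)] with z hz
      exact (formJet_sub σ η hz).symm
  rw [h2]
  refine h1.trans ?_
  rw [h3]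
  calc _ ≤ (c₂ : ℝ≥0∞) * (c₁ * hnorm (r + 1) α S (inChart p (formOf σ)) +
        c₁ * hnorm (r + 1) α S (inChart p (formOf η))) *
        (c₁ * hnorm (r + 1) α S (inChart p (formOf (σ - η)))) := by
        gcongr
        · exact hjet σ
        · exact hjet η
        · exact hjet (σ - η)
    _ = _ := by push_cast; ring

/-- The quadratic estimate for the nonlinear part. -/
theorem exists_holderNorm_nonlinearPart_sub_le [T2Space M] (hφ : IsClosedG2Structure φ)
    (hι : IsCoassociativeImmersion φ ι) (r : ℕ) {α : ℝ} (hα : α ∈ Ioo (0 : ℝ) 1)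
    (𝒜 : BallCover 4 M) {K : Set (TwoFormBundle M)} (hK : IsCompact K) (hKU : K ⊆ T.U) (R : ℝ≥0) :
    ∃ c : ℝ≥0, 0 < c ∧ ∀ σ ∈ T.sections, ∀ η ∈ T.sections,
      (∀ x, (⟨x, formOf σ x⟩ : TwoFormBundle M) ∈ K) →
      (∀ x, (⟨x, formOf η x⟩ : TwoFormBundle M) ∈ K) →
      𝒜.holderNorm (r + 1) α (formOf σ) ≤ R →
      𝒜.holderNorm (r + 1) α (formOf η) ≤ R →
      𝒜.holderNorm r α (T.nonlinearPart hφ hι σ - T.nonlinearPart hφ hι η).val.val ≤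
        c * (𝒜.holderNorm (r + 1) α (formOf σ) + 𝒜.holderNorm (r + 1) α (formOf η)) *
          𝒜.holderNorm (r + 1) α (formOf (σ - η)) := by
  choose c hc using fun i => exists_hnorm_nonlinearPart_sub_le (T := T) hφ hι r hα (𝒜.subset i)
    hK hKU R
  refine ⟨1 + ∑ i, c i, by positivity, fun σ hσ η hη hσK hηK hσR hηR => ?_⟩
  have hle : ∀ (q k : ℕ) (θ : RawForm 4 k M) (i : Fin 𝒜.size),
      hnorm q α (Metric.closedBall (𝒜.center i) (𝒜.radius i)) (inChart (𝒜.base i) θ) ≤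
        𝒜.holderNorm q α θ := fun q k θ i =>
    le_iSup (fun i => hnorm q α (Metric.closedBall (𝒜.center i) (𝒜.radius i))
      (inChart (𝒜.base i) θ)) i
  refine iSup_le fun i => ?_
  refine (hc i σ hσ η hη hσK hηK ((hle _ _ _ i).trans hσR) ((hle _ _ _ i).trans hηR)).trans ?_
  have hci : c i ≤ 1 + ∑ i, c i :=
    (Finset.single_le_sum (fun _ _ => zero_le) (Finset.mem_univ i)).trans le_add_self
  gcongr <;> exact hle _ _ _ i

end TubularNeighborhood

end Estimate

end Coassociative

end

theorem proposition3p3 {M Y : Type*}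
    [TopologicalSpace M] [T2Space M] [SecondCountableTopology M]
    [ChartedSpace (EuclideanSpace ℝ (Fin 4)) M] [IsManifold (𝓡 4) ∞ M]
    [TopologicalSpace Y] [T2Space Y] [SecondCountableTopology Y]
    [ChartedSpace (EuclideanSpace ℝ (Fin 7)) Y] [IsManifold (𝓡 7) ∞ Y]
    (φ : Coassociative.RawForm 7 3 Y) (hφ : Coassociative.IsClosedG2Structure φ)
    (ι : M → Y) (hι : Coassociative.IsCoassociativeImmersion φ ι)
    (T : Coassociative.TubularNeighborhood φ ι) :
    (∀ σ ∈ T.sections, ∃ θ ∈ Coassociative.exactForms 4 2 M, T.F σ = θ.val) ∧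
    ∃ N : Coassociative.selfDualForms φ ι → Coassociative.exactForms 4 2 M,
      (∀ σ ∈ T.sections,
        T.F σ = Coassociative.extD (Coassociative.formOf σ) + (N σ).val.val) ∧
      (CompactSpace M →
        Coassociative.IsFrechetSmoothOn N T.sections ∧
        ∀ r : ℕ, ∀ α ∈ Ioo (0 : ℝ) 1, ∀ 𝒜 : Coassociative.BallCover 4 M,
        ∀ K : Set (Coassociative.TwoFormBundle M), IsCompact K → K ⊆ T.U → ∀ R : ℝ≥0,
        ∃ c : ℝ≥0, 0 < c ∧ ∀ σ ∈ T.sections, ∀ η ∈ T.sections,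
          (∀ x, (⟨x, Coassociative.formOf σ x⟩ : Coassociative.TwoFormBundle M) ∈ K) →
          (∀ x, (⟨x, Coassociative.formOf η x⟩ : Coassociative.TwoFormBundle M) ∈ K) →
          𝒜.holderNorm (r + 1) α (Coassociative.formOf σ) ≤ R →
          𝒜.holderNorm (r + 1) α (Coassociative.formOf η) ≤ R →
          𝒜.holderNorm r α (N σ - N η).val.val ≤
            c * (𝒜.holderNorm (r + 1) α (Coassociative.formOf σ) +
                𝒜.holderNorm (r + 1) α (Coassociative.formOf η)) *
              𝒜.holderNorm (r + 1) α (Coassociative.formOf (σ - η))) := by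
  refine ⟨fun σ hσ => ?_, T.nonlinearPart hφ hι, fun σ hσ => T.F_eq_nonlinearPart hφ hι hσ,
    fun hM => ⟨T.isFrechetSmoothOn_nonlinearPart hφ hι, ?_⟩⟩
  · refine ⟨Coassociative.dForm σ.1 + (T.nonlinearPart hφ hι σ).1, ?_, ?_⟩
    · exact add_mem (Coassociative.dForm σ.1).2 (T.nonlinearPart hφ hι σ).2
    · exact T.F_eq_nonlinearPart hφ hι hσ
  · exact fun r α hα 𝒜 K hK hKU R =>
      T.exists_holderNorm_nonlinearPart_sub_le hφ hι r hα 𝒜 hK hKU R
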